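/- Let $M$ be a finite-dimensional, Hausdorff, second countable real analytic manifold (without boundary) and $\star\in M$. \emph{Loops.} A path $\gamma:[0,1]\to M$ is piecewise analytic if it is continuous and, for some partition $0=t_0\le\dots\le t_n=1$, agrees on each $[t_i,t_{i+1}]$ with an analytic map. Let $Loop_\star(M)$ be the group, under composition, of piecewise analytic loops based at $\star$ modulo the equivalence relation generated by order preserving (continuous, monotone, end point preserving) reparametrizations and by the insertion of retracings, $pq\sim p\,\gamma\gamma^{-1}q$. An edge is an analytic path $e:[0,1]\to M$ whose restriction to $(0,1)$ is an embedding; its vertices are $e(0)$ and $e(1)$. A finite family of loops $\beta_1,\dots,\beta_n$ ($n\ge 0$) is independent if the union of their images is a finite embedded graph (a union of the images of finitely many edges, distinct edges meeting only in common vertices) such that every $\beta_i$ has an edge $e_i$ of the graph whose interior points are passed exactly once by $\beta_i$ and whose image meets the other loops at most in the vertices of $e_i$. Let $J$ be the set of subgroups $L\subseteq Loop_\star(M)$ generated by the classes of a finite independent family, ordered by inclusion. \emph{Spaces.} For a group $\Lambda$, $Hom(\Lambda,U(1))$ carries pointwise multiplication and the topology of pointwise convergence; it is a compact Abelian group. Put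 $\overline{\mathcal A/\mathcal G}=Hom(Loop_\star(M),U(1))$, with normalized Haar measure $\mu_0$, and, for $L\in J$, $\overline{\mathcal A/\mathcal G}_L=Hom(L,U(1))$, with normalized Haar measure $\mu_L$ and (discrete) dual group $\mathcal W_L$. For $\alpha\in Loop_\star(M)$ let $T_\alpha(H)=H(\alpha)$ be the Wilson function, and let $\mathcal W=Hoop_\star(M)=\{T_\alpha\}$ be the group of hoops, with pointwise multiplication and the discrete topology. $L^2$ of a discrete group is taken with respect to counting measure. \emph{Inductive limits.} An inductive family of Hilbert spaces over a (nonempty) directed set $J$ consists of Hilbert spaces $\mathcal H_\mu$ and isometric linear maps $i_{\nu\mu}:\mathcal H_\mu\to\mathcal H_\nu$ ($\mu\le\nu$) with $i_{\mu\mu}=\mathrm{id}$ and $i_{\lambda\nu}i_{\nu\mu}=i_{\lambda\mu}$. A Hilbert space $\mathcal H$ with isometric linear maps $i_\mu:\mathcal H_\mu\to\mathcal H$ such that $i_\nu i_{\nu\mu}=i_\mu$ is its inductive limit if the images of the $i_\mu$ cover a dense linear subspace of $\mathcal H$. Given a second such family $(\mathcal H'_\mu,i'_{\nu\mu})$ with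 limit $(\mathcal H',i'_\mu)$, unitary maps $\phi_\mu:\mathcal H_\mu\to\mathcal H'_\mu$ form an inductive family if $i'_{\nu\mu}\phi_\mu=\phi_\nu i_{\nu\mu}$ for $\mu\le\nu$, and their inductive limit is the unique unitary map $\phi:\mathcal H\to\mathcal H'$ with $\phi\, i_\mu=i'_\mu\phi_\mu$ for all $\mu$. \textbf{Theorem.} For every independent family $\beta_1,\dots,\beta_n$ with generated subgroup $L$, the evaluation $H\mapsto(H(\beta_1),\dots,H(\beta_n))$ is an isomorphism of topological groups $\overline{\mathcal A/\mathcal G}_L\to U(1)^n$, and composition with it is a unitary map $L^2(U(1)^n)\to L^2(\overline{\mathcal A/\mathcal G}_L)$. Moreover the following maps are well defined: the isometric linear inclusions $i_{L'L}:L^2(\overline{\mathcal A/\mathcal G}_L)\to L^2(\overline{\mathcal A/\mathcal G}_{L'})$, for $L\le L'$ in $J$, and $i_L:L^2(\overline{\mathcal A/\mathcal G}_L)\to L^2(\overline{\mathcal A/\mathcal G})$, given by $(i_{L'L}\psi)(H)=\psi(H|_L)$ and $(i_L\psi)(H)=\psi(H|_L)$; the Fourier transforms $F_L:L^2(\overline{\mathcal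 A/\mathcal G}_L)\to L^2(\mathcal W_L)$, $(F_L\psi)(\chi)=\int\overline{\chi}\,\psi\,d\mu_L$, which are unitary; the loop transform $\mathcal L:L^2(\overline{\mathcal A/\mathcal G})\to L^2(Hoop_\star(M))$, $(\mathcal L\psi)(T_\alpha)=\int\overline{T_\alpha}\,\psi\,d\mu_0$, which is unitary (in particular its range is all of $L^2(Hoop_\star(M))$); and the isometric linear inclusions $j_{L'L}=F_{L'}\,i_{L'L}\,F_L^{-1}$ and $j_L=\mathcal L\,i_L\,F_L^{-1}$. With these maps: \begin{enumerate} \item $J$ is directed, and $L^2(\overline{\mathcal A/\mathcal G})$, with the inclusions $i_L$, is the inductive limit of the inductive family $\{L^2(\overline{\mathcal A/\mathcal G}_L),i_{L'L}\}_{L\in J}$; \item $L^2(\mathcal W)=L^2(Hoop_\star(M))$, with the inclusions $j_L$, is the inductive limit of the inductive family $\{L^2(\mathcal W_L),j_{L'L}\}_{L\in J}$; \item the loop transform $\mathcal L$ is the inductive limit of the inductive family of unitary maps $\{F_L\}_{L\in J}$. \end{enumerate} -/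

import Mathlib

open Set MeasureTheory Topology
open scoped Manifold ContDiff unitInterval ComplexConjugate

/-! ### Piecewise analytic paths -/

section Paths

variable (E : Type*) [NormedAddCommGroup E] [NormedSpace ℝ E]
  {M : Type*} [TopologicalSpace M] [ChartedSpace E M]

/-- `f` agrees on `[a, b]` with a map that is real analytic (in a neighbourhood of each point
of `[a, b]`). -/
def AgreesWithAnalytic (f : ℝ → M) (a b : ℝ) : Prop :=
  ∃ η : ℝ → M, (∀ s ∈ Icc a b, ContMDiffAt 𝓘(ℝ, ℝ) 𝓘(ℝ, E) ω η s) ∧ EqOn f η (Icc a b)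

/-- A continuous path is piecewise analytic if there is a partition
`0 = t₀ ≤ t₁ ≤ ⋯ ≤ tₙ = 1` such that it agrees with an analytic map on each `[tᵢ, tᵢ₊₁]`. -/
def IsPiecewiseAnalytic {x y : M} (γ : Path x y) : Prop :=
  ∃ (n : ℕ) (t : ℕ → ℝ), Monotone t ∧ t 0 = 0 ∧ t n = 1 ∧
    ∀ i < n, AgreesWithAnalytic E γ.extend (t i) (t (i + 1))

variable {E}

theorem AgreesWithAnalytic.comp_affine {f g : ℝ → M} {a b a' b' : ℝ}
    (h : AgreesWithAnalytic E f a b) (c d : ℝ)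
    (hmaps : ∀ s ∈ Icc a' b', c * s + d ∈ Icc a b) (hg : ∀ s ∈ Icc a' b', g s = f (c * s + d)) :
    AgreesWithAnalytic E g a' b' := by
  obtain ⟨η, hη, hEq⟩ := h
  refine ⟨fun s => η (c * s + d), fun s hs => ?_, fun s hs => ?_⟩
  · have h1 : ContMDiffAt 𝓘(ℝ, ℝ) 𝓘(ℝ, ℝ) ω (fun s : ℝ => c * s + d) s := by
      apply ContDiffAt.contMDiffAt
      fun_prop
    exact ContMDiffAt.comp (g := η) (f := fun s : ℝ => c * s + d) s (hη _ (hmaps s hs)) h1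
  · rw [hg s hs]
    exact hEq (hmaps s hs)

theorem IsPiecewiseAnalytic.refl (x : M) : IsPiecewiseAnalytic E (Path.refl x) :=
  ⟨1, fun n => n, Nat.mono_cast, by simp, by simp, fun _ _ =>
    ⟨fun _ => x, fun _ _ => contMDiffAt_const, fun _ _ => by simp⟩⟩

theorem IsPiecewiseAnalytic.symm {x y : M} {γ : Path x y} (h : IsPiecewiseAnalytic E γ) :
    IsPiecewiseAnalytic E γ.symm := by
  obtain ⟨n, t, ht, h0, h1, hp⟩ := h
  refine ⟨n, fun k => 1 - t (n - k), fun k l hkl => ?_, by simp [h1], by simp [h0],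
    fun i hi => ?_⟩
  · have := ht (Nat.sub_le_sub_left hkl n)
    dsimp only
    linarith
  · have e : n - i = (n - (i + 1)) + 1 := by omega
    refine (hp (n - (i + 1)) (by omega)).comp_affine (-1) 1 (fun s hs => ?_) (fun s hs => ?_)
    · rw [← e]
      constructor <;> linarith [hs.1, hs.2]
    · rw [Path.extend_symm_apply]
      congr 1
      ring

theorem IsPiecewiseAnalytic.trans {x y z : M} {γ : Path x y} {γ' : Path y z}
    (h : IsPiecewiseAnalytic E γ) (h' : IsPiecewiseAnalytic E γ') :
    IsPiecewiseAnalytic E (γ.trans γ') := by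
  obtain ⟨n, t, ht, h0, h1, hp⟩ := h
  obtain ⟨m, u, hu, h0', h1', hp'⟩ := h'
  have htn : ∀ k ≤ n, t k ≤ 1 := fun k hk => h1 ▸ ht hk
  have hu0 : ∀ k, 0 ≤ u k := fun k => h0' ▸ hu (Nat.zero_le k)
  have ht0 : ∀ k, 0 ≤ t k := fun k => h0 ▸ ht (Nat.zero_le k)
  have hum : ∀ k ≤ m, u k ≤ 1 := fun k hk => h1' ▸ hu hk
  let v : ℕ → ℝ := fun k => if k ≤ n then t k / 2 else (1 + u (k - n)) / 2
  have hv1 : ∀ k ≤ n, v k = t k / 2 := fun k hk => if_pos hk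
  have hv2 : ∀ k, n ≤ k → v k = (1 + u (k - n)) / 2 := by
    intro k hk
    rcases hk.eq_or_lt with rfl | hk
    · rw [hv1 _ le_rfl, h1]
      simp [h0']
    · exact if_neg (by omega)
  refine ⟨n + m, v, fun k l hkl => ?_, ?_, ?_, fun i hi => ?_⟩
  · by_cases hl : l ≤ n
    · rw [hv1 k (hkl.trans hl), hv1 l hl]
      linarith [ht hkl]
    · rw [hv2 l (by omega)]
      by_cases hk : k ≤ n
      · rw [hv1 k hk]
        linarith [htn k hk, hu0 (l - n)]
      · rw [hv2 k (by omega)]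
        linarith [hu (Nat.sub_le_sub_right hkl n)]
  · rw [hv1 0 (Nat.zero_le _), h0]
    simp
  · rw [hv2 _ (by omega), Nat.add_sub_cancel_left, h1']
    norm_num
  · by_cases hin : i < n
    · rw [hv1 i hin.le, hv1 (i + 1) hin]
      refine (hp i hin).comp_affine 2 0 (fun s hs => ?_) (fun s hs => ?_)
      · constructor <;> linarith [hs.1, hs.2]
      · rw [Path.extend_trans_of_le_half _ _ (by linarith [hs.2, htn (i + 1) hin])]
        simp
    · have e : i + 1 - n = (i - n) + 1 := by omega
      rw [hv2 i (by omega), hv2 (i + 1) (by omega), e]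
      refine (hp' (i - n) (by omega)).comp_affine 2 (-1) (fun s hs => ?_) (fun s hs => ?_)
      · constructor <;> linarith [hs.1, hs.2]
      · rw [Path.extend_trans_of_half_le _ _ (by linarith [hs.1, hu0 (i - n)])]
        rfl

variable (E)

/-- Piecewise analytic paths from `x` to `y`, parametrized by the unit interval. -/
def PAPath (x y : M) : Type _ := {γ : Path x y // IsPiecewiseAnalytic E γ}

variable {E}

namespace PAPath

/-- The constant path. -/
def refl (x : M) : PAPath E x x := ⟨Path.refl x, .refl x⟩

/-- The reversed path `γ⁻¹`. -/
def symm {x y : M} (γ : PAPath E x y) : PAPath E y x := ⟨γ.1.symm, γ.2.symm⟩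

/-- The composition `γ γ'`: first `γ`, then `γ'`. -/
noncomputable def trans {x y z : M} (γ : PAPath E x y) (γ' : PAPath E y z) : PAPath E x z :=
  ⟨γ.1.trans γ'.1, γ.2.trans γ'.2⟩

end PAPath

/-! ### The group of loops -/

/-- The two elementary moves between piecewise analytic paths with the same end points:
an order preserving reparametrization, and the insertion of a retracing `γ γ⁻¹`. -/
inductive ElementaryMove {x y : M} : PAPath E x y → PAPath E x y → Prop
  | reparam (α β : PAPath E x y) (φ : I → I) (hφ : Continuous φ) (hmono : Monotone φ)
      (h0 : φ 0 = 0) (h1 : φ 1 = 1) (h : ∀ t, β.1 t = α.1 (φ t)) : ElementaryMove α β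
  | retrace {z w : M} (p : PAPath E x z) (q : PAPath E z y) (γ : PAPath E z w) :
      ElementaryMove (p.trans q) (p.trans ((γ.trans γ.symm).trans q))

variable (E)

/-- Elementary equivalence: equivalence up to reparametrizations and immediate retracings. -/
def elementarySetoid (x y : M) : Setoid (PAPath E x y) :=
  Relation.EqvGen.setoid ElementaryMove

/-- The group of loops based at `x`: piecewise analytic loops modulo elementary equivalence. -/
def LoopGroup (x : M) : Type _ := Quotient (elementarySetoid E x x)

variable {E}

/-- The class of a parametrized loop in the group of loops. -/
def loopClass {x : M} (α : PAPath E x x) : LoopGroup E x :=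
  Quotient.mk (elementarySetoid E x x) α

namespace PAPath

theorem rel_of_move {x y : M} {α β : PAPath E x y} (h : ElementaryMove α β) :
    elementarySetoid E x y α β :=
  Relation.EqvGen.rel _ _ h

theorem rel_reparam {x y : M} (α β : PAPath E x y) (φ : I → I) (hφ : Continuous φ)
    (hmono : Monotone φ) (h0 : φ 0 = 0) (h1 : φ 1 = 1) (h : ∀ t, β.1 t = α.1 (φ t)) :
    elementarySetoid E x y α β :=
  rel_of_move (.reparam α β φ hφ hmono h0 h1 h)

theorem rel_assoc {x y z w : M} (p : PAPath E x y) (q : PAPath E y z) (r : PAPath E z w) :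
    elementarySetoid E x w (p.trans (q.trans r)) ((p.trans q).trans r) := by
  refine rel_reparam _ _
    (fun t => ⟨Path.Homotopy.transAssocReparamAux t, Path.Homotopy.transAssocReparamAux_mem_I t⟩)
    (by fun_prop) ?_ (Subtype.ext Path.Homotopy.transAssocReparamAux_zero)
    (Subtype.ext Path.Homotopy.transAssocReparamAux_one) ?_
  · intro s t hst
    have hst' : (s : ℝ) ≤ t := hst
    change Path.Homotopy.transAssocReparamAux s ≤ Path.Homotopy.transAssocReparamAux t
    unfold Path.Homotopy.transAssocReparamAux
    split_ifs <;> linarith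
  · intro t
    change ((p.1.trans q.1).trans r.1) t = _
    rw [Path.Homotopy.trans_assoc_reparam]
    rfl

theorem rel_trans_refl {x y : M} (p : PAPath E x y) :
    elementarySetoid E x y p (p.trans (refl y)) := by
  refine rel_reparam _ _
    (fun t => ⟨Path.Homotopy.transReflReparamAux t, Path.Homotopy.transReflReparamAux_mem_I t⟩)
    (by fun_prop) ?_ (Subtype.ext Path.Homotopy.transReflReparamAux_zero)
    (Subtype.ext Path.Homotopy.transReflReparamAux_one) ?_
  · intro s t hst
    have hst' : (s : ℝ) ≤ t := hst
    change Path.Homotopy.transReflReparamAux s ≤ Path.Homotopy.transReflReparamAux t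
    unfold Path.Homotopy.transReflReparamAux
    split_ifs <;> linarith [unitInterval.le_one s, unitInterval.le_one t]
  · intro t
    change (p.1.trans (Path.refl y)) t = _
    rw [Path.Homotopy.trans_refl_reparam]
    rfl

theorem rel_symm {x y : M} {p q : PAPath E x y} (h : elementarySetoid E x y p q) :
    elementarySetoid E x y q p := (elementarySetoid E x y).symm h

theorem rel_tr {x y : M} {p q r : PAPath E x y} (h : elementarySetoid E x y p q)
    (h' : elementarySetoid E x y q r) : elementarySetoid E x y p r :=
  (elementarySetoid E x y).trans h h'

theorem rel_refl_trans {x y : M} (p : PAPath E x y) :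
    elementarySetoid E x y p ((refl x).trans p) := by
  refine rel_reparam _ _ (fun t => ⟨max 0 (2 * (t : ℝ) - 1), ?_⟩) ?_ ?_ ?_ ?_ ?_
  · constructor
    · exact le_max_left _ _
    · exact max_le zero_le_one (by linarith [unitInterval.le_one t])
  · fun_prop
  · intro s t hst
    have hst' : (s : ℝ) ≤ t := hst
    change max 0 (2 * (s : ℝ) - 1) ≤ max 0 (2 * (t : ℝ) - 1)
    exact max_le_max le_rfl (by linarith)
  · exact Subtype.ext (by norm_num)
  · exact Subtype.ext (by norm_num)
  · intro t
    change ((Path.refl x).trans p.1) t = _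
    rw [Path.trans_apply]
    split_ifs with h
    · have : max 0 (2 * (t : ℝ) - 1) = 0 := max_eq_left (by linarith)
      simp only [this, Path.refl_apply]
      exact p.1.source.symm
    · congr 1
      exact Subtype.ext (max_eq_right (by linarith [not_le.1 h])).symm

theorem rel_trans_of_reparam {x y z : M} {a b : PAPath E x y} {c d : PAPath E y z}
    (φ ψ : I → I) (hφ : Continuous φ) (hφm : Monotone φ) (hφ0 : φ 0 = 0) (hφ1 : φ 1 = 1)
    (hψ : Continuous ψ) (hψm : Monotone ψ) (hψ0 : ψ 0 = 0) (hψ1 : ψ 1 = 1)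
    (hab : ∀ t, b.1 t = a.1 (φ t)) (hcd : ∀ t, d.1 t = c.1 (ψ t)) :
    elementarySetoid E x z (a.trans c) (b.trans d) := by
  have m1 : ∀ t : I, (t : ℝ) / 2 ∈ I := fun t => ⟨by linarith [t.2.1], by linarith [t.2.2]⟩
  have m2 : ∀ t : I, (1 + (t : ℝ)) / 2 ∈ I := fun t => ⟨by linarith [t.2.1], by linarith [t.2.2]⟩
  let P : Path (0 : I) ⟨1 / 2, by norm_num, by norm_num⟩ :=
    { toFun := fun t => ⟨(φ t : ℝ) / 2, m1 _⟩
      continuous_toFun := by fun_prop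
      source' := Subtype.ext (by simp [hφ0])
      target' := Subtype.ext (by simp [hφ1]) }
  let Q : Path (⟨1 / 2, by norm_num, by norm_num⟩ : I) 1 :=
    { toFun := fun t => ⟨(1 + (ψ t : ℝ)) / 2, m2 _⟩
      continuous_toFun := by fun_prop
      source' := Subtype.ext (by simp [hψ0])
      target' := Subtype.ext (by simp [hψ1]) }
  have hP : ∀ t, (P t : ℝ) = φ t / 2 := fun _ => rfl
  have hQ : ∀ t, (Q t : ℝ) = (1 + ψ t) / 2 := fun _ => rfl
  refine rel_reparam _ _ (P.trans Q) (P.trans Q).continuous ?_ (P.trans Q).source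
    (P.trans Q).target ?_
  · intro s t hst
    have hst' : (s : ℝ) ≤ t := hst
    change ((P.trans Q) s : ℝ) ≤ (P.trans Q) t
    rw [Path.trans_apply, Path.trans_apply]
    split_ifs with hs ht ht
    · rw [hP, hP]
      have h : φ ⟨2 * s, (unitInterval.mul_pos_mem_iff zero_lt_two).2 ⟨s.2.1, hs⟩⟩ ≤
          φ ⟨2 * t, (unitInterval.mul_pos_mem_iff zero_lt_two).2 ⟨t.2.1, ht⟩⟩ :=
        hφm (Subtype.mk_le_mk.2 (by linarith))
      have h' := Subtype.coe_le_coe.2 h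
      linarith
    · rw [hP, hQ]
      have h1 := (φ ⟨2 * s, (unitInterval.mul_pos_mem_iff zero_lt_two).2 ⟨s.2.1, hs⟩⟩).2.2
      have h2 := (ψ ⟨2 * t - 1, unitInterval.two_mul_sub_one_mem_iff.2
        ⟨(not_le.1 ht).le, t.2.2⟩⟩).2.1
      linarith
    · linarith
    · rw [hQ, hQ]
      have h : ψ ⟨2 * s - 1, unitInterval.two_mul_sub_one_mem_iff.2 ⟨(not_le.1 hs).le, s.2.2⟩⟩ ≤
          ψ ⟨2 * t - 1, unitInterval.two_mul_sub_one_mem_iff.2 ⟨(not_le.1 ht).le, t.2.2⟩⟩ :=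
        hψm (Subtype.mk_le_mk.2 (by linarith))
      have h' := Subtype.coe_le_coe.2 h
      linarith
  · intro t
    change (b.1.trans d.1) t = (a.1.trans c.1) ((P.trans Q) t)
    have key : ((P.trans Q) t) = if h : (t : ℝ) ≤ 1 / 2 then
        P ⟨2 * t, (unitInterval.mul_pos_mem_iff zero_lt_two).2 ⟨t.2.1, h⟩⟩
        else Q ⟨2 * t - 1, unitInterval.two_mul_sub_one_mem_iff.2 ⟨(not_le.1 h).le, t.2.2⟩⟩ :=
      Path.trans_apply _ _ _
    rw [← Path.extend_extends' (a.1.trans c.1), key]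
    by_cases ht : (t : ℝ) ≤ 1 / 2
    · rw [dif_pos ht, hP, Path.extend_trans_of_le_half, Path.trans_apply, dif_pos ht, hab,
        ← Path.extend_extends']
      · congr 1
        ring
      · linarith [(φ ⟨2 * t, (unitInterval.mul_pos_mem_iff zero_lt_two).2 ⟨t.2.1, ht⟩⟩).2.2]
    · rw [dif_neg ht, hQ, Path.extend_trans_of_half_le, Path.trans_apply, dif_neg ht, hcd,
        ← Path.extend_extends']
      · congr 1
        ring
      · linarith [(ψ ⟨2 * t - 1, unitInterval.two_mul_sub_one_mem_iff.2
          ⟨(not_le.1 ht).le, t.2.2⟩⟩).2.1]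

theorem rel_trans_right {x y z : M} (p : PAPath E x y) {q q' : PAPath E y z}
    (h : elementarySetoid E y z q q') : elementarySetoid E x z (p.trans q) (p.trans q') := by
  induction h with
  | refl => exact (elementarySetoid E x z).refl _
  | symm _ _ _ ih => exact rel_symm ih
  | trans _ _ _ _ _ ih ih' => exact rel_tr ih ih'
  | rel a b hab =>
    cases hab with
    | reparam _ _ φ hφ hmono h0 h1 h =>
      exact rel_trans_of_reparam id φ continuous_id monotone_id rfl rfl hφ hmono h0 h1
        (fun _ => rfl) h
    | retrace u v γ =>
      exact rel_tr (rel_assoc _ _ _) (rel_tr (rel_of_move (.retrace _ _ γ))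
        (rel_symm (rel_assoc _ _ _)))

theorem rel_trans_left {x y z : M} {p p' : PAPath E x y} (q : PAPath E y z)
    (h : elementarySetoid E x y p p') : elementarySetoid E x z (p.trans q) (p'.trans q) := by
  induction h with
  | refl => exact (elementarySetoid E x z).refl _
  | symm _ _ _ ih => exact rel_symm ih
  | trans _ _ _ _ _ ih ih' => exact rel_tr ih ih'
  | rel a b hab =>
    cases hab with
    | reparam _ _ φ hφ hmono h0 h1 h =>
      exact rel_trans_of_reparam φ id hφ hmono h0 h1 continuous_id monotone_id rfl rfl
        h (fun _ => rfl)
    | retrace u v γ =>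
      refine rel_tr (rel_symm (rel_assoc _ _ _)) (rel_tr (rel_of_move (.retrace _ _ γ)) ?_)
      exact rel_tr (rel_trans_right _ (rel_assoc _ _ _)) (rel_assoc _ _ _)

theorem rel_trans {x y z : M} {p p' : PAPath E x y} {q q' : PAPath E y z}
    (h : elementarySetoid E x y p p') (h' : elementarySetoid E y z q q') :
    elementarySetoid E x z (p.trans q) (p'.trans q') :=
  rel_tr (rel_trans_left q h) (rel_trans_right p' h')

theorem rel_trans_symm {x y : M} (p : PAPath E x y) :
    elementarySetoid E x x (refl x) (p.trans p.symm) :=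
  rel_tr (rel_trans_refl _) (rel_tr (rel_of_move (.retrace _ _ p))
    (rel_tr (rel_symm (rel_refl_trans _)) (rel_symm (rel_trans_refl _))))

theorem symm_symm {x y : M} (p : PAPath E x y) : p.symm.symm = p :=
  Subtype.ext (Path.symm_symm p.1)

theorem rel_symm_trans {x y : M} (p : PAPath E x y) :
    elementarySetoid E y y (refl y) (p.symm.trans p) := by
  have h := rel_trans_symm p.symm
  rwa [symm_symm] at h

theorem rel_inv {x y : M} {p q : PAPath E x y} (h : elementarySetoid E x y p q) :
    elementarySetoid E y x p.symm q.symm :=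
  rel_tr (rel_trans_refl _) <| rel_tr (rel_trans_right _ (rel_trans_symm q)) <|
    rel_tr (rel_assoc _ _ _) <|
    rel_tr (rel_trans_left _ (rel_trans_right _ (rel_symm h))) <|
    rel_tr (rel_trans_left _ (rel_symm (rel_symm_trans p))) (rel_symm (rel_refl_trans _))

end PAPath

noncomputable instance (x : M) : Group (LoopGroup E x) where
  mul := Quotient.map₂ PAPath.trans fun _ _ h _ _ h' => PAPath.rel_trans h h'
  one := loopClass (PAPath.refl x)
  inv := Quotient.map PAPath.symm fun _ _ h => PAPath.rel_inv h
  mul_assoc := by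
    rintro ⟨a⟩ ⟨b⟩ ⟨c⟩
    exact Quotient.sound (PAPath.rel_symm (PAPath.rel_assoc a b c))
  one_mul := by
    rintro ⟨a⟩
    exact Quotient.sound (PAPath.rel_symm (PAPath.rel_refl_trans a))
  mul_one := by
    rintro ⟨a⟩
    exact Quotient.sound (PAPath.rel_symm (PAPath.rel_trans_refl a))
  inv_mul_cancel := by
    rintro ⟨a⟩
    exact Quotient.sound (PAPath.rel_symm (PAPath.rel_symm_trans a))

/-! ### Graphs and independent families of loops -/

variable (E)

/-- An edge: an analytic path `e : [0, 1] → M` whose restriction to `(0, 1)` is an embedding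
(an immersion and a homeomorphism onto its image). Only the values on `[0, 1]` matter. -/
structure IsEdge (e : ℝ → M) : Prop where
  analytic : ∀ t ∈ Icc (0 : ℝ) 1, ContMDiffAt 𝓘(ℝ, ℝ) 𝓘(ℝ, E) ω e t
  immersion : ∀ t ∈ Ioo (0 : ℝ) 1, mfderiv 𝓘(ℝ, ℝ) 𝓘(ℝ, E) e t ≠ 0
  embedding : IsEmbedding ((Ioo (0 : ℝ) 1).domRestrict e)

/-- The vertices of an edge. -/
def edgeVertices (e : ℝ → M) : Set M := {e 0, e 1}

/-- The edges `e₁, …, eₘ` form a finite embedded graph with underlying set `Γ`: distinct edges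
meet only in common vertices, and the union of their images is `Γ`. -/
structure IsGraph {m : ℕ} (e : Fin m → ℝ → M) (Γ : Set M) : Prop where
  isEdge : ∀ k, IsEdge E (e k)
  inter : ∀ k l, k ≠ l →
    e k '' Icc 0 1 ∩ e l '' Icc 0 1 ⊆ edgeVertices (e k) ∩ edgeVertices (e l)
  union : ⋃ k, e k '' Icc 0 1 = Γ

variable {E}

/-- The loops `β₁, …, βₙ` are independent: their images form a finite embedded graph such that
every `βᵢ` has an edge whose interior points are passed exactly once by `βᵢ`, and which meets the
other loops at most in its vertices. -/
def IndependentLoops {x : M} {n : ℕ} (β : Fin n → PAPath E x x) : Prop :=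
  ∃ (m : ℕ) (e : Fin m → ℝ → M), IsGraph E e (⋃ i, range (β i).1) ∧
    ∀ i, ∃ k : Fin m,
      (∀ s ∈ Ioo (0 : ℝ) 1, ∃! t : I, (β i).1 t = e k s) ∧
      ∀ j, j ≠ i → e k '' Icc 0 1 ∩ range (β j).1 ⊆ edgeVertices (e k)

/-- The subgroup of the group of loops generated by a finite family of loops. -/
noncomputable def generatedSubgroup {x : M} {n : ℕ} (β : Fin n → PAPath E x x) : Subgroup (LoopGroup E x) :=
  Subgroup.closure (range fun i => loopClass (β i))

variable (E)

/-- The index set: subgroups of the group of loops generated by a finite independent family,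
ordered by inclusion. -/
abbrev LoopIndex (x : M) : Type _ :=
  {L : Subgroup (LoopGroup E x) //
    ∃ (n : ℕ) (β : Fin n → PAPath E x x), IndependentLoops β ∧ L = generatedSubgroup β}

end Paths

/-! ### The compact groups `Hom(L, U(1))` and their Hilbert spaces -/

noncomputable section

/-- `Hom(G, U(1))`, with pointwise multiplication and the topology of pointwise convergence. -/
def HomU1 (G : Type*) [Group G] : Type _ := G →* Circle

namespace HomU1

variable {G : Type*} [Group G]

instance : CommGroup (HomU1 G) := inferInstanceAs (CommGroup (G →* Circle))

instance : FunLike (HomU1 G) G Circle := inferInstanceAs (FunLike (G →* Circle) G Circle)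

instance : MonoidHomClass (HomU1 G) G Circle :=
  inferInstanceAs (MonoidHomClass (G →* Circle) G Circle)

instance : TopologicalSpace (HomU1 G) :=
  TopologicalSpace.induced (fun (H : HomU1 G) (g : G) => H g) inferInstance

/-- The inclusion of `Hom(G, U(1))` in the product group `U(1)^G`. -/
def toPi : HomU1 G →* (G → Circle) where
  toFun H g := H g
  map_one' := rfl
  map_mul' _ _ := rfl

instance : IsTopologicalGroup (HomU1 G) := topologicalGroup_induced (toPi (G := G))

theorem isClosedEmbedding_toPi : IsClosedEmbedding (toPi (G := G)) where
  eq_induced := rfl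
  injective := fun _ _ h => DFunLike.ext _ _ fun g => congrFun h g
  isClosed_range := by
    have : range (toPi (G := G)) = ⋂ (a : G) (b : G), {f | f (a * b) = f a * f b} := by
      ext f
      simp only [mem_range, mem_iInter, mem_ofPred_eq]
      constructor
      · rintro ⟨H, rfl⟩ a b
        exact map_mul H a b
      · intro h
        exact ⟨MonoidHom.mk' f h, rfl⟩
    rw [this]
    refine isClosed_iInter fun a => isClosed_iInter fun b => isClosed_eq ?_ ?_ <;> fun_prop

instance : CompactSpace (HomU1 G) := isClosedEmbedding_toPi.compactSpace

instance : T2Space (HomU1 G) := isClosedEmbedding_toPi.isEmbedding.t2Space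

instance : MeasurableSpace (HomU1 G) := borel _

instance : BorelSpace (HomU1 G) := ⟨rfl⟩

theorem continuous_eval (g : G) : Continuous fun H : HomU1 G => H g :=
  (continuous_apply g).comp isClosedEmbedding_toPi.continuous

/-- The projection `Hom(G, U(1)) → Hom(L, U(1))`, restriction to the subgroup `L`. -/
def restrict (L : Subgroup G) (H : HomU1 G) : HomU1 L := MonoidHom.comp (H : G →* Circle) L.subtype

/-- The projection `Hom(L', U(1)) → Hom(L, U(1))`, restriction to `L ≤ L'`. -/
def restrictLE {L L' : Subgroup G} (h : L ≤ L') (H : HomU1 L') : HomU1 L :=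
  MonoidHom.comp (H : L' →* Circle) (Subgroup.inclusion h)

/-- The Wilson functions `T_α(H) = H(α)`, as characters of `Hom(G, U(1))`. -/
def wilson : G →* PontryaginDual (HomU1 G) where
  toFun α :=
    { toFun := fun H => H α
      map_one' := rfl
      map_mul' := fun _ _ => rfl
      continuous_toFun := continuous_eval α }
  map_one' := PontryaginDual.ext fun H => map_one H
  map_mul' α β := PontryaginDual.ext fun H => map_mul H α β

end HomU1

/-- The torus `U(1)ⁿ`. -/
def Torus (n : ℕ) : Type := Fin n → Circle

namespace Torus

variable (n : ℕ)

instance : CommGroup (Torus n) := inferInstanceAs (CommGroup (Fin n → Circle))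
instance : TopologicalSpace (Torus n) := inferInstanceAs (TopologicalSpace (Fin n → Circle))
instance : IsTopologicalGroup (Torus n) := inferInstanceAs (IsTopologicalGroup (Fin n → Circle))
instance : CompactSpace (Torus n) := inferInstanceAs (CompactSpace (Fin n → Circle))
instance : MeasurableSpace (Torus n) := borel _
instance : BorelSpace (Torus n) := ⟨rfl⟩

end Torus

section HaarL2

variable (G : Type*) [Group G] [TopologicalSpace G] [IsTopologicalGroup G] [CompactSpace G]
  [MeasurableSpace G] [BorelSpace G]

/-- The normalized Haar measure of a compact group. -/
def normHaar : Measure G := Measure.haarMeasure ⊤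

/-- `L²(G)` for the normalized Haar measure. -/
abbrev HaarL2 : Type _ := Lp ℂ 2 (normHaar G)

end HaarL2

/-- `L²` of a discrete group (Haar measure = counting measure). -/
abbrev DiscreteL2 (W : Type*) : Type _ := lp (fun _ : W => ℂ) 2

section Maps

variable {G G' : Type*} [Group G] [TopologicalSpace G] [IsTopologicalGroup G] [CompactSpace G]
  [MeasurableSpace G] [BorelSpace G] [Group G'] [TopologicalSpace G'] [IsTopologicalGroup G']
  [CompactSpace G'] [MeasurableSpace G'] [BorelSpace G']

/-- `i` is the pull-back `ψ ↦ ψ ∘ π`. -/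
def IsPullback (π : G' → G) (i : HaarL2 G → HaarL2 G') : Prop :=
  ∀ ψ : HaarL2 G, (i ψ : G' → ℂ) =ᵐ[normHaar G'] fun H => ψ (π H)

/-- `F` is the Fourier transform of the compact Abelian group `G`:
`(F ψ)(χ) = ∫ conj(χ) ψ` for every `χ` in the dual group. -/
def IsFourierTransform (F : HaarL2 G → DiscreteL2 (PontryaginDual G)) : Prop :=
  ∀ (ψ : HaarL2 G) (χ : PontryaginDual G),
    F ψ χ = ∫ H, conj (χ H : ℂ) * ψ H ∂normHaar G

end Maps

/-! ### Inductive limits of Hilbert spaces -/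

section InductiveLimits

variable {J : Type*} [PartialOrder J]
  {𝓗 : J → Type*} [∀ a, NormedAddCommGroup (𝓗 a)] [∀ a, InnerProductSpace ℂ (𝓗 a)]
  {𝓗' : J → Type*} [∀ a, NormedAddCommGroup (𝓗' a)] [∀ a, InnerProductSpace ℂ (𝓗' a)]
  {𝓚 : Type*} [NormedAddCommGroup 𝓚] [InnerProductSpace ℂ 𝓚]
  {𝓚' : Type*} [NormedAddCommGroup 𝓚'] [InnerProductSpace ℂ 𝓚']

/-- Isometric linear maps `i a b : 𝓗 a → 𝓗 b`, for `a ≤ b` in a directed set, form an inductive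
family. -/
structure IsInductiveFamily (i : ∀ a b, a ≤ b → 𝓗 a →ₗᵢ[ℂ] 𝓗 b) : Prop where
  nonempty : Nonempty J
  directed : ∀ a b : J, ∃ c, a ≤ c ∧ b ≤ c
  id : ∀ a x, i a a le_rfl x = x
  comp : ∀ a b c (hab : a ≤ b) (hbc : b ≤ c) x,
    i b c hbc (i a b hab x) = i a c (hab.trans hbc) x

/-- `𝓚`, with the isometric linear maps `ι a : 𝓗 a → 𝓚`, is the inductive limit of the inductive
family `i`: the inclusions are compatible and they cover a dense linear subspace. -/
structure IsInductiveLimit (i : ∀ a b, a ≤ b → 𝓗 a →ₗᵢ[ℂ] 𝓗 b)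
    (ι : ∀ a, 𝓗 a →ₗᵢ[ℂ] 𝓚) : Prop where
  family : IsInductiveFamily i
  complete : CompleteSpace 𝓚
  compat : ∀ a b (h : a ≤ b) x, ι b (i a b h x) = ι a x
  dense : ∃ V : Submodule ℂ 𝓚, (V : Set 𝓚) = ⋃ a, range (ι a) ∧ Dense (V : Set 𝓚)

/-- The unitary map `Φ : 𝓚 → 𝓚'` between the inductive limits of `i` and `i'` is the inductive
limit of the family of unitary maps `φ a : 𝓗 a → 𝓗' a`: the `φ a` form an inductive family, and
`Φ` is the unique unitary map that is compatible with them. -/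
structure IsInductiveLimitOfUnitaries (i : ∀ a b, a ≤ b → 𝓗 a →ₗᵢ[ℂ] 𝓗 b)
    (i' : ∀ a b, a ≤ b → 𝓗' a →ₗᵢ[ℂ] 𝓗' b) (ι : ∀ a, 𝓗 a →ₗᵢ[ℂ] 𝓚) (ι' : ∀ a, 𝓗' a →ₗᵢ[ℂ] 𝓚')
    (φ : ∀ a, 𝓗 a ≃ₗᵢ[ℂ] 𝓗' a) (Φ : 𝓚 ≃ₗᵢ[ℂ] 𝓚') : Prop where
  family : ∀ a b (h : a ≤ b) x, i' a b h (φ a x) = φ b (i a b h x)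
  compat : ∀ a x, Φ (ι a x) = ι' a (φ a x)
  unique : ∀ Ψ : 𝓚 ≃ₗᵢ[ℂ] 𝓚', (∀ a x, Ψ (ι a x) = ι' a (φ a x)) → Ψ = Φ

end InductiveLimits

/-! ### Generalized connections and hoops -/

section Hoops

variable (E : Type*) [NormedAddCommGroup E] [NormedSpace ℝ E]
  {M : Type*} [TopologicalSpace M] [ChartedSpace E M]

/-- The compact Abelian group of generalized `U(1)`-connections modulo gauge transformations:
the homomorphisms from the group of loops to `U(1)`. -/
abbrev GenConn (x : M) : Type _ := HomU1 (LoopGroup E x)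

/-- `Hom(L, U(1))` for an index `L`. -/
abbrev GenConnAt {x : M} (L : LoopIndex E x) : Type _ := HomU1 L.1

/-- The group of hoops: the Wilson functions `T_α`, with pointwise multiplication. -/
abbrev HoopGroup (x : M) : Type _ := (HomU1.wilson (G := LoopGroup E x)).range

variable {E}

/-- `T_α` as an element of the group of hoops. -/
def hoop {x : M} (α : LoopGroup E x) : HoopGroup E x := HomU1.wilson.rangeRestrict α

/-- `T` is the loop transform: `(T ψ)(T_α) = ∫ conj(T_α) ψ` for every loop `α`. -/
def IsLoopTransform {x : M} (T : HaarL2 (GenConn E x) → DiscreteL2 (HoopGroup E x)) : Prop :=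
  ∀ (ψ : HaarL2 (GenConn E x)) (α : LoopGroup E x),
    T ψ (hoop α) = ∫ H : GenConn E x, conj (H α : ℂ) * ψ H ∂normHaar (GenConn E x)

end Hoops

end

/-!
Let two analytic curves be immersed off the parameter `0`, and suppose that they meet at points
accumulating at the value of both at `0`. After a substitution by powers of the parameters, the
identity principle makes their half-branches there coincide. By compactness, a path therefore meets
an analytic arc in finitely many points and intervals, so that finitely many piecewise analytic
loops can be cut at finitely many break points into the edges of a finite embedded graph.

The parameter of an arc inside an edge can be developed along every path, by adding up its changes
while the path runs inside the arc. The total change is a homomorphism from the group of loops to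
`ℝ`; exponentiating it gives `U(1)`-valued homomorphisms with prescribed values on independent
loops. Conversely, in the graph of a finite family of loops, the edges off a maximal tree give
independent loops that generate the family. Hence the index set is directed and covers the group of
loops.

Restriction to a subgroup in the index set is thus onto, and so preserves normalized Haar measure:
the pull-backs are isometries. The Wilson functions are orthonormal characters, and they are total
by the Stone–Weierstrass theorem; this gives both the unitarity of the transforms and the density in
the inductive limit.
-/

/-! ### Germs of analytic curves -/

section Germs

open Filter

theorem tendsto_nhdsGT_of_continuousAt {X Y : Type*} [TopologicalSpace X] [Preorder X]
    [TopologicalSpace Y] [Preorder Y] {f : X → Y} {a : X} {b : Y} (hf : ContinuousAt f a)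
    (hb : f a = b) (hpos : ∀ᶠ x in 𝓝[>] a, b < f x) : Tendsto f (𝓝[>] a) (𝓝[>] b) :=
  tendsto_nhdsWithin_iff.2 ⟨(hb ▸ hf.tendsto).mono_left nhdsWithin_le_nhds, hpos⟩

theorem tendsto_pow_nhdsGT_zero {n : ℕ} (hn : n ≠ 0) :
    Tendsto (fun y : ℝ => y ^ n) (𝓝[>] 0) (𝓝[>] 0) :=
  tendsto_nhdsGT_of_continuousAt (continuous_pow n).continuousAt (zero_pow hn)
    (eventually_mem_nhdsWithin.mono fun _ hy => pow_pos (mem_Ioi.1 hy) n)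

theorem tendsto_rpow_nhdsGT_zero {r : ℝ} (hr : 0 < r) :
    Tendsto (fun y : ℝ => y ^ r) (𝓝[>] 0) (𝓝[>] 0) :=
  tendsto_nhdsGT_of_continuousAt (Real.continuous_rpow_const hr.le).continuousAt
    (Real.zero_rpow hr.ne') (eventually_mem_nhdsWithin.mono fun _ hy => Real.rpow_pos_of_pos hy r)

theorem exists_analyticAt_pow_eq_pow_mul {a : ℝ → ℝ} {k : ℕ} (hk : k ≠ 0) (ha : AnalyticAt ℝ a 0)
    (ha0 : 0 < a 0) :
    ∃ u : ℝ → ℝ, AnalyticAt ℝ u 0 ∧ u 0 = 0 ∧ deriv u 0 ≠ 0 ∧ (∀ z, 0 < u z ↔ 0 < z) ∧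
      ∀ᶠ z in 𝓝 0, u z ^ k = z ^ k * a z := by
  let b : ℝ → ℝ := fun z => Real.exp (Real.log (a z) / k)
  have hb : AnalyticAt ℝ b 0 := ((ha.log ha0).div_const (c := (k : ℝ))).rexp
  have hderiv : HasDerivAt (fun z => z * b z) (1 * b 0 + 0 * deriv b 0) 0 :=
    (hasDerivAt_id (0 : ℝ)).mul hb.differentiableAt.hasDerivAt
  refine ⟨fun z => z * b z, analyticAt_id.mul hb, zero_mul _, ?_, ?_, ?_⟩
  · rw [hderiv.deriv]
    simp [b, Real.exp_ne_zero]
  · exact fun z => mul_pos_iff_of_pos_right (Real.exp_pos _)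
  · filter_upwards [ha.continuousAt.eventually (lt_mem_nhds ha0)] with z hz
    rw [mul_pow, ← Real.exp_nat_mul, mul_div_cancel₀ _ (Nat.cast_ne_zero.2 hk), Real.exp_log hz]

theorem exists_analyticAt_local_inverse_nhdsGT {u : ℝ → ℝ} (hu : AnalyticAt ℝ u 0) (hu0 : u 0 = 0)
    (hu' : deriv u 0 ≠ 0) (hpos : ∀ z, 0 < u z ↔ 0 < z) :
    ∃ ρ : ℝ → ℝ, AnalyticAt ℝ ρ 0 ∧ ρ 0 = 0 ∧ Tendsto ρ (𝓝[>] 0) (𝓝[>] 0) ∧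
      (∀ᶠ z in 𝓝 0, ρ (u z) = z) ∧ ∀ᶠ w in 𝓝 0, u (ρ w) = w := by
  let ρ := hu.hasStrictDerivAt.localInverse _ _ _ hu'
  have hρ : AnalyticAt ℝ ρ 0 := by simpa only [hu0] using hu.analyticAt_localInverse hu'
  have hleft : ∀ᶠ z in 𝓝 0, ρ (u z) = z := HasStrictDerivAt.eventually_left_inverse ..
  have hright : ∀ᶠ w in 𝓝 (0 : ℝ), u (ρ w) = w := by
    have : ∀ᶠ w in 𝓝 (u 0), u (ρ w) = w := HasStrictDerivAt.eventually_right_inverse ..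
    rwa [hu0] at this
  have hρ0 : ρ 0 = 0 := by simpa only [hu0] using hleft.self_of_nhds
  refine ⟨ρ, hρ, hρ0, tendsto_nhdsGT_of_continuousAt hρ.continuousAt hρ0 ?_, hleft, hright⟩
  filter_upwards [self_mem_nhdsWithin, hright.filter_mono nhdsWithin_le_nhds] with w hw huρ
  rwa [← hpos, huρ]

/-- Two curves whose positions are recorded by powers of their parameters can only meet where
`w ↦ F (w ^ l)` and `w ↦ G (w ^ k)` agree, so the identity principle applies. -/
theorem eventually_eq_rpow_of_frequently_eq {E : Type*} [NormedAddCommGroup E] [NormedSpace ℝ E]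
    {F G : ℝ → E} {φ : E → ℝ} {c : ℝ} {k l : ℕ} (hk : k ≠ 0) (hl : l ≠ 0)
    (hF : AnalyticAt ℝ F 0) (hG : AnalyticAt ℝ G 0)
    (hφF : ∀ᶠ s in 𝓝[>] 0, φ (F s) = c + s ^ k) (hφG : ∀ᶠ t in 𝓝[>] 0, φ (G t) = c + t ^ l)
    (hFG : ∃ᶠ p : ℝ × ℝ in 𝓝[>] 0 ×ˢ 𝓝[>] 0, F p.1 = G p.2) :
    ∀ᶠ s in 𝓝[>] 0, F s = G ((s ^ (l : ℝ)⁻¹) ^ k) := by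
  have hroot : Tendsto (fun s : ℝ => s ^ (l : ℝ)⁻¹) (𝓝[>] 0) (𝓝[>] 0) :=
    tendsto_rpow_nhdsGT_zero (by positivity)
  have hroot_pow {s : ℝ} (hs : 0 < s) : (s ^ (l : ℝ)⁻¹) ^ l = s :=
    Real.rpow_inv_natCast_pow hs.le hl
  have hmeet : ∃ᶠ w in 𝓝[≠] (0 : ℝ), F (w ^ l) = G (w ^ k) := by
    have hlim : Tendsto (fun p : ℝ × ℝ => p.1 ^ (l : ℝ)⁻¹) (𝓝[>] 0 ×ˢ 𝓝[>] 0) (𝓝[≠] 0) :=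
      (hroot.comp tendsto_fst).mono_right (nhdsWithin_mono _ fun y (hy : 0 < y) => hy.ne')
    refine hlim.frequently ((hFG.and_eventually ((eventually_mem_nhdsWithin.and hφF).prod_mk
      (eventually_mem_nhdsWithin.and hφG))).mono ?_)
    rintro ⟨s, t⟩ ⟨hst, ⟨hs, hFs⟩, ht, hGt⟩
    dsimp only at hst hs hFs ht hGt ⊢
    have hpow : s ^ k = t ^ l := by linarith [congrArg φ hst]
    have ht_eq : t = (s ^ (l : ℝ)⁻¹) ^ k := by
      refine (pow_left_inj₀ (le_of_lt ht) (by have := mem_Ioi.1 hs; positivity) hl).1 ?_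
      rw [← hpow, ← pow_mul, mul_comm k l, pow_mul, hroot_pow hs]
    rw [hroot_pow hs, ← ht_eq, hst]
  have hFl : AnalyticAt ℝ (fun w : ℝ => F (w ^ l)) 0 :=
    AnalyticAt.fun_comp (by rwa [zero_pow hl]) (analyticAt_id.pow l)
  have hGk : AnalyticAt ℝ (fun w : ℝ => G (w ^ k)) 0 :=
    AnalyticAt.fun_comp (by rwa [zero_pow hk]) (analyticAt_id.pow k)
  have hagree := (hFl.frequently_eq_iff_eventually_eq hGk).1 hmeet
  filter_upwards [(hroot.mono_right nhdsWithin_le_nhds).eventually hagree,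
    self_mem_nhdsWithin] with s hs hpos
  rwa [hroot_pow hpos] at hs

variable {E : Type*} [NormedAddCommGroup E] [NormedSpace ℝ E]

theorem exists_pow_coordinate {f : ℝ → E} {A : ℝ → E} {k : ℕ} (hf : AnalyticAt ℝ f 0)
    (hk : k ≠ 0) (hA : AnalyticAt ℝ A 0) (hfA : ∀ᶠ z in 𝓝 0, f z - f 0 = z ^ k • A z)
    (φ : E →L[ℝ] ℝ) (hφ : 0 < φ (A 0)) :
    ∃ u ρ : ℝ → ℝ, AnalyticAt ℝ (f ∘ ρ) 0 ∧ Tendsto u (𝓝[>] 0) (𝓝[>] 0) ∧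
      Tendsto ρ (𝓝[>] 0) (𝓝[>] 0) ∧ (∀ᶠ z in 𝓝[>] 0, ρ (u z) = z) ∧
      ∀ᶠ w in 𝓝[>] 0, φ (f (ρ w)) = φ (f 0) + w ^ k := by
  obtain ⟨u, hu, hu0, hu', hpos, huk⟩ :=
    exists_analyticAt_pow_eq_pow_mul hk ((φ.analyticAt _).comp hA) hφ
  obtain ⟨ρ, hρ, hρ0, hρpos, hleft, hright⟩ :=
    exists_analyticAt_local_inverse_nhdsGT hu hu0 hu' hpos
  refine ⟨u, ρ, AnalyticAt.comp (by rwa [hρ0]) hρ,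
    tendsto_nhdsGT_of_continuousAt hu.continuousAt hu0
      (eventually_mem_nhdsWithin.mono fun z hz => (hpos z).2 hz), hρpos,
    hleft.filter_mono nhdsWithin_le_nhds, ?_⟩
  filter_upwards [hρpos.eventually ((huk.and hfA).filter_mono nhdsWithin_le_nhds),
    hright.filter_mono nhdsWithin_le_nhds] with w ⟨hpow, hfw⟩ hw
  rw [← sub_eq_iff_eq_add', ← map_sub, hfw, map_smul, smul_eq_mul, ← hw, hw]
  simpa [hw] using hpow.symm

theorem sameRay_of_tendsto {X : Type*} {L : Filter X} {A B : X → E} {a b : E}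
    (hA : Tendsto A L (𝓝 a)) (hB : Tendsto B L (𝓝 b)) (ha : a ≠ 0) (hb : b ≠ 0)
    (hAB : ∃ᶠ x in L, SameRay ℝ (A x) (B x)) : SameRay ℝ a b := by
  refine (sameRay_iff_inv_norm_smul_eq_of_ne ha hb).2
    (tendsto_nhds_unique_of_frequently_eq ((hA.norm.inv₀ (norm_ne_zero_iff.2 ha)).smul hA)
      ((hB.norm.inv₀ (norm_ne_zero_iff.2 hb)).smul hB) ?_)
  refine (hAB.and_eventually ((hA.eventually_ne ha).and (hB.eventually_ne hb))).mono ?_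
  exact fun x ⟨hx, hAx, hBx⟩ => (sameRay_iff_inv_norm_smul_eq_of_ne hAx hBx).1 hx

/-- Where the curves meet, their leading coefficients point in the same direction; a functional
positive on one is therefore positive on the other. -/
theorem exists_dual_pos_of_frequently_eq {A B : ℝ → E} {k l : ℕ} (hA : ContinuousAt A 0)
    (hB : ContinuousAt B 0) (hA0 : A 0 ≠ 0) (hB0 : B 0 ≠ 0)
    (hAB : ∃ᶠ p : ℝ × ℝ in 𝓝[>] 0 ×ˢ 𝓝[>] 0, p.1 ^ k • A p.1 = p.2 ^ l • B p.2) :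
    ∃ φ : E →L[ℝ] ℝ, 0 < φ (A 0) ∧ 0 < φ (B 0) := by
  have hray : SameRay ℝ (A 0) (B 0) := by
    refine sameRay_of_tendsto
      ((hA.tendsto.mono_left nhdsWithin_le_nhds).comp tendsto_fst)
      ((hB.tendsto.mono_left nhdsWithin_le_nhds).comp tendsto_snd) hA0 hB0
      ((hAB.and_eventually (eventually_mem_nhdsWithin.prod_mk eventually_mem_nhdsWithin)).mono ?_)
    rintro p ⟨hp, hp₁, hp₂⟩
    exact (SameRay.sameRay_pos_smul_right _ (pow_pos (mem_Ioi.1 hp₁) k)).trans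
      (hp ▸ SameRay.sameRay_pos_smul_left _ (pow_pos (mem_Ioi.1 hp₂) l))
      fun h => Or.inl ((smul_eq_zero.1 h).resolve_left (pow_ne_zero k (mem_Ioi.1 hp₁).ne'))
  obtain ⟨r, hr, hrA⟩ := hray.exists_pos_left hA0 hB0
  obtain ⟨φ, hφ⟩ := SeparatingDual.exists_eq_one (R := ℝ) hA0
  exact ⟨φ, by simp [hφ], by simpa [← hrA, hφ] using hr⟩

theorem exists_eq_add_pow_smul {f : ℝ → E} (hf : AnalyticAt ℝ f 0)
    (hfc : ¬ ∀ᶠ z in 𝓝 0, f z = f 0) :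
    ∃ (k : ℕ) (A : ℝ → E), k ≠ 0 ∧ AnalyticAt ℝ A 0 ∧ A 0 ≠ 0 ∧
      ∀ᶠ z in 𝓝 0, f z - f 0 = z ^ k • A z := by
  obtain ⟨k, A, hA, hA0, hfA⟩ :=
    (hf.sub analyticAt_const).exists_eventuallyEq_pow_smul_nonzero_iff.2
      (by simpa [sub_eq_zero] using hfc)
  simp only [sub_zero, Pi.sub_apply] at hfA
  refine ⟨k, A, ?_, hA, hA0, hfA⟩
  rintro rfl
  exact hA0 (by simpa using hfA.self_of_nhds.symm)

theorem halfBranch_subset_of_frequently_eq {f g : ℝ → E} (hf : AnalyticAt ℝ f 0)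
    (hg : AnalyticAt ℝ g 0) (h0 : f 0 = g 0) (hfc : ¬ ∀ᶠ z in 𝓝 0, f z = f 0)
    (hgc : ¬ ∀ᶠ z in 𝓝 0, g z = g 0)
    (hfg : ∃ᶠ p : ℝ × ℝ in 𝓝[>] 0 ×ˢ 𝓝[>] 0, f p.1 = g p.2) {δ : ℝ} (hδ : 0 < δ) :
    ∀ᶠ s in 𝓝[>] 0, ∃ t ∈ Ioo 0 δ, f s = g t := by
  obtain ⟨k, A, hk, hA, hA0, hfA⟩ := exists_eq_add_pow_smul hf hfc
  obtain ⟨l, B, hl, hB, hB0, hgB⟩ := exists_eq_add_pow_smul hg hgc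
  obtain ⟨φ, hφA, hφB⟩ : ∃ φ : E →L[ℝ] ℝ, 0 < φ (A 0) ∧ 0 < φ (B 0) := by
    refine exists_dual_pos_of_frequently_eq (k := k) (l := l) hA.continuousAt hB.continuousAt hA0
      hB0 ((hfg.and_eventually ((hfA.filter_mono nhdsWithin_le_nhds).prod_mk
        (hgB.filter_mono nhdsWithin_le_nhds))).mono ?_)
    rintro p ⟨hp, hfp, hgp⟩
    rw [← hfp, ← hgp, hp, h0]
  obtain ⟨u, ρ, hfρ, hu, -, hρu, hfpow⟩ := exists_pow_coordinate hf hk hA hfA φ hφA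
  obtain ⟨v, τ, hgτ, hv, hτ, hτv, hgpow⟩ := exists_pow_coordinate hg hl hB hgB φ hφB
  have hmeet : ∃ᶠ q : ℝ × ℝ in 𝓝[>] 0 ×ˢ 𝓝[>] 0, (f ∘ ρ) q.1 = (g ∘ τ) q.2 := by
    refine (hu.prodMap hv).frequently ((hfg.and_eventually (hρu.prod_mk hτv)).mono ?_)
    rintro p ⟨hp, hρp, hτp⟩
    simpa [hρp, hτp] using hp
  have hroot : Tendsto (fun s => τ ((u s ^ (l : ℝ)⁻¹) ^ k)) (𝓝[>] 0) (𝓝[>] 0) :=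
    hτ.comp ((tendsto_pow_nhdsGT_zero hk).comp
      ((tendsto_rpow_nhdsGT_zero (by positivity)).comp hu))
  filter_upwards [hu.eventually (eventually_eq_rpow_of_frequently_eq hk hl hfρ hgτ
    hfpow (by simpa only [h0, Function.comp_apply] using hgpow) hmeet), hρu,
    hroot.eventually (Ioo_mem_nhdsGT hδ)] with s hs hρs hmem
  exact ⟨_, hmem, by simpa [hρs] using hs⟩

theorem injOn_Icc_of_deriv_ne_zero {f : ℝ → ℝ} {a b : ℝ} (hf : ContinuousOn f (Icc a b))
    (hf' : ∀ t ∈ Ioo a b, deriv f t ≠ 0) : InjOn f (Icc a b) := by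
  have hlt : ∀ s ∈ Icc a b, ∀ t ∈ Icc a b, s < t → f s ≠ f t := by
    intro s hs t ht hst heq
    obtain ⟨c, hc, hc0⟩ := exists_deriv_eq_zero hst (hf.mono (Icc_subset_Icc hs.1 ht.2)) heq
    exact hf' c ⟨hs.1.trans_lt hc.1, hc.2.trans_le ht.2⟩ hc0
  intro s hs t ht heq
  by_contra hne
  rcases lt_or_gt_of_ne hne with hst | hts
  exacts [hlt s hs t ht hst heq, hlt t ht s hs hts heq.symm]

variable [CompleteSpace E]

theorem eventually_const_of_eventually_deriv_eq_zero {f : ℝ → E} {t₀ : ℝ} (hf : AnalyticAt ℝ f t₀)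
    (hf' : ∀ᶠ t in 𝓝 t₀, deriv f t = 0) : ∀ᶠ t in 𝓝 t₀, f t = f t₀ := by
  obtain ⟨ε, hε, hball⟩ := Metric.eventually_nhds_iff_ball.1 (hf'.and hf.eventually_analyticAt)
  filter_upwards [Metric.ball_mem_nhds t₀ hε] with t ht
  exact Metric.isOpen_ball.is_const_of_deriv_eq_zero (convex_ball t₀ ε).isPreconnected
    (fun y hy => (hball y hy).2.differentiableAt.differentiableWithinAt)
    (fun y hy => (hball y hy).1) ht (Metric.mem_ball_self hε)

theorem exists_dual_deriv_ne_zero {f : ℝ → E} {t₀ : ℝ} (hf : AnalyticAt ℝ f t₀)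
    (hfc : ¬ ∀ᶠ z in 𝓝 t₀, f z = f t₀) :
    ∃ φ : E →L[ℝ] ℝ, ∀ᶠ t in 𝓝 t₀, AnalyticAt ℝ f t ∧ (t ≠ t₀ → φ (deriv f t) ≠ 0) := by
  obtain ⟨k, A, hA, hA0, hfA⟩ := hf.deriv.exists_eventuallyEq_pow_smul_nonzero_iff.2
    fun h => hfc (eventually_const_of_eventually_deriv_eq_zero hf h)
  obtain ⟨φ, hφ⟩ := SeparatingDual.exists_ne_zero (R := ℝ) hA0
  refine ⟨φ, ?_⟩
  filter_upwards [hf.eventually_analyticAt, hfA,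
    (φ.continuous.continuousAt.comp hA.continuousAt).eventually_ne hφ] with t han hderiv hφt
  refine ⟨han, fun hne => ?_⟩
  rw [hderiv, map_smul, smul_eq_mul]
  exact mul_ne_zero (pow_ne_zero _ (sub_ne_zero.2 hne)) hφt

theorem exists_injOn_Icc_of_analyticAt {f : ℝ → E} {t₀ : ℝ} (hf : AnalyticAt ℝ f t₀)
    (hfc : ¬ ∀ᶠ z in 𝓝 t₀, f z = f t₀) :
    ∃ ε > 0, (∀ a b, t₀ - ε ≤ a → b ≤ t₀ + ε → t₀ ∉ Ioo a b → InjOn f (Icc a b)) ∧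
      ∀ t ∈ Icc (t₀ - ε) (t₀ + ε), t ≠ t₀ → deriv f t ≠ 0 := by
  obtain ⟨φ, hφ⟩ := exists_dual_deriv_ne_zero hf hfc
  obtain ⟨ε, hε, hball⟩ := Metric.nhds_basis_closedBall.eventually_iff.1 hφ
  simp only [Real.closedBall_eq_Icc] at hball
  refine ⟨ε, hε, fun a b ha hb ht₀ => ?_, fun t ht hne h => (hball ht).2 hne (by rw [h, map_zero])⟩
  have hsub : Icc a b ⊆ Icc (t₀ - ε) (t₀ + ε) := Icc_subset_Icc ha hb
  have hderiv : ∀ t ∈ Icc a b, HasDerivAt (φ ∘ f) (φ (deriv f t)) t := fun t ht =>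
    φ.hasFDerivAt.comp_hasDerivAt t (hball (hsub ht)).1.differentiableAt.hasDerivAt
  refine InjOn.of_comp (g := φ) (injOn_Icc_of_deriv_ne_zero (HasDerivAt.continuousOn hderiv)
    fun t ht => ?_)
  rw [(hderiv t (Ioo_subset_Icc_self ht)).deriv]
  exact (hball (hsub (Ioo_subset_Icc_self ht))).2 fun h => ht₀ (h ▸ ht)

end Germs

/-! ### Analytic curves in a manifold -/

section Curves

open Filter

theorem exists_frequently_nhdsWithin_of_isCompact {X Y : Type*} [TopologicalSpace Y] {L : Filter X}
    {K : Set Y} (hK : IsCompact K) {R : X → Y → Prop} (h : ∃ᶠ x in L, ∃ y ∈ K, R x y) :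
    ∃ y₀ ∈ K, ∃ᶠ p in L ×ˢ 𝓝[K] y₀, R p.1 p.2 := by
  by_contra! hnot
  refine h ?_
  have hlocal : ∀ y₀ ∈ K, {p : X × Y | p.2 ∈ K → ¬ R p.1 p.2} ∈ L ×ˢ 𝓝 y₀ := by
    intro y₀ hy₀
    obtain ⟨s, hs, t, ht, hst⟩ := mem_prod_iff.1 (hnot y₀ hy₀)
    refine mem_prod_iff.2 ⟨s, hs, _, mem_nhdsWithin_iff_eventually.1 ht, ?_⟩
    exact fun p hp hpK => hst ⟨hp.1, hp.2 hpK⟩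
  obtain ⟨s, hs, t, ht, hst⟩ := mem_prod_iff.1 (hK.mem_prod_nhdsSet_of_forall hlocal)
  filter_upwards [hs] with x hx
  rintro ⟨y, hy, hxy⟩
  exact hst (mk_mem_prod hx (subset_of_mem_nhdsSet ht hy)) hy hxy

theorem exists_ne_zero_frequently_nhdsGT_of_nhdsNE {X : Type*} {L : Filter X} {P : X → ℝ → Prop}
    {t₀ : ℝ} (h : ∃ᶠ p in L ×ˢ 𝓝[≠] t₀, P p.1 p.2) :
    ∃ a : ℝ, a ≠ 0 ∧ ∃ᶠ q in L ×ˢ 𝓝[>] 0, P q.1 (a * q.2 + t₀) := by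
  rw [← nhdsLT_sup_nhdsGT, prod_sup, frequently_sup] at h
  rcases h with h | h
  · have hlim : Tendsto (fun t => t₀ - t) (𝓝[<] t₀) (𝓝[>] 0) :=
      tendsto_nhdsWithin_iff.2 ⟨((continuous_sub_left t₀).tendsto' t₀ 0 (sub_self t₀)).mono_left
        nhdsWithin_le_nhds, eventually_mem_nhdsWithin.mono fun t ht => mem_Ioi.2 (sub_pos.2 ht)⟩
    refine ⟨-1, by norm_num, (tendsto_id.prodMap hlim).frequently (h.mono fun p hp => ?_)⟩
    simpa using hp
  · have hlim : Tendsto (fun t => t - t₀) (𝓝[>] t₀) (𝓝[>] 0) :=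
      tendsto_nhdsGT_of_continuousAt (continuous_sub_right t₀).continuousAt (sub_self t₀)
        (eventually_mem_nhdsWithin.mono fun t ht => sub_pos.2 ht)
    refine ⟨1, one_ne_zero, (tendsto_id.prodMap hlim).frequently (h.mono fun p hp => ?_)⟩
    simpa using hp

theorem not_eventually_const_of_injOn {N : Type*} {g : ℝ → N} {c d t : ℝ} (hcd : c < d)
    (hinj : InjOn g (Icc c d)) (ht : t ∈ Icc c d) : ¬ ∀ᶠ s in 𝓝 t, g s = g t := by
  intro h
  rcases ht.2.lt_or_eq with hd | rfl
  · obtain ⟨s, hs, hs'⟩ := ((h.filter_mono nhdsWithin_le_nhds).and (Ioo_mem_nhdsGT hd)).exists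
    exact hs'.1.ne' (hinj ⟨ht.1.trans hs'.1.le, hs'.2.le⟩ ht hs)
  · obtain ⟨s, hs, hs'⟩ := ((h.filter_mono nhdsWithin_le_nhds).and (Ioo_mem_nhdsLT hcd)).exists
    exact hs'.2.ne (hinj ⟨hs'.1.le, hs'.2.le⟩ ht hs)

variable {E : Type*} [NormedAddCommGroup E] [NormedSpace ℝ E]
  {M : Type*} [TopologicalSpace M] [ChartedSpace E M]

variable (E) in
/-- The curve `f` in the analytic manifold `M` modelled on `E` is real analytic at `t`. -/
abbrev AnalyticCurveAt (f : ℝ → M) (t : ℝ) : Prop :=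
  ContMDiffAt 𝓘(ℝ, ℝ) 𝓘(ℝ, E) ω f t

namespace AnalyticCurveAt

variable {f g : ℝ → M} {t : ℝ}

theorem analyticAt_extChartAt (h : AnalyticCurveAt E f t) :
    AnalyticAt ℝ (fun s => extChartAt 𝓘(ℝ, E) (f t) (f s)) t :=
  (contMDiffAt_iff_contDiffAt.1 (contMDiffAt_iff_target.1 h).2).analyticAt

theorem eventually_mem_extChartAt_source (h : AnalyticCurveAt E f t) :
    ∀ᶠ s in 𝓝 t, f s ∈ (extChartAt 𝓘(ℝ, E) (f t)).source :=
  h.continuousAt.eventually (extChartAt_source_mem_nhds (f t))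

theorem eventually_const_of_extChartAt (h : AnalyticCurveAt E f t)
    (hc : ∀ᶠ s in 𝓝 t, extChartAt 𝓘(ℝ, E) (f t) (f s) = extChartAt 𝓘(ℝ, E) (f t) (f t)) :
    ∀ᶠ s in 𝓝 t, f s = f t := by
  filter_upwards [hc, h.eventually_mem_extChartAt_source] with s hs hs'
  exact (extChartAt 𝓘(ℝ, E) (f t)).injOn hs' (mem_extChartAt_source _) hs

theorem comp_affine {c d : ℝ} (h : AnalyticCurveAt E f (c * t + d)) :
    AnalyticCurveAt E (fun s => f (c * s + d)) t :=
  ContMDiffAt.comp (g := f) (f := fun s : ℝ => c * s + d) t h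
    (ContDiffAt.contMDiffAt (by fun_prop))

theorem eventually_const_or_eventually_ne (h : AnalyticCurveAt E f t) :
    (∀ᶠ s in 𝓝 t, f s = f t) ∨ ∀ᶠ s in 𝓝[≠] t, f s ≠ f t :=
  (h.analyticAt_extChartAt.eventually_eq_or_eventually_ne analyticAt_const).imp
    h.eventually_const_of_extChartAt fun hne => hne.mono fun _ hs hs' => hs (by rw [hs'])

theorem halfBranch_subset_of_frequently_eq (hf : AnalyticCurveAt E f 0) (hg : AnalyticCurveAt E g 0)
    (h0 : f 0 = g 0) (hfc : ¬ ∀ᶠ s in 𝓝 0, f s = f 0) (hgc : ¬ ∀ᶠ t in 𝓝 0, g t = g 0)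
    (hfg : ∃ᶠ p : ℝ × ℝ in 𝓝[>] 0 ×ˢ 𝓝[>] 0, f p.1 = g p.2) {δ : ℝ} (hδ : 0 < δ) :
    ∀ᶠ s in 𝓝[>] 0, ∃ t ∈ Ioo 0 δ, f s = g t := by
  have hga := hg.analyticAt_extChartAt
  have hgs := hg.eventually_mem_extChartAt_source
  have hgc' := mt hg.eventually_const_of_extChartAt hgc
  rw [← h0] at hga hgs hgc'
  obtain ⟨ε, hε, hball⟩ := Metric.nhds_basis_ball.eventually_iff.1 hgs
  have hsub := _root_.halfBranch_subset_of_frequently_eq hf.analyticAt_extChartAt hga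
    (by rw [h0]) (mt hf.eventually_const_of_extChartAt hfc) (by simpa only [h0] using hgc')
    (hfg.mono fun p hp => by rw [hp]) (lt_min hδ hε)
  filter_upwards [hsub, hf.eventually_mem_extChartAt_source.filter_mono nhdsWithin_le_nhds]
    with s ⟨t, ht, hst⟩ hs
  obtain ⟨htδ, htε⟩ := lt_min_iff.1 ht.2
  refine ⟨t, ⟨ht.1, htδ⟩, (extChartAt 𝓘(ℝ, E) (f 0)).injOn hs (hball ?_) hst⟩
  simpa [Real.dist_eq, abs_of_pos ht.1] using htε

/-- The parameters of the meeting points accumulate at some `t₀` in the arc; on the side of `t₀`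
where they do, the arc contains the half-branch of `f`. -/
theorem eventually_mem_arc_of_frequently [T2Space M] {c d : ℝ} (hf : AnalyticCurveAt E f 0)
    (hfne : ∀ᶠ s in 𝓝[≠] 0, f s ≠ f 0) (hg : ∀ t ∈ Icc c d, AnalyticCurveAt E g t) (hcd : c < d)
    (hinj : InjOn g (Icc c d)) (hmeet : ∃ᶠ s in 𝓝[>] 0, f s ∈ g '' Icc c d) :
    ∀ᶠ s in 𝓝[>] 0, f s ∈ g '' Icc c d := by
  obtain ⟨t₀, ht₀, hfreq⟩ := exists_frequently_nhdsWithin_of_isCompact isCompact_Icc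
    (R := fun s t => g t = f s) hmeet
  have h0 : f 0 = g t₀ := tendsto_nhds_unique_of_frequently_eq
    ((hf.continuousAt.tendsto.mono_left nhdsWithin_le_nhds).comp tendsto_fst)
    (((hg t₀ ht₀).continuousAt.tendsto.mono_left nhdsWithin_le_nhds).comp tendsto_snd)
    (hfreq.mono fun p hp => hp.symm)
  have hfne' : ∀ᶠ s in 𝓝[>] 0, f s ≠ f 0 :=
    hfne.filter_mono (nhdsWithin_mono _ fun s (hs : 0 < s) => hs.ne')
  have hpunctured : ∃ᶠ p in 𝓝[>] 0 ×ˢ 𝓝[≠] t₀, p.2 ∈ Icc c d ∧ g p.2 = f p.1 := by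
    have hnhds : ∃ᶠ p in 𝓝[>] 0 ×ˢ 𝓝 t₀, p.2 ∈ Icc c d ∧ g p.2 = f p.1 :=
      ((hfreq.and_eventually (tendsto_snd.eventually eventually_mem_nhdsWithin)).mono
        fun _ => And.symm).filter_mono (prod_mono_right _ nhdsWithin_le_nhds)
    rw [← nhdsNE_sup_pure, prod_sup, frequently_sup, prod_pure, frequently_map] at hnhds
    exact hnhds.resolve_right
      (not_frequently.2 (hfne'.mono fun s hs hst => hs (hst.2.symm.trans h0.symm)))
  obtain ⟨a, ha, hside⟩ := exists_ne_zero_frequently_nhdsGT_of_nhdsNE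
    (P := fun s t => t ∈ Icc c d ∧ g t = f s) hpunctured
  obtain ⟨⟨s₁, δ⟩, ⟨hmem, -⟩, -, hδ⟩ := (hside.and_eventually
    (eventually_mem_nhdsWithin.prod_mk eventually_mem_nhdsWithin)).exists
  have hga : AnalyticCurveAt E (fun r => g (a * r + t₀)) 0 :=
    comp_affine (by simpa using hg t₀ ht₀)
  have hgc : ¬ ∀ᶠ r in 𝓝 (0 : ℝ), g (a * r + t₀) = g (a * 0 + t₀) := by
    intro hconst
    have hlim : Tendsto (fun t => (t - t₀) / a) (𝓝 t₀) (𝓝 0) :=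
      Continuous.tendsto' (by fun_prop) _ _ (by simp)
    refine not_eventually_const_of_injOn hcd hinj ht₀ ((hlim.eventually hconst).mono ?_)
    intro t ht
    simpa [mul_div_cancel₀ _ ha] using ht
  filter_upwards [hf.halfBranch_subset_of_frequently_eq hga (by simpa using h0)
    (fun hc => ((hc.filter_mono nhdsWithin_le_nhds).and hfne').exists.elim fun s hs => hs.2 hs.1)
    hgc (hside.mono fun p hp => hp.2.symm) hδ] with s ⟨r, hr, hsr⟩
  refine ⟨a * r + t₀, ?_, hsr.symm⟩
  rcases lt_or_gt_of_ne ha with hneg | hpos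
  · exact ⟨hmem.1.trans (by nlinarith [hr.2]), by nlinarith [hr.1, ht₀.2]⟩
  · exact ⟨by nlinarith [hr.1, ht₀.1], le_trans (by nlinarith [hr.2]) hmem.2⟩

theorem eventually_mem_or_notMem_arc [T2Space M] {c d : ℝ} (hf : AnalyticCurveAt E f 0)
    (hg : ∀ t ∈ Icc c d, AnalyticCurveAt E g t) (hcd : c < d) (hinj : InjOn g (Icc c d)) :
    (∀ᶠ s in 𝓝[>] 0, f s ∈ g '' Icc c d) ∨ ∀ᶠ s in 𝓝[>] 0, f s ∉ g '' Icc c d := by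
  rcases hf.eventually_const_or_eventually_ne with hc | hne
  · have hc' := hc.filter_mono (nhdsWithin_le_nhds (s := Ioi 0))
    by_cases h0 : f 0 ∈ g '' Icc c d
    exacts [.inl (hc'.mono fun s hs => hs ▸ h0), .inr (hc'.mono fun s hs => hs ▸ h0)]
  · exact (em _).imp (hf.eventually_mem_arc_of_frequently hne hg hcd hinj) not_frequently.1

theorem eventually_mem_or_notMem_arc_right [T2Space M] {s₀ c d : ℝ} (hf : AnalyticCurveAt E f s₀)
    (hg : ∀ t ∈ Icc c d, AnalyticCurveAt E g t) (hcd : c < d) (hinj : InjOn g (Icc c d)) :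
    (∀ᶠ s in 𝓝[>] s₀, f s ∈ g '' Icc c d) ∨ ∀ᶠ s in 𝓝[>] s₀, f s ∉ g '' Icc c d := by
  have hlim : Tendsto (fun s => s - s₀) (𝓝[>] s₀) (𝓝[>] 0) :=
    tendsto_nhdsGT_of_continuousAt (continuous_sub_right s₀).continuousAt (sub_self s₀)
      (eventually_mem_nhdsWithin.mono fun t ht => sub_pos.2 ht)
  have hf₀ : AnalyticCurveAt E (fun z => f (1 * z + s₀)) 0 := comp_affine (by simpa using hf)
  exact (hf₀.eventually_mem_or_notMem_arc hg hcd hinj).imp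
    (fun h => by simpa using hlim.eventually h) fun h => by simpa using hlim.eventually h

theorem eventually_mem_or_notMem_arc_left [T2Space M] {s₀ c d : ℝ} (hf : AnalyticCurveAt E f s₀)
    (hg : ∀ t ∈ Icc c d, AnalyticCurveAt E g t) (hcd : c < d) (hinj : InjOn g (Icc c d)) :
    (∀ᶠ s in 𝓝[<] s₀, f s ∈ g '' Icc c d) ∨ ∀ᶠ s in 𝓝[<] s₀, f s ∉ g '' Icc c d := by
  have hf' : AnalyticCurveAt E (fun r => f (-1 * r + 0)) (-s₀) := comp_affine (by simpa using hf)
  exact (hf'.eventually_mem_or_notMem_arc_right hg hcd hinj).imp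
    (fun h => by simpa using tendsto_neg_nhdsLT.eventually h)
    fun h => by simpa using tendsto_neg_nhdsLT.eventually h

theorem exists_mapsTo_or_mapsTo_compl_arc [T2Space M] {c d : ℝ} (hf : AnalyticCurveAt E f t)
    (hg : ∀ t ∈ Icc c d, AnalyticCurveAt E g t) (hcd : c < d) (hinj : InjOn g (Icc c d)) :
    ∃ ε > 0, ∀ a b, t - ε ≤ a → b ≤ t + ε → t ∉ Ioo a b →
      MapsTo f (Ioo a b) (g '' Icc c d) ∨ MapsTo f (Ioo a b) (g '' Icc c d)ᶜ := by
  have exists_right : ∀ {S : Set M}, (∀ᶠ s in 𝓝[>] t, f s ∈ S) → ∃ u > t, MapsTo f (Ioo t u) S :=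
    fun h => mem_nhdsGT_iff_exists_Ioo_subset.1 h
  have exists_left : ∀ {S : Set M}, (∀ᶠ s in 𝓝[<] t, f s ∈ S) → ∃ u < t, MapsTo f (Ioo u t) S :=
    fun h => mem_nhdsLT_iff_exists_Ioo_subset.1 h
  obtain ⟨u, hu, hright⟩ : ∃ u > t, MapsTo f (Ioo t u) (g '' Icc c d) ∨
      MapsTo f (Ioo t u) (g '' Icc c d)ᶜ := by
    simpa only [and_or_left, exists_or] using
      (hf.eventually_mem_or_notMem_arc_right hg hcd hinj).imp exists_right exists_right
  obtain ⟨v, hv, hleft⟩ : ∃ v < t, MapsTo f (Ioo v t) (g '' Icc c d) ∨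
      MapsTo f (Ioo v t) (g '' Icc c d)ᶜ := by
    simpa only [and_or_left, exists_or] using
      (hf.eventually_mem_or_notMem_arc_left hg hcd hinj).imp exists_left exists_left
  refine ⟨min (u - t) (t - v), lt_min (sub_pos.2 hu) (sub_pos.2 hv), fun a b ha hb ht => ?_⟩
  have hbu : b ≤ u := by linarith [min_le_left (u - t) (t - v)]
  have hva : v ≤ a := by linarith [min_le_right (u - t) (t - v)]
  rcases le_or_gt t a with hta | hat
  · have hsub : Ioo a b ⊆ Ioo t u := Ioo_subset_Ioo hta hbu
    exact hright.imp (·.mono_left hsub) (·.mono_left hsub)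
  · have hsub : Ioo a b ⊆ Ioo v t := Ioo_subset_Ioo hva (not_lt.1 fun htb => ht ⟨hat, htb⟩)
    exact hleft.imp (·.mono_left hsub) (·.mono_left hsub)

theorem mfderiv_ne_zero_of_deriv_extChartAt_ne_zero [IsManifold 𝓘(ℝ, E) ω M] {y : M}
    (h : AnalyticCurveAt E f t) (hmem : f t ∈ (extChartAt 𝓘(ℝ, E) y).source)
    (hderiv : deriv (fun s => extChartAt 𝓘(ℝ, E) y (f s)) t ≠ 0) :
    mfderiv 𝓘(ℝ, ℝ) 𝓘(ℝ, E) f t ≠ 0 := by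
  intro h0
  have hft : HasMFDerivAt 𝓘(ℝ, ℝ) 𝓘(ℝ, E) f t 0 :=
    h0 ▸ (h.mdifferentiableAt (by simp)).hasMFDerivAt
  have hchart : MDifferentiableAt 𝓘(ℝ, E) 𝓘(ℝ, E) (extChartAt 𝓘(ℝ, E) y) (f t) :=
    (contMDiffAt_extChartAt' (n := 1) (by simpa using hmem)).mdifferentiableAt one_ne_zero
  have hcomp := hchart.hasMFDerivAt.comp t hft
  rw [ContinuousLinearMap.comp_zero] at hcomp
  have hzero : HasFDerivAt (extChartAt 𝓘(ℝ, E) y ∘ f) (0 : ℝ →L[ℝ] E) t := hcomp.hasFDerivAt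
  exact hderiv (hzero.hasDerivAt.deriv.trans rfl)

theorem const_or_injOn_Icc [CompleteSpace E] [IsManifold 𝓘(ℝ, E) ω M]
    (h : AnalyticCurveAt E f t) :
    ∃ ε > 0, (∀ s ∈ Icc (t - ε) (t + ε), AnalyticCurveAt E f s) ∧
      ((∀ s ∈ Icc (t - ε) (t + ε), f s = f t) ∨
        (∀ a b, t - ε ≤ a → b ≤ t + ε → t ∉ Ioo a b → InjOn f (Icc a b)) ∧
          ∀ s ∈ Icc (t - ε) (t + ε), s ≠ t → mfderiv 𝓘(ℝ, ℝ) 𝓘(ℝ, E) f s ≠ 0) := by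
  have han : ∀ᶠ s in 𝓝 t, AnalyticCurveAt E f s :=
    (contMDiffAt_iff_contMDiffAt_nhds (by simp)).1 h
  by_cases hc : ∀ᶠ s in 𝓝 t, f s = f t
  · obtain ⟨ε, hε, hball⟩ := Metric.nhds_basis_closedBall.eventually_iff.1 (han.and hc)
    simp only [Real.closedBall_eq_Icc] at hball
    exact ⟨ε, hε, fun s hs => (hball hs).1, Or.inl fun s hs => (hball hs).2⟩
  obtain ⟨ε₁, hε₁, hinj, hderiv⟩ := exists_injOn_Icc_of_analyticAt
    h.analyticAt_extChartAt (mt h.eventually_const_of_extChartAt hc)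
  obtain ⟨ε₂, hε₂, hball⟩ := Metric.nhds_basis_closedBall.eventually_iff.1
    (han.and h.eventually_mem_extChartAt_source)
  simp only [Real.closedBall_eq_Icc] at hball
  have hmin₁ := min_le_left ε₁ ε₂
  have hmin₂ := min_le_right ε₁ ε₂
  have hsub₁ : Icc (t - min ε₁ ε₂) (t + min ε₁ ε₂) ⊆ Icc (t - ε₁) (t + ε₁) :=
    Icc_subset_Icc (by linarith) (by linarith)
  have hsub₂ : Icc (t - min ε₁ ε₂) (t + min ε₁ ε₂) ⊆ Icc (t - ε₂) (t + ε₂) :=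
    Icc_subset_Icc (by linarith) (by linarith)
  refine ⟨min ε₁ ε₂, lt_min hε₁ hε₂, fun s hs => (hball (hsub₂ hs)).1,
    Or.inr ⟨fun a b ha hb ht => InjOn.of_comp (hinj a b (by linarith) (by linarith) ht),
      fun s hs hst => ?_⟩⟩
  obtain ⟨hs_an, hs_source⟩ := hball (hsub₂ hs)
  exact hs_an.mfderiv_ne_zero_of_deriv_extChartAt_ne_zero hs_source (hderiv s (hsub₁ hs) hst)

end AnalyticCurveAt

end Curves

/-! ### Finite subdivisions of paths -/

section Breaks

theorem interval_induction_of_finite {V : Set ℝ} (hV : V.Finite) {Q : ℝ → ℝ → Prop}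
    (base : ∀ a b, a < b → Disjoint (Ioo a b) V → Q a b)
    (glue : ∀ a, ∀ v ∈ V, ∀ b, a < v → v < b → Q a v → Q v b → Q a b) {A B : ℝ} (hAB : A < B) :
    Q A B := by
  suffices key : ∀ n : ℕ, ∀ a b, a < b → (Ioo a b ∩ V).ncard = n → Q a b from key _ A B hAB rfl
  intro n
  induction n using Nat.strong_induction_on with
  | _ n ih =>
    rintro a b hab rfl
    by_cases hdisj : Disjoint (Ioo a b) V
    · exact base a b hab hdisj
    obtain ⟨v, hv, hvV⟩ := not_disjoint_iff.1 hdisj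
    have hcard : ∀ {S : Set ℝ}, S ⊆ Ioo a b → v ∉ S →
        (S ∩ V).ncard < (Ioo a b ∩ V).ncard := fun hS hvS =>
      ncard_lt_ncard ⟨inter_subset_inter_left V hS, fun h => hvS (h ⟨hv, hvV⟩).1⟩
        (hV.subset inter_subset_right)
    exact glue a v hvV b hv.1 hv.2
      (ih _ (hcard (Ioo_subset_Ioo_right hv.2.le) fun h => lt_irrefl v h.2) a v hv.1 rfl)
      (ih _ (hcard (Ioo_subset_Ioo_left hv.1.le) fun h => lt_irrefl v h.1) v b hv.2 rfl)

/-- Between any two consecutive points of some finite subset of `[A, B]`, the property `P` holds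
for all intervals `[a, b]`. Since `P a b` is required for every `[a, b]` with no break point in
its interior, further break points can be added freely. -/
def HasFiniteBreaks (P : ℝ → ℝ → Prop) (A B : ℝ) : Prop :=
  ∃ V : Set ℝ, V.Finite ∧ ∀ a b, A ≤ a → b ≤ B → a < b → Disjoint (Ioo a b) V → P a b

namespace HasFiniteBreaks

variable {P Q : ℝ → ℝ → Prop} {A B C : ℝ}

theorem trans (h : HasFiniteBreaks P A B) (h' : HasFiniteBreaks P B C) :
    HasFiniteBreaks P A C := by
  obtain ⟨V, hV, hP⟩ := h
  obtain ⟨V', hV', hP'⟩ := h'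
  refine ⟨insert B (V ∪ V'), (hV.union hV').insert B, fun a b ha hb hab hdisj => ?_⟩
  rw [disjoint_insert_right, disjoint_union_right] at hdisj
  obtain ⟨hB, hdV, hdV'⟩ := hdisj
  rcases le_or_gt b B with hbB | hBb
  · exact hP a b ha hbB hab hdV
  · exact hP' a b (not_lt.1 fun haB => hB ⟨haB, hBb⟩) hb hab hdV'

theorem of_partition {n : ℕ} {t : ℕ → ℝ}
    (h : ∀ i < n, HasFiniteBreaks P (t i) (t (i + 1))) : HasFiniteBreaks P (t 0) (t n) := by
  induction n with
  | zero => exact ⟨∅, finite_empty, fun a b ha hb hab => absurd (ha.trans_lt hab) (not_lt.2 hb)⟩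
  | succ n ih => exact (ih fun i hi => h i (hi.trans n.lt_succ_self)).trans (h n n.lt_succ_self)

theorem of_forall_mem_Icc
    (h : ∀ t ∈ Icc A B, ∃ ε > 0, ∀ a b, A ≤ a → b ≤ B → a < b → t - ε ≤ a → b ≤ t + ε →
      t ∉ Ioo a b → P a b) : HasFiniteBreaks P A B := by
  choose! ε hε hP using h
  obtain ⟨s, hs, hcover⟩ := isCompact_Icc.elim_nhds_subcover (s := Icc A B)
    (fun t => Ioo (t - ε t) (t + ε t))
    (fun t ht => Ioo_mem_nhds (by linarith [hε t ht]) (by linarith [hε t ht]))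
  refine ⟨⋃ t ∈ s, {t - ε t, t, t + ε t},
    s.finite_toSet.biUnion fun t _ => by simp, fun a b ha hb hab hdisj => ?_⟩
  obtain ⟨t, ht, hmem⟩ := mem_iUnion₂.1
    (hcover (⟨by linarith, by linarith⟩ : (a + b) / 2 ∈ Icc A B))
  have hbreak : ∀ v ∈ ({t - ε t, t, t + ε t} : Set ℝ), v ∉ Ioo a b := fun v hv hvab =>
    disjoint_left.1 hdisj hvab (mem_iUnion₂.2 ⟨t, ht, hv⟩)
  refine hP t (hs t ht) a b ha hb hab ?_ ?_ (hbreak t (by simp))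
  · exact not_lt.1 fun hlt => hbreak (t - ε t) (by simp) ⟨hlt, by linarith [hmem.1]⟩
  · exact not_lt.1 fun hlt => hbreak (t + ε t) (by simp) ⟨by linarith [hmem.2], hlt⟩

theorem induction (h : HasFiniteBreaks P A B) (hAB : A < B)
    (base : ∀ a b, A ≤ a → b ≤ B → a < b → P a b → Q a b)
    (glue : ∀ a v b, a < v → v < b → Q a v → Q v b → Q a b) : Q A B := by
  obtain ⟨V, hV, hP⟩ := h
  refine interval_induction_of_finite (Q := fun a b => A ≤ a → b ≤ B → Q a b) hV ?_ ?_ hAB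
    le_rfl le_rfl
  · exact fun a b hab hdisj ha hb => base a b ha hb hab (hP a b ha hb hab hdisj)
  · exact fun a v _ b hav hvb hl hr ha hb =>
      glue a v b hav hvb (hl ha (hvb.le.trans hb)) (hr (ha.trans hav.le) hb)

end HasFiniteBreaks

variable {E : Type*} [NormedAddCommGroup E] [NormedSpace ℝ E]
  {M : Type*} [TopologicalSpace M] [ChartedSpace E M]

variable (E) in
/-- The set `K` is met by every piecewise analytic path in finitely many points and intervals. -/
def MeetsPathsFinitely (K : Set M) : Prop :=
  ∀ {x y : M} (γ : PAPath E x y), HasFiniteBreaks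
    (fun a b => MapsTo γ.1.extend (Ioo a b) K ∨ MapsTo γ.1.extend (Ioo a b) Kᶜ) 0 1

variable (E) in
/-- On `[a, b]`, `f` is an injective analytic curve, immersed on `(a, b)`. -/
def IsArc (f : ℝ → M) (a b : ℝ) : Prop :=
  ∃ η : ℝ → M, (∀ s ∈ Icc a b, AnalyticCurveAt E η s) ∧ EqOn f η (Icc a b) ∧
    InjOn η (Icc a b) ∧ ∀ s ∈ Ioo a b, mfderiv 𝓘(ℝ, ℝ) 𝓘(ℝ, E) η s ≠ 0

theorem IsArc.mono {f : ℝ → M} {a b a' b' : ℝ} (h : IsArc E f a b) (ha : a ≤ a') (hb : b' ≤ b) :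
    IsArc E f a' b' := by
  obtain ⟨η, hη, hfη, hinj, hderiv⟩ := h
  have hsub : Icc a' b' ⊆ Icc a b := Icc_subset_Icc ha hb
  exact ⟨η, fun s hs => hη s (hsub hs), hfη.mono hsub, hinj.mono hsub,
    fun s hs => hderiv s (Ioo_subset_Ioo ha hb hs)⟩

theorem IsArc.injOn {f : ℝ → M} {a b : ℝ} (h : IsArc E f a b) : InjOn f (Icc a b) := by
  obtain ⟨η, -, hfη, hinj, -⟩ := h
  exact hinj.congr hfη.symm

theorem IsPiecewiseAnalytic.hasFiniteBreaks {x y : M} {γ : Path x y}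
    (h : IsPiecewiseAnalytic E γ) {P : ℝ → ℝ → Prop}
    (hP : ∀ (η : ℝ → M) (t : ℝ), AnalyticCurveAt E η t → ∃ ε > 0, ∀ a b, a < b → t - ε ≤ a →
      b ≤ t + ε → t ∉ Ioo a b → EqOn γ.extend η (Icc a b) → P a b) :
    HasFiniteBreaks P 0 1 := by
  obtain ⟨n, t, -, h0, h1, hγ⟩ := h
  rw [← h0, ← h1]
  refine .of_partition fun i hi => .of_forall_mem_Icc fun s hs => ?_
  obtain ⟨η, hη, hγη⟩ := hγ i hi
  obtain ⟨ε, hε, hεP⟩ := hP η s (hη s hs)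
  exact ⟨ε, hε, fun a b ha hb hab hεa hεb hsab =>
    hεP a b hab hεa hεb hsab (hγη.mono (Icc_subset_Icc ha hb))⟩

theorem meetsPathsFinitely_arc [T2Space M] {g : ℝ → M} {c d : ℝ}
    (hg : ∀ t ∈ Icc c d, AnalyticCurveAt E g t) (hcd : c < d) (hinj : InjOn g (Icc c d)) :
    MeetsPathsFinitely E (g '' Icc c d) := by
  refine fun γ => γ.2.hasFiniteBreaks fun η t hη => ?_
  obtain ⟨ε, hε, h⟩ := hη.exists_mapsTo_or_mapsTo_compl_arc hg hcd hinj
  refine ⟨ε, hε, fun a b _ ha hb ht heq => ?_⟩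
  have hcongr := (heq.mono Ioo_subset_Icc_self).symm
  exact (h a b ha hb ht).imp (·.congr hcongr) (·.congr hcongr)

theorem IsPiecewiseAnalytic.hasFiniteBreaks_const_or_isArc [CompleteSpace E]
    [IsManifold 𝓘(ℝ, E) ω M] {x y : M} {γ : Path x y} (h : IsPiecewiseAnalytic E γ) :
    HasFiniteBreaks
      (fun a b => (∀ s ∈ Icc a b, γ.extend s = γ.extend a) ∨ IsArc E γ.extend a b) 0 1 := by
  refine h.hasFiniteBreaks fun η t hη => ?_
  obtain ⟨ε, hε, han, hη⟩ := hη.const_or_injOn_Icc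
  refine ⟨ε, hε, fun a b hab ha hb ht heq => ?_⟩
  have hsub : Icc a b ⊆ Icc (t - ε) (t + ε) := Icc_subset_Icc ha hb
  rcases hη with hconst | ⟨hinj, hderiv⟩
  · have ha' := left_mem_Icc.2 hab.le
    exact Or.inl fun s hs => by rw [heq hs, heq ha', hconst s (hsub hs), hconst a (hsub ha')]
  · exact Or.inr ⟨η, fun s hs => han s (hsub hs), heq, hinj a b ha hb ht,
      fun s hs => hderiv s (hsub (Ioo_subset_Icc_self hs)) fun hst => ht (hst ▸ hs)⟩

end Breaks

/-! ### Developing a function along the part of a path inside a set -/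

section Development

variable {M : Type*}

/-- `D` records the change of the function `r` along `f`, as long as `f` runs inside `K`. -/
def IsDevelopment (f : ℝ → M) (K : Set M) (r : M → ℝ) (a b : ℝ) (D : ℝ → ℝ) : Prop :=
  ∀ s t, a ≤ s → s ≤ t → t ≤ b →
    (MapsTo f (Ioo s t) K → D t - D s = r (f t) - r (f s)) ∧ (MapsTo f (Ioo s t) Kᶜ → D t = D s)

namespace IsDevelopment

variable {f f' : ℝ → M} {K : Set M} {r : M → ℝ} {a b c : ℝ} {D D' : ℝ → ℝ}

theorem glue (h : IsDevelopment f K r a b D) (h' : IsDevelopment f K r b c D') (hab : a ≤ b)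
    (hbc : b ≤ c) : ∃ D'', IsDevelopment f K r a c D'' ∧
      D'' c - D'' a = (D b - D a) + (D' c - D' b) := by
  classical
  let D'' : ℝ → ℝ := fun t => if t ≤ b then D t else D b + (D' t - D' b)
  have hleft : ∀ t, t ≤ b → D'' t = D t := fun t ht => if_pos ht
  have hright : ∀ t, b ≤ t → D'' t = D b + (D' t - D' b) := by
    intro t ht
    rcases ht.eq_or_lt with rfl | ht
    · rw [hleft _ le_rfl, sub_self, add_zero]
    · exact if_neg (not_le.2 ht)
  refine ⟨D'', fun s t hs hst ht => ?_, by rw [hright c hbc, hleft a hab]; ring⟩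
  rcases le_total t b with htb | hbt
  · rw [hleft t htb, hleft s (hst.trans htb)]
    exact h s t hs hst htb
  rcases le_total b s with hbs | hsb
  · rw [hright t hbt, hright s hbs]
    obtain ⟨hK, hKc⟩ := h' s t hbs hst ht
    exact ⟨fun hm => by linarith [hK hm], fun hm => by rw [hKc hm]⟩
  · rw [hright t hbt, hleft s hsb]
    obtain ⟨hK, hKc⟩ := h s b hs hsb le_rfl
    obtain ⟨hK', hKc'⟩ := h' b t le_rfl hbt ht
    have hsub : Ioo s b ⊆ Ioo s t := Ioo_subset_Ioo_right hbt
    have hsub' : Ioo b t ⊆ Ioo s t := Ioo_subset_Ioo_left hsb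
    refine ⟨fun hm => ?_, fun hm => ?_⟩
    · linarith [hK (hm.mono_left hsub), hK' (hm.mono_left hsub')]
    · rw [hKc (hm.mono_left hsub), hKc' (hm.mono_left hsub'), sub_self, add_zero]

theorem comp_monotoneOn (h : IsDevelopment f K r a b D) {φ : ℝ → ℝ} {a' b' : ℝ}
    (hφ : ContinuousOn φ (Icc a' b')) (hmono : MonotoneOn φ (Icc a' b'))
    (hmaps : MapsTo φ (Icc a' b') (Icc a b)) (hf : ∀ t ∈ Icc a' b', f' t = f (φ t)) :
    IsDevelopment f' K r a' b' (D ∘ φ) := by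
  intro s t hs hst ht
  have hs_mem : s ∈ Icc a' b' := ⟨hs, hst.trans ht⟩
  have ht_mem : t ∈ Icc a' b' := ⟨hs.trans hst, ht⟩
  have hsub : Icc s t ⊆ Icc a' b' := Icc_subset_Icc hs ht
  have transfer : ∀ S : Set M, MapsTo f' (Ioo s t) S → MapsTo f (Ioo (φ s) (φ t)) S := by
    intro S hS y hy
    obtain ⟨u, hu, rfl⟩ := intermediate_value_Ioo hst (hφ.mono hsub) hy
    rw [← hf u (hsub (Ioo_subset_Icc_self hu))]
    exact hS hu
  obtain ⟨hK, hKc⟩ := h (φ s) (φ t) (hmaps hs_mem).1 (hmono hs_mem ht_mem hst) (hmaps ht_mem).2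
  rw [hf s hs_mem, hf t ht_mem]
  exact ⟨fun hm => hK (transfer _ hm), fun hm => hKc (transfer _ hm)⟩

theorem comp_one_sub (h : IsDevelopment f K r 0 1 D)
    (hf : ∀ t ∈ Icc (0 : ℝ) 1, f' t = f (1 - t)) :
    IsDevelopment f' K r 0 1 (fun t => D (1 - t)) := by
  intro s t hs hst ht
  have transfer : ∀ S : Set M, MapsTo f' (Ioo s t) S → MapsTo f (Ioo (1 - t) (1 - s)) S := by
    intro S hS y hy
    have hy' : 1 - y ∈ Ioo s t := ⟨by linarith [hy.2], by linarith [hy.1]⟩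
    simpa [hf _ ⟨hs.trans hy'.1.le, hy'.2.le.trans ht⟩] using hS hy'
  obtain ⟨hK, hKc⟩ := h (1 - t) (1 - s) (by linarith) (by linarith) (by linarith)
  rw [hf s ⟨hs, hst.trans ht⟩, hf t ⟨hs.trans hst, ht⟩]
  exact ⟨fun hm => by linarith [hK (transfer _ hm)], fun hm => (hKc (transfer _ hm)).symm⟩

theorem of_mapsTo (h : MapsTo f (Ioo a b) K) : IsDevelopment f K r a b (r ∘ f) := by
  refine fun s t hs hst ht => ⟨fun _ => rfl, fun hm => ?_⟩
  rcases hst.eq_or_lt with rfl | hlt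
  · rfl
  · obtain ⟨u, hu⟩ := nonempty_Ioo.2 hlt
    exact absurd (h (Ioo_subset_Ioo hs ht hu)) (hm hu)

theorem of_mapsTo_compl (h : MapsTo f (Ioo a b) Kᶜ) :
    IsDevelopment f K r a b (fun _ => 0) := by
  refine fun s t hs hst ht => ⟨fun hm => ?_, fun _ => rfl⟩
  rcases hst.eq_or_lt with rfl | hlt
  · rw [sub_self, sub_self]
  · obtain ⟨u, hu⟩ := nonempty_Ioo.2 hlt
    exact absurd (hm hu) (h (Ioo_subset_Ioo hs ht hu))

theorem exists_of_hasFiniteBreaks (hab : a < b)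
    (h : HasFiniteBreaks (fun s t => MapsTo f (Ioo s t) K ∨ MapsTo f (Ioo s t) Kᶜ) a b) :
    ∃ D, IsDevelopment f K r a b D := by
  refine h.induction (Q := fun s t => ∃ D, IsDevelopment f K r s t D) hab ?_ ?_
  · rintro s t - - - (hm | hm)
    exacts [⟨_, of_mapsTo hm⟩, ⟨_, of_mapsTo_compl hm⟩]
  · rintro s v t hsv hvt ⟨D, hD⟩ ⟨D', hD'⟩
    obtain ⟨D'', hD'', -⟩ := hD.glue hD' hsv.le hvt.le
    exact ⟨D'', hD''⟩

theorem sub_eq_sub (hD : IsDevelopment f K r a b D) (hD' : IsDevelopment f K r a b D')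
    (hab : a < b)
    (h : HasFiniteBreaks (fun s t => MapsTo f (Ioo s t) K ∨ MapsTo f (Ioo s t) Kᶜ) a b) :
    D b - D a = D' b - D' a := by
  refine h.induction (Q := fun s t => D t - D s = D' t - D' s) hab ?_
    fun s v t _ _ h₁ h₂ => by linarith
  rintro s t hs ht hst (hm | hm)
  · rw [(hD s t hs hst.le ht).1 hm, (hD' s t hs hst.le ht).1 hm]
  · rw [(hD s t hs hst.le ht).2 hm, (hD' s t hs hst.le ht).2 hm, sub_self, sub_self]

end IsDevelopment

variable {E : Type*} [NormedAddCommGroup E] [NormedSpace ℝ E] [TopologicalSpace M]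
  [ChartedSpace E M]

namespace MeetsPathsFinitely

variable {K : Set M} (hK : MeetsPathsFinitely E K) (r : M → ℝ) {x y z : M}

include hK in
theorem exists_isDevelopment (γ : PAPath E x y) : ∃ D, IsDevelopment γ.1.extend K r 0 1 D :=
  IsDevelopment.exists_of_hasFiniteBreaks one_pos (hK γ)

/-- The total change of `r` along the part of `γ` inside `K`; it does not depend on the chosen
development by `IsDevelopment.sub_eq_sub`. -/
noncomputable def change (γ : PAPath E x y) : ℝ :=
  (hK.exists_isDevelopment r γ).choose 1 - (hK.exists_isDevelopment r γ).choose 0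

variable {r}

theorem change_eq {γ : PAPath E x y} {D : ℝ → ℝ} (hD : IsDevelopment γ.1.extend K r 0 1 D) :
    hK.change r γ = D 1 - D 0 :=
  (hK.exists_isDevelopment r γ).choose_spec.sub_eq_sub hD one_pos (hK γ)

theorem change_trans (γ : PAPath E x y) (γ' : PAPath E y z) :
    hK.change r (γ.trans γ') = hK.change r γ + hK.change r γ' := by
  obtain ⟨D, hD⟩ := hK.exists_isDevelopment r γ
  obtain ⟨D', hD'⟩ := hK.exists_isDevelopment r γ'
  have hleft : IsDevelopment (γ.trans γ').1.extend K r 0 (1 / 2) (D ∘ fun t => 2 * t) :=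
    hD.comp_monotoneOn (by fun_prop) (fun s _ t _ hst => by linarith)
      (fun t ht => ⟨by linarith [ht.1], by linarith [ht.2]⟩)
      (fun t ht => Path.extend_trans_of_le_half _ _ ht.2)
  have hright : IsDevelopment (γ.trans γ').1.extend K r (1 / 2) 1 (D' ∘ fun t => 2 * t - 1) :=
    hD'.comp_monotoneOn (by fun_prop) (fun s _ t _ hst => by linarith)
      (fun t ht => ⟨by linarith [ht.1], by linarith [ht.2]⟩)
      (fun t ht => Path.extend_trans_of_half_le _ _ ht.1)
  obtain ⟨D'', hD'', hsum⟩ := hleft.glue hright (by norm_num) (by norm_num)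
  rw [hK.change_eq hD'', hK.change_eq hD, hK.change_eq hD', hsum]
  norm_num

theorem change_symm (γ : PAPath E x y) : hK.change r γ.symm = -hK.change r γ := by
  obtain ⟨D, hD⟩ := hK.exists_isDevelopment r γ
  have hsymm : IsDevelopment γ.symm.1.extend K r 0 1 (fun t => D (1 - t)) :=
    hD.comp_one_sub fun t _ => Path.extend_symm_apply _ _
  rw [hK.change_eq hsymm, hK.change_eq hD]
  norm_num

theorem change_reparam {α β : PAPath E x y} {φ : I → I} (hφ : Continuous φ) (hmono : Monotone φ)
    (h0 : φ 0 = 0) (h1 : φ 1 = 1) (h : ∀ t, β.1 t = α.1 (φ t)) :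
    hK.change r α = hK.change r β := by
  obtain ⟨D, hD⟩ := hK.exists_isDevelopment r α
  have hβ : IsDevelopment β.1.extend K r 0 1
      (D ∘ fun t => (φ (projIcc 0 1 zero_le_one t) : ℝ)) := by
    refine hD.comp_monotoneOn (by fun_prop) (fun s _ t _ hst => hmono (monotone_projIcc _ hst))
      (fun t _ => (φ _).2) fun t ht => ?_
    rw [Path.extend_apply _ ht, h, Path.extend_apply _ (φ _).2, projIcc_of_mem _ ht]
  rw [hK.change_eq hD, hK.change_eq hβ]
  simp [h0, h1]

theorem change_eq_of_elementarySetoid {γ γ' : PAPath E x y} (h : elementarySetoid E x y γ γ') :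
    hK.change r γ = hK.change r γ' := by
  induction h with
  | refl => rfl
  | symm _ _ _ ih => exact ih.symm
  | trans _ _ _ _ _ ih ih' => exact ih.trans ih'
  | rel _ _ hmove =>
    cases hmove with
    | reparam _ _ φ hφ hmono h0 h1 h => exact hK.change_reparam hφ hmono h0 h1 h
    | retrace p q δ => simp only [change_trans, change_symm, add_neg_cancel, zero_add]

variable (r)

/-- The total change of `r` inside `K`, as a homomorphism on the group of loops. -/
noncomputable def changeHom (x : M) : LoopGroup E x →* Multiplicative ℝ :=
  MonoidHom.mk' (Quotient.lift (fun γ : PAPath E x x => Multiplicative.ofAdd (hK.change r γ))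
    fun _ _ h => congrArg Multiplicative.ofAdd (hK.change_eq_of_elementarySetoid h)) <| by
    rintro ⟨α⟩ ⟨β⟩
    exact congrArg Multiplicative.ofAdd (hK.change_trans α β)

theorem changeHom_loopClass {x : M} (α : PAPath E x x) :
    hK.changeHom r x (loopClass α) = Multiplicative.ofAdd (hK.change r α) :=
  rfl

end MeetsPathsFinitely

end Development

/-! ### Independent loops are separated by homomorphisms -/

section IndependentLoops

theorem continuousOn_of_comp_injOn {X Y N : Type*} [TopologicalSpace X] [TopologicalSpace Y]
    [TopologicalSpace N] [T2Space N] {f : Y → N} {g : X → N} {h : X → Y} {S : Set Y} {T : Set X}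
    (hS : IsCompact S) (hf : ContinuousOn f S) (hinj : InjOn f S) (hg : ContinuousOn g T)
    (hh : MapsTo h T S) (hcomp : ∀ t ∈ T, f (h t) = g t) : ContinuousOn h T := by
  rw [continuousOn_iff_isClosed]
  intro C hC
  have hcl : IsClosed (f '' (S ∩ C)) :=
    ((hS.inter_right hC).image_of_continuousOn (hf.mono inter_subset_left)).isClosed
  obtain ⟨u, hu, hu'⟩ := continuousOn_iff_isClosed.1 hg _ hcl
  refine ⟨u, hu, ?_⟩
  rw [← hu']
  ext t
  simp only [mem_inter_iff, mem_preimage]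
  refine and_congr_left fun ht => ⟨fun hc => ⟨h t, ⟨hh ht, hc⟩, hcomp t ht⟩, ?_⟩
  rintro ⟨s, ⟨hs, hsC⟩, hst⟩
  rwa [← hinj hs (hh ht) (hst.trans (hcomp t ht).symm)]

theorem IsDevelopment.sub_eq_of_mem_iff_mem_Icc {M : Type*} {f : ℝ → M} {K : Set M} {r : M → ℝ}
    {a b p q : ℝ} {D : ℝ → ℝ} (hD : IsDevelopment f K r a b D) (hap : a ≤ p) (hpq : p ≤ q)
    (hqb : q ≤ b) (hK : ∀ t ∈ Icc a b, f t ∈ K ↔ t ∈ Icc p q) :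
    D b - D a = r (f q) - r (f p) := by
  have before : D p = D a := (hD a p le_rfl hap (hpq.trans hqb)).2 fun t ht hmem =>
    ht.2.not_ge ((hK t ⟨ht.1.le, (ht.2.le.trans hpq).trans hqb⟩).1 hmem).1
  have inside : D q - D p = r (f q) - r (f p) := (hD p q hap hpq hqb).1 fun t ht =>
    (hK t ⟨hap.trans ht.1.le, ht.2.le.trans hqb⟩).2 (Ioo_subset_Icc_self ht)
  have after : D b = D q := (hD q b (hap.trans hpq) hqb le_rfl).2 fun t ht hmem =>
    ht.1.not_ge ((hK t ⟨(hap.trans hpq).trans ht.1.le, ht.2.le⟩).1 hmem).2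
  rw [after, ← before, inside]

section Path

variable {M : Type*} [TopologicalSpace M] [T2Space M] {x y : M} {β : Path x y} {e : ℝ → M}
  {c d : ℝ}

theorem exists_continuousOn_injOn_of_existsUnique (he : ContinuousOn e (Icc c d))
    (hinj : InjOn e (Icc c d)) (hβ : ∀ s ∈ Icc c d, ∃! t : I, β t = e s) :
    ∃ τ : ℝ → ℝ, ContinuousOn τ (Icc c d) ∧ InjOn τ (Icc c d) ∧ MapsTo τ (Icc c d) I ∧
      (∀ s ∈ Icc c d, β.extend (τ s) = e s) ∧
      ∀ t ∈ I, β.extend t ∈ e '' Icc c d ↔ t ∈ τ '' Icc c d := by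
  choose! τ hτ hτ' using hβ
  dsimp only at hτ hτ'
  have hext (s : ℝ) (hs : s ∈ Icc c d) : β.extend (τ s) = e s :=
    (β.extend_extends' (τ s)).trans (hτ s hs)
  have hS : IsCompact (β ⁻¹' (e '' Icc c d)) :=
    ((isCompact_Icc.image_of_continuousOn he).isClosed.preimage β.continuous).isCompact
  have hβinj : InjOn β (β ⁻¹' (e '' Icc c d)) := by
    rintro t ⟨s, hs, hst⟩ t' - htt'
    rw [hτ' s hs t hst.symm, hτ' s hs t' (htt'.symm.trans hst.symm)]
  refine ⟨fun s => τ s, ?_, ?_, fun s _ => (τ s).2, hext, fun t ht => ⟨?_, ?_⟩⟩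
  · exact continuous_subtype_val.comp_continuousOn (continuousOn_of_comp_injOn hS
      β.continuous.continuousOn hβinj he (fun s hs => ⟨s, hs, (hτ s hs).symm⟩) hτ)
  · intro s hs s' hs' hss'
    exact hinj hs hs' (by rw [← hτ s hs, ← hτ s' hs', Subtype.ext hss'])
  · rw [Path.extend_apply _ ht]
    rintro ⟨s, hs, hst⟩
    exact ⟨s, hs, congrArg Subtype.val (hτ' s hs ⟨t, ht⟩ hst.symm).symm⟩
  · rintro ⟨s, hs, rfl⟩
    exact ⟨s, hs, (hext s hs).symm⟩

theorem IsDevelopment.sub_ne_zero_of_existsUnique (hcd : c < d) (he : ContinuousOn e (Icc c d))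
    (hinj : InjOn e (Icc c d)) (hβ : ∀ s ∈ Icc c d, ∃! t : I, β t = e s) {r : M → ℝ}
    (hr : ∀ s ∈ Icc c d, r (e s) = s) {D : ℝ → ℝ}
    (hD : IsDevelopment β.extend (e '' Icc c d) r 0 1 D) : D 1 - D 0 ≠ 0 := by
  obtain ⟨τ, hτ, hτinj, hmaps, hβτ, hmem⟩ := exists_continuousOn_injOn_of_existsUnique he hinj hβ
  have hc : c ∈ Icc c d := left_mem_Icc.2 hcd.le
  have hd : d ∈ Icc c d := right_mem_Icc.2 hcd.le
  rcases ContinuousOn.strictMonoOn_of_injOn_Icc' hcd.le hτ hτinj with hm | hm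
  · have himage : τ '' Icc c d = Icc (τ c) (τ d) := Subset.antisymm
      hm.monotoneOn.mapsTo_Icc.image_subset (intermediate_value_Icc hcd.le hτ)
    rw [hD.sub_eq_of_mem_iff_mem_Icc (hmaps hc).1 (hm hc hd hcd).le (hmaps hd).2
      (himage ▸ hmem), hβτ c hc, hβτ d hd, hr c hc, hr d hd]
    exact sub_ne_zero.2 hcd.ne'
  · have himage : τ '' Icc c d = Icc (τ d) (τ c) := Subset.antisymm
      hm.antitoneOn.mapsTo_Icc.image_subset (intermediate_value_Icc' hcd.le hτ)
    rw [hD.sub_eq_of_mem_iff_mem_Icc (hmaps hd).1 (hm hc hd hcd).le (hmaps hc).2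
      (himage ▸ hmem), hβτ c hc, hβτ d hd, hr c hc, hr d hd]
    exact sub_ne_zero.2 hcd.ne

end Path

variable {E : Type*} [NormedAddCommGroup E] [NormedSpace ℝ E]
  {M : Type*} [TopologicalSpace M] [ChartedSpace E M]

namespace IsEdge

variable {e : ℝ → M}

theorem injOn_Ioo (he : IsEdge E e) : InjOn e (Ioo 0 1) :=
  injOn_iff_injective.2 he.embedding.injective

theorem ne_of_mem_Ioo (he : IsEdge E e) {s v : ℝ} (hs : s ∈ Ioo (0 : ℝ) 1)
    (hv : v ∈ Icc (0 : ℝ) 1) (hsv : s ≠ v) : e s ≠ e v := by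
  intro heq
  let l : Filter (Ioo (0 : ℝ) 1) := Filter.comap (↑) (𝓝 v)
  have : l.NeBot := mem_closure_iff_comap_neBot.1 (by rwa [closure_Ioo zero_ne_one])
  have hlv : Filter.Tendsto (fun t : Ioo (0 : ℝ) 1 => (t : ℝ)) l (𝓝 v) := Filter.tendsto_comap
  have hls : Filter.Tendsto id l (𝓝 (⟨s, hs⟩ : Ioo (0 : ℝ) 1)) := by
    rw [he.embedding.isInducing.tendsto_nhds_iff]
    have := (he.analytic v hv).continuousAt.tendsto.comp hlv
    rwa [← heq] at this
  exact hsv (tendsto_nhds_unique ((continuous_subtype_val.tendsto _).comp hls) hlv)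

theorem notMem_vertices (he : IsEdge E e) {s : ℝ} (hs : s ∈ Ioo (0 : ℝ) 1) :
    e s ∉ edgeVertices e := by
  rintro (h | h)
  · exact he.ne_of_mem_Ioo hs (by simp) hs.1.ne' h
  · exact he.ne_of_mem_Ioo hs (by simp) hs.2.ne h

end IsEdge

namespace IndependentLoops

variable [T2Space M] {x : M} {n : ℕ} {β : Fin n → PAPath E x x}

theorem exists_hom_real (hβ : IndependentLoops β) (i : Fin n) :
    ∃ h : LoopGroup E x →* Multiplicative ℝ, (h (loopClass (β i))).toAdd ≠ 0 ∧
      ∀ j, j ≠ i → h (loopClass (β j)) = 1 := by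
  obtain ⟨m, e, hgraph, hind⟩ := hβ
  obtain ⟨k, hk, hk'⟩ := hind i
  have he := hgraph.isEdge k
  have hsub : Icc (1 / 4 : ℝ) (3 / 4) ⊆ Ioo 0 1 := Icc_subset_Ioo (by norm_num) (by norm_num)
  have hcd : (1 / 4 : ℝ) < 3 / 4 := by norm_num
  have hinj : InjOn (e k) (Icc (1 / 4 : ℝ) (3 / 4)) := he.injOn_Ioo.mono hsub
  have han : ∀ t ∈ Icc (1 / 4 : ℝ) (3 / 4), AnalyticCurveAt E (e k) t :=
    fun t ht => he.analytic t (Ioo_subset_Icc_self (hsub ht))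
  have hK : MeetsPathsFinitely E (e k '' Icc (1 / 4 : ℝ) (3 / 4)) :=
    meetsPathsFinitely_arc han hcd hinj
  let r : M → ℝ := Function.invFunOn (e k) (Icc (1 / 4 : ℝ) (3 / 4))
  refine ⟨hK.changeHom r x, ?_, fun j hj => ?_⟩
  · obtain ⟨D, hD⟩ := hK.exists_isDevelopment r (β i)
    rw [hK.changeHom_loopClass, toAdd_ofAdd, hK.change_eq hD]
    exact hD.sub_ne_zero_of_existsUnique hcd
      (fun t ht => (han t ht).continuousAt.continuousWithinAt) hinj (fun s hs => hk s (hsub hs))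
      fun s hs => hinj.leftInvOn_invFunOn hs
  · have hD : IsDevelopment (β j).1.extend (e k '' Icc (1 / 4 : ℝ) (3 / 4)) r 0 1 fun _ => 0 := by
      refine IsDevelopment.of_mapsTo_compl ?_
      rintro t ht ⟨s, hs, hst⟩
      refine he.notMem_vertices (hsub hs) (hk' j hj ⟨⟨s, Ioo_subset_Icc_self (hsub hs), rfl⟩, ?_⟩)
      rw [hst, Path.extend_apply _ (Ioo_subset_Icc_self ht)]
      exact mem_range_self _
    rw [hK.changeHom_loopClass, hK.change_eq hD, sub_self, ofAdd_zero]

theorem exists_hom_circle (hβ : IndependentLoops β) (z : Fin n → Circle) :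
    ∃ H : LoopGroup E x →* Circle, ∀ k, H (loopClass (β k)) = z k := by
  choose h h_self h_ne using hβ.exists_hom_real
  choose θ hθ using fun k => Circle.exp_surjective (z k)
  let H : Fin n → LoopGroup E x →* Circle := fun i =>
    MonoidHom.mk' (fun α => Circle.exp (θ i / (h i (loopClass (β i))).toAdd * (h i α).toAdd))
      (fun a b => by rw [map_mul (h i), toAdd_mul, mul_add, Circle.exp_add])
  refine ⟨∏ i, H i, fun k => ?_⟩
  rw [MonoidHom.finsetProd_apply, Finset.prod_eq_single k]
  · change Circle.exp _ = _
    rw [div_mul_cancel₀ _ (h_self k), hθ]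
  · intro i _ hik
    change Circle.exp _ = _
    rw [h_ne i k hik.symm, toAdd_one, mul_zero, Circle.exp_zero]
  · simp

end IndependentLoops

end IndependentLoops

/-! ### The graph of a finite family of loops -/

section Subdivision

/-- The break points of a subdivision of `[0, 1]`, as a finite set containing `0` and `1`. -/
structure IsSubdivision (V : Set ℝ) : Prop where
  finite : V.Finite
  subset_Icc : V ⊆ Icc 0 1
  zero_mem : 0 ∈ V
  one_mem : 1 ∈ V

/-- `a < b` are consecutive points of `V`. -/
structure IsGap (V : Set ℝ) (a b : ℝ) : Prop where
  left_mem : a ∈ V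
  right_mem : b ∈ V
  lt : a < b
  disjoint : Disjoint (Ioo a b) V

theorem finite_setOf_isGap {ι : Type*} [Finite ι] {V : ι → Set ℝ}
    (hV : ∀ i, IsSubdivision (V i)) :
    {p : ι × ℝ × ℝ | IsGap (V p.1) p.2.1 p.2.2}.Finite := by
  refine (finite_iUnion fun i =>
    ((hV i).finite.prod (hV i).finite).image (Prod.mk i)).subset ?_
  exact fun ⟨i, a, b⟩ hp => mem_iUnion.2 ⟨i, (a, b), ⟨hp.left_mem, hp.right_mem⟩, rfl⟩

namespace IsSubdivision

variable {V W : Set ℝ}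

theorem union (hV : IsSubdivision V) (hW : W.Finite) (hW' : W ⊆ Icc 0 1) :
    IsSubdivision (V ∪ W) where
  finite := hV.finite.union hW
  subset_Icc := union_subset hV.subset_Icc hW'
  zero_mem := Or.inl hV.zero_mem
  one_mem := Or.inl hV.one_mem

theorem exists_isGap (hV : IsSubdivision V) {a b : ℝ} (ha : 0 ≤ a) (hb : b ≤ 1) (hab : a < b)
    (hdisj : Disjoint (Ioo a b) V) : ∃ a' b', IsGap V a' b' ∧ a' ≤ a ∧ b ≤ b' := by
  obtain ⟨a', ⟨ha', ha'a⟩, hmax⟩ := (hV.finite.inter_of_left (Iic a)).exists_maximal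
    ⟨0, hV.zero_mem, ha⟩
  obtain ⟨b', ⟨hb', hbb'⟩, hmin⟩ := (hV.finite.inter_of_left (Ici b)).exists_minimal
    ⟨1, hV.one_mem, hb⟩
  refine ⟨a', b', ⟨ha', hb', ha'a.trans_lt (hab.trans_le hbb'), ?_⟩, ha'a, hbb'⟩
  refine disjoint_left.2 fun u hu huV => ?_
  rcases le_or_gt u a with hua | hau
  · exact (hmax ⟨huV, hua⟩ hu.1.le).not_gt hu.1
  rcases le_or_gt b u with hbu | hub
  · exact (hmin ⟨huV, hbu⟩ hu.2.le).not_gt hu.2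
  · exact disjoint_left.1 hdisj ⟨hau, hub⟩ huV

theorem exists_isGap_of_subset (hV : IsSubdivision V) (hW : IsSubdivision W) (hVW : V ⊆ W)
    {a b : ℝ} (h : IsGap W a b) : ∃ a' b', IsGap V a' b' ∧ a' ≤ a ∧ b ≤ b' :=
  hV.exists_isGap (hW.subset_Icc h.left_mem).1 (hW.subset_Icc h.right_mem).2 h.lt
    (h.disjoint.mono_right hVW)

theorem const_or_of_subset (hV : IsSubdivision V) (hW : IsSubdivision W) (hVW : V ⊆ W)
    {N : Type*} {f : ℝ → N} {P : ℝ → ℝ → Prop}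
    (hP : ∀ a b, IsGap V a b → (∀ s ∈ Icc a b, f s = f a) ∨ P a b) {a b : ℝ}
    (h : IsGap W a b) :
    (∀ s ∈ Icc a b, f s = f a) ∨ ∃ c d, IsGap V c d ∧ P c d ∧ c ≤ a ∧ b ≤ d := by
  obtain ⟨c, d, hgap, hc, hd⟩ := hV.exists_isGap_of_subset hW hVW h
  refine (hP c d hgap).imp (fun hcd s hs => ?_) fun hcd => ⟨c, d, hgap, hcd, hc, hd⟩
  rw [hcd s ⟨hc.trans hs.1, hs.2.trans hd⟩, hcd a ⟨hc, h.lt.le.trans hd⟩]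

theorem induction (hV : IsSubdivision V) {Q : ℝ → ℝ → Prop} (base : ∀ a b, IsGap V a b → Q a b)
    (glue : ∀ a ∈ V, ∀ v ∈ V, ∀ b ∈ V, a < v → v < b → Q a v → Q v b → Q a b) : Q 0 1 := by
  refine interval_induction_of_finite (Q := fun a b => a ∈ V → b ∈ V → Q a b) hV.finite ?_ ?_
    zero_lt_one hV.zero_mem hV.one_mem
  · exact fun a b hab hdisj ha hb => base a b ⟨ha, hb, hab, hdisj⟩
  · exact fun a v hv b hav hvb hl hr ha hb => glue a ha v hv b hb hav hvb (hl ha hv) (hr hv hb)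

theorem exists_refinement (hV : IsSubdivision V) {N : Type*} {f : ℝ → N} {S : Set N}
    (hS : S.Finite) (hVS : MapsTo f V S)
    (hf : ∀ a b, IsGap V a b → (∀ s ∈ Icc a b, f s = f a) ∨ InjOn f (Icc a b)) :
    ∃ W, IsSubdivision W ∧ V ⊆ W ∧ MapsTo f W S ∧
      ∀ a b, IsGap W a b → (∀ s ∈ Icc a b, f s = f a) ∨ MapsTo f (Ioo a b) Sᶜ := by
  let gaps : Set (ℝ × ℝ) := {p | IsGap V p.1 p.2 ∧ InjOn f (Icc p.1 p.2)}
  have hgaps : gaps.Finite := (hV.finite.prod hV.finite).subset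
    fun p hp => ⟨hp.1.left_mem, hp.1.right_mem⟩
  let Z : Set ℝ := ⋃ p ∈ gaps, Icc p.1 p.2 ∩ f ⁻¹' S
  have hZ : Z.Finite := hgaps.biUnion fun p hp => Finite.of_finite_image
    (hS.subset (image_subset_iff.2 inter_subset_right)) (hp.2.mono inter_subset_left)
  have hZI : Z ⊆ Icc 0 1 := iUnion₂_subset fun p hp => inter_subset_left.trans
    (Icc_subset_Icc (hV.subset_Icc hp.1.left_mem).1 (hV.subset_Icc hp.1.right_mem).2)
  have hW := hV.union hZ hZI
  refine ⟨V ∪ Z, hW, subset_union_left, ?_, fun a b hab => ?_⟩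
  · exact mapsTo_iff_subset_preimage.2
      (union_subset hVS (iUnion₂_subset fun p _ => inter_subset_right))
  refine (hV.const_or_of_subset hW subset_union_left hf hab).imp id ?_
  rintro ⟨c, d, hgap, hinj, hc, hd⟩ u hu huS
  exact disjoint_left.1 hab.disjoint hu (Or.inr (mem_iUnion₂.2
    ⟨(c, d), ⟨hgap, hinj⟩, ⟨hc.trans hu.1.le, hu.2.le.trans hd⟩, huS⟩))

end IsSubdivision

theorem HasFiniteBreaks.exists_isSubdivision {P : ℝ → ℝ → Prop} (h : HasFiniteBreaks P 0 1) :
    ∃ V, IsSubdivision V ∧ ∀ a b, 0 ≤ a → b ≤ 1 → a < b → Disjoint (Ioo a b) V → P a b := by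
  obtain ⟨V, hV, hP⟩ := h
  refine ⟨{0, 1} ∪ V ∩ Icc 0 1, ⟨(toFinite _).union (hV.inter_of_left _), ?_, by simp, by simp⟩,
    fun a b ha hb hab hdisj => hP a b ha hb hab (disjoint_left.2 fun u hu huV => ?_)⟩
  · exact union_subset (by simp [insert_subset_iff]) inter_subset_right
  · exact disjoint_left.1 hdisj hu
      (Or.inr ⟨huV, ha.trans hu.1.le, hu.2.le.trans hb⟩)

theorem HasFiniteBreaks.forall {κ : Type*} [Finite κ] {P : κ → ℝ → ℝ → Prop} {A B : ℝ}
    (h : ∀ k, HasFiniteBreaks (P k) A B) : HasFiniteBreaks (fun a b => ∀ k, P k a b) A B := by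
  choose V hV hP using h
  exact ⟨⋃ k, V k, finite_iUnion hV, fun a b ha hb hab hdisj k =>
    hP k a b ha hb hab (hdisj.mono_right (subset_iUnion V k))⟩

end Subdivision

section Graph

theorem image_Icc_eq_closure_image_Ioo {N : Type*} [TopologicalSpace N] [T2Space N] {f : ℝ → N}
    {a b : ℝ} (hab : a < b) (hf : ContinuousOn f (Icc a b)) :
    f '' Icc a b = closure (f '' Ioo a b) := by
  have hcl := closure_Ioo hab.ne
  rw [← image_closure_of_isCompact (hcl ▸ isCompact_Icc) (hcl ▸ hf), hcl]

/-- The lift of `f` through the arc `g` has connected range, which cannot leave `(c, d)`. -/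
theorem image_Ioo_subset_image_Ioo {N : Type*} [TopologicalSpace N] [T2Space N] {f g : ℝ → N}
    {a b c d c' d' : ℝ} (hf : ContinuousOn f (Ioo a b)) (hg : ContinuousOn g (Icc c' d'))
    (hinj : InjOn g (Icc c' d')) (hmaps : MapsTo f (Ioo a b) (g '' Icc c' d')) (hc : c' ≤ c)
    (hd : d ≤ d') (hgc : g c ∉ f '' Ioo a b) (hgd : g d ∉ f '' Ioo a b)
    (hmeet : (f '' Ioo a b ∩ g '' Ioo c d).Nonempty) : f '' Ioo a b ⊆ g '' Ioo c d := by
  have hlift : ∀ s ∈ Ioo a b, ∃ t ∈ Icc c' d', g t = f s := fun s hs => hmaps hs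
  choose! h hh hgh using hlift
  have hcont : ContinuousOn h (Ioo a b) :=
    continuousOn_of_comp_injOn isCompact_Icc hg hinj hf hh hgh
  have hord : (h '' Ioo a b).OrdConnected := (isPreconnected_Ioo.image h hcont).ordConnected
  have hmiss : ∀ v, g v ∉ f '' Ioo a b → v ∉ h '' Ioo a b := by
    rintro _ hv ⟨s, hs, rfl⟩
    exact hv (hgh s hs ▸ mem_image_of_mem f hs)
  obtain ⟨_, ⟨u, hu, rfl⟩, w, hw, hwu⟩ := hmeet
  have hhu : h u = w :=
    hinj (hh u hu) ⟨hc.trans hw.1.le, hw.2.le.trans hd⟩ ((hgh u hu).trans hwu.symm)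
  have hw' : w ∈ h '' Ioo a b := ⟨u, hu, hhu⟩
  rintro _ ⟨s, hs, rfl⟩
  have hs' := mem_image_of_mem h hs
  refine ⟨h s, ⟨not_le.1 fun hsc => ?_, not_le.1 fun hds => ?_⟩, hgh s hs⟩
  · exact hmiss c hgc (hord.out hs' hw' ⟨hsc, hw.1.le⟩)
  · exact hmiss d hgd (hord.out hw' hs' ⟨hw.2.le, hds⟩)

theorem image_of_eqOn_comp_affine {N : Type*} {e f : ℝ → N} {a b : ℝ} (hab : a < b)
    (h : ∀ s ∈ Icc (0 : ℝ) 1, e s = f ((b - a) * s + a)) :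
    e '' Icc 0 1 = f '' Icc a b ∧ e '' Ioo 0 1 = f '' Ioo a b := by
  have hba : 0 < b - a := sub_pos.2 hab
  constructor
  · rw [image_congr h, ← image_image f, image_affine_Icc' hba]
    simp
  · rw [image_congr fun s hs => h s (Ioo_subset_Icc_self hs), ← image_image f,
      image_affine_Ioo hba]
    simp

variable {E : Type*} [NormedAddCommGroup E] [NormedSpace ℝ E]
  {M : Type*} [TopologicalSpace M] [ChartedSpace E M]

theorem mfderiv_comp_affine_ne_zero {η : ℝ → M} {c d t : ℝ}
    (hη : MDifferentiableAt 𝓘(ℝ, ℝ) 𝓘(ℝ, E) η (c * t + d)) (hc : c ≠ 0)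
    (h : mfderiv 𝓘(ℝ, ℝ) 𝓘(ℝ, E) η (c * t + d) ≠ 0) :
    mfderiv 𝓘(ℝ, ℝ) 𝓘(ℝ, E) (fun s => η (c * s + d)) t ≠ 0 := by
  have haff : HasMFDerivAt 𝓘(ℝ, ℝ) 𝓘(ℝ, ℝ) (fun s : ℝ => c * s + d) t
      (c • ContinuousLinearMap.id ℝ ℝ) :=
    (((hasFDerivAt_id t).const_mul c).add_const d).hasMFDerivAt
  have hcomp := (hη.hasMFDerivAt.comp t haff).mfderiv
  refine fun h0 => h (ContinuousLinearMap.ext fun v => ?_)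
  have hv := DFunLike.congr_fun (hcomp.symm.trans h0) (c⁻¹ • v)
  change mfderiv 𝓘(ℝ, ℝ) 𝓘(ℝ, E) η (c * t + d) (c • c⁻¹ • v) = 0 at hv
  rwa [smul_inv_smul₀ hc] at hv

theorem IsArc.exists_isEdge [T2Space M] {f : ℝ → M} {a b : ℝ} (h : IsArc E f a b) (hab : a < b) :
    ∃ e : ℝ → M, IsEdge E e ∧ InjOn e (Icc 0 1) ∧
      ∀ s ∈ Icc (0 : ℝ) 1, e s = f ((b - a) * s + a) := by
  obtain ⟨η, hη, hfη, hinj, hderiv⟩ := h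
  have hba : 0 < b - a := sub_pos.2 hab
  have hmem : ∀ s ∈ Icc (0 : ℝ) 1, (b - a) * s + a ∈ Icc a b := fun s hs =>
    ⟨by nlinarith [hs.1], by nlinarith [hs.2]⟩
  have hmem' : ∀ s ∈ Ioo (0 : ℝ) 1, (b - a) * s + a ∈ Ioo a b := fun s hs =>
    ⟨by nlinarith [hs.1], by nlinarith [hs.2]⟩
  have hean : ∀ t ∈ Icc (0 : ℝ) 1, AnalyticCurveAt E (fun s => η ((b - a) * s + a)) t :=
    fun t ht => (hη _ (hmem t ht)).comp_affine
  have hei : InjOn (fun s => η ((b - a) * s + a)) (Icc 0 1) := fun s hs t ht hst =>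
    mul_left_cancel₀ hba.ne' (add_right_cancel (hinj (hmem s hs) (hmem t ht) hst))
  refine ⟨_, ⟨hean, fun t ht => ?_, ?_⟩, hei, fun s hs => (hfη (hmem s hs)).symm⟩
  · exact mfderiv_comp_affine_ne_zero
      ((hη _ (Ioo_subset_Icc_self (hmem' t ht))).mdifferentiableAt (by simp)) hba.ne'
      (hderiv _ (hmem' t ht))
  · have hcont : Continuous ((Icc (0 : ℝ) 1).domRestrict fun s => η ((b - a) * s + a)) :=
      continuousOn_iff_continuous_domRestrict.1
        fun t ht => (hean t ht).continuousAt.continuousWithinAt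
    exact (hcont.isClosedEmbedding (injOn_iff_injective.1 hei)).isEmbedding.comp
      (IsEmbedding.inclusion Ioo_subset_Icc_self)

variable (E) in
/-- On `[a, b]`, `f` runs along an arc which meets the set `S` of vertices exactly in its two end
points: it is the candidate for an edge of a graph with vertices in `S`. -/
structure IsEdgePiece (S : Set M) (f : ℝ → M) (a b : ℝ) : Prop where
  lt : a < b
  isArc : IsArc E f a b
  left_mem : f a ∈ S
  right_mem : f b ∈ S
  mapsTo : MapsTo f (Ioo a b) Sᶜ

theorem IsEdgePiece.exists_isEdge [T2Space M] {S : Set M} {f : ℝ → M} {a b : ℝ}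
    (h : IsEdgePiece E S f a b) : ∃ e : ℝ → M, IsEdge E e ∧ InjOn e (Icc 0 1) ∧
      e '' Ioo 0 1 = f '' Ioo a b ∧ IsEdgePiece E S e 0 1 := by
  obtain ⟨e, he, hinj, hef⟩ := h.isArc.exists_isEdge h.lt
  have hIoo := (image_of_eqOn_comp_affine h.lt hef).2
  refine ⟨e, he, hinj, hIoo, zero_lt_one,
    ⟨e, he.analytic, fun _ _ => rfl, hinj, he.immersion⟩, ?_, ?_, fun s hs => ?_⟩
  · simpa [hef 0 (by simp)] using h.left_mem
  · simpa [hef 1 (by simp)] using h.right_mem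
  · obtain ⟨u, hu, hus⟩ := hIoo.subset (mem_image_of_mem e hs)
    exact hus ▸ h.mapsTo hu

theorem IsEdgePiece.image_inter_subset {S : Set M} {f g : ℝ → M} {a b c d : ℝ}
    (hf : IsEdgePiece E S f a b) (hg : IsEdgePiece E S g c d)
    (hdisj : Disjoint (f '' Ioo a b) (g '' Ioo c d)) :
    f '' Icc a b ∩ g '' Icc c d ⊆ {f a, f b} := by
  rw [← Ioo_union_both hf.lt.le, ← Ioo_union_both hg.lt.le, image_union, image_union,
    image_pair, image_pair]
  rintro y ⟨hyf | hyf, hyg⟩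
  · obtain ⟨u, hu, rfl⟩ := hyf
    rcases hyg with hyg | hyg | hyg
    · exact (disjoint_left.1 hdisj ⟨u, hu, rfl⟩ hyg).elim
    · exact (hf.mapsTo hu (hyg ▸ hg.left_mem)).elim
    · exact (hf.mapsTo hu (hyg ▸ hg.right_mem)).elim
  · exact hyf

/-- Of the pieces which run along the same arc, one becomes the edge. -/
theorem exists_edges_of_isEdgePiece [T2Space M] {κ : Type*} [Finite κ] {S : Set M}
    {f : κ → ℝ → M} {a b : κ → ℝ} (hpiece : ∀ p, IsEdgePiece E S (f p) (a p) (b p))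
    (heq : ∀ p q, (f p '' Ioo (a p) (b p) ∩ f q '' Ioo (a q) (b q)).Nonempty →
      f p '' Ioo (a p) (b p) = f q '' Ioo (a q) (b q)) :
    ∃ (m : ℕ) (e : Fin m → ℝ → M), (∀ k, IsEdge E (e k)) ∧ (∀ k, InjOn (e k) (Icc 0 1)) ∧
      (∀ k l, k ≠ l →
        e k '' Icc 0 1 ∩ e l '' Icc 0 1 ⊆ edgeVertices (e k) ∩ edgeVertices (e l)) ∧
      ∀ p, ContinuousOn (f p) (Icc (a p) (b p)) →
        ∃ k, f p '' Icc (a p) (b p) = e k '' Icc 0 1 := by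
  let img : κ → Set M := fun p => f p '' Ioo (a p) (b p)
  let ξ := Finite.equivFin (range img)
  choose p hp using fun k => (ξ.symm k).2
  choose e he hinj heIoo hepiece using fun k => (hpiece (p k)).exists_isEdge
  have heimg : ∀ k, e k '' Ioo 0 1 = ξ.symm k := fun k => (heIoo k).trans (hp k)
  have hdisj : ∀ k l, k ≠ l → Disjoint (e k '' Ioo 0 1) (e l '' Ioo 0 1) := fun k l hkl => by
    rw [heIoo, heIoo]
    by_contra hmeet
    exact hkl (ξ.symm.injective (Subtype.ext ((hp k).symm.trans
      ((heq _ _ (not_disjoint_iff_nonempty_inter.1 hmeet)).trans (hp l)))))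
  refine ⟨_, e, he, hinj, fun k l hkl => subset_inter ?_ ?_, fun q hq => ?_⟩
  · exact (hepiece k).image_inter_subset (hepiece l) (hdisj k l hkl)
  · rw [inter_comm]
    exact (hepiece l).image_inter_subset (hepiece k) (hdisj l k hkl.symm)
  · refine ⟨ξ ⟨img q, q, rfl⟩, ?_⟩
    rw [image_Icc_eq_closure_image_Ioo (hpiece q).lt hq,
      image_Icc_eq_closure_image_Ioo zero_lt_one
        (fun t ht => ((he _).analytic t ht).continuousAt.continuousWithinAt), heimg,
      ξ.symm_apply_apply]

variable [T2Space M] [CompleteSpace E] [IsManifold 𝓘(ℝ, E) ω M] {ι : Type*} [Finite ι] {x : M}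

theorem exists_isSubdivision_arcs (γ : ι → PAPath E x x) :
    ∃ W V : ι → Set ℝ, (∀ i, IsSubdivision (W i)) ∧ (∀ i, IsSubdivision (V i)) ∧
      (∀ i, W i ⊆ V i) ∧
      (∀ i a b, IsGap (W i) a b →
        (∀ s ∈ Icc a b, (γ i).1.extend s = (γ i).1.extend a) ∨ IsArc E (γ i).1.extend a b) ∧
      ∀ i a b j c d, IsGap (V i) a b → IsGap (W j) c d → IsArc E (γ j).1.extend c d →
        MapsTo (γ i).1.extend (Ioo a b) ((γ j).1.extend '' Icc c d) ∨
        MapsTo (γ i).1.extend (Ioo a b) ((γ j).1.extend '' Icc c d)ᶜ := by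
  choose W hW hWarc using fun i => (γ i).2.hasFiniteBreaks_const_or_isArc.exists_isSubdivision
  let arcs : Set (ι × ℝ × ℝ) :=
    {p | IsGap (W p.1) p.2.1 p.2.2 ∧ IsArc E (γ p.1).1.extend p.2.1 p.2.2}
  have : Finite arcs := ((finite_setOf_isGap hW).subset fun p hp => hp.1).to_subtype
  have hmeets : ∀ p : arcs, MeetsPathsFinitely E
      ((γ p.1.1).1.extend '' Icc p.1.2.1 p.1.2.2) := fun p => by
    obtain ⟨hgap, η, hη, hγη, hinj, -⟩ := p.2
    rw [hγη.image_eq]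
    exact meetsPathsFinitely_arc hη hgap.lt hinj
  choose V hV hVarc using fun i =>
    (HasFiniteBreaks.forall fun p : arcs => hmeets p (γ i)).exists_isSubdivision
  have hWV : ∀ i, IsSubdivision (W i ∪ V i) := fun i =>
    (hW i).union (hV i).finite (hV i).subset_Icc
  refine ⟨W, fun i => W i ∪ V i, hW, hWV, fun i => subset_union_left, fun i a b h => ?_,
    fun i a b j c d h h' harc => ?_⟩
  · exact hWarc i a b ((hW i).subset_Icc h.left_mem).1 ((hW i).subset_Icc h.right_mem).2 h.lt
      h.disjoint
  · exact hVarc i a b ((hWV i).subset_Icc h.left_mem).1 ((hWV i).subset_Icc h.right_mem).2 h.lt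
      (h.disjoint.mono_right subset_union_right) ⟨(j, c, d), h', harc⟩

/-- Taking as vertices the images of all break points, and adding to the break points the
parameters at which an arc of one of the paths passes a vertex, makes the pieces compatible. -/
theorem exists_compatible_breaks (γ : ι → PAPath E x x) :
    ∃ (V : ι → Set ℝ) (S : Set M), (∀ i, IsSubdivision (V i)) ∧
      (∀ i a b, IsGap (V i) a b → (∀ s ∈ Icc a b, (γ i).1.extend s = (γ i).1.extend a) ∨
        IsEdgePiece E S (γ i).1.extend a b) ∧
      ∀ i a b j c d, IsGap (V i) a b → IsEdgePiece E S (γ i).1.extend a b →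
        IsGap (V j) c d → IsEdgePiece E S (γ j).1.extend c d →
        ((γ i).1.extend '' Ioo a b ∩ (γ j).1.extend '' Ioo c d).Nonempty →
        (γ i).1.extend '' Ioo a b ⊆ (γ j).1.extend '' Ioo c d := by
  obtain ⟨W, V, hW, hV, hWV, hconst, hmeet⟩ := exists_isSubdivision_arcs γ
  let S : Set M := ⋃ i, (γ i).1.extend '' V i
  have hVS : ∀ i, MapsTo (γ i).1.extend (V i) S := fun i u hu =>
    mem_iUnion.2 ⟨i, mem_image_of_mem _ hu⟩
  choose U hU hVU hUS hUgap using fun i => (hV i).exists_refinement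
    (finite_iUnion fun i => (hV i).finite.image _) (hVS i) fun a b h =>
      ((hW i).const_or_of_subset (hV i) (hWV i) (hconst i) h).imp id
        fun ⟨c, d, _, harc, hc, hd⟩ => (harc.mono hc hd).injOn
  have hWU : ∀ i, W i ⊆ U i := fun i => (hWV i).trans (hVU i)
  refine ⟨U, S, hU, fun i a b h => ?_, fun i a b j c d h hp h' hp' hne => ?_⟩
  · rcases (hW i).const_or_of_subset (hU i) (hWU i) (hconst i) h with hab | ⟨c, d, -, harc, hc, hd⟩
    · exact Or.inl hab
    · exact (hUgap i a b h).imp id fun hmaps =>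
        ⟨h.lt, harc.mono hc hd, hUS i h.left_mem, hUS i h.right_mem, hmaps⟩
  have hcd : ¬∀ s ∈ Icc c d, (γ j).1.extend s = (γ j).1.extend c := fun hcd =>
    h'.lt.ne' (hp'.isArc.injOn (right_mem_Icc.2 h'.lt.le) (left_mem_Icc.2 h'.lt.le)
      (hcd d (right_mem_Icc.2 h'.lt.le)))
  obtain ⟨c', d', hgap, harc, hc, hd⟩ :=
    ((hW j).const_or_of_subset (hU j) (hWU j) (hconst j) h').resolve_left hcd
  obtain ⟨a', b', hgap', ha, hb⟩ := (hV i).exists_isGap_of_subset (hU i) (hVU i) h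
  have hsub : Ioo a b ⊆ Ioo a' b' := Ioo_subset_Ioo ha hb
  have hmaps : MapsTo (γ i).1.extend (Ioo a b) ((γ j).1.extend '' Icc c' d') := by
    refine ((hmeet i a' b' j c' d' hgap' hgap harc).resolve_right fun hmiss => ?_).mono_left hsub
    obtain ⟨_, ⟨u, hu, rfl⟩, w, hw, hwu⟩ := hne
    exact hmiss (hsub hu) ⟨w, ⟨hc.trans hw.1.le, hw.2.le.trans hd⟩, hwu⟩
  exact image_Ioo_subset_image_Ioo (γ i).1.continuous_extend.continuousOn
    (γ j).1.continuous_extend.continuousOn harc.injOn hmaps hc hd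
    (fun hmem => hp.mapsTo.image_subset hmem hp'.left_mem)
    (fun hmem => hp.mapsTo.image_subset hmem hp'.right_mem) hne

theorem exists_graph (γ : ι → PAPath E x x) :
    ∃ (m : ℕ) (e : Fin m → ℝ → M), (∀ k, IsEdge E (e k)) ∧ (∀ k, InjOn (e k) (Icc 0 1)) ∧
      (∀ k l, k ≠ l →
        e k '' Icc 0 1 ∩ e l '' Icc 0 1 ⊆ edgeVertices (e k) ∩ edgeVertices (e l)) ∧
      ∀ i, ∃ V, IsSubdivision V ∧ ∀ a b, IsGap V a b →
        (∀ s ∈ Icc a b, (γ i).1.extend s = (γ i).1.extend a) ∨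
        (InjOn (γ i).1.extend (Icc a b) ∧
          ∃ k, (γ i).1.extend '' Icc a b = e k '' Icc 0 1) := by
  obtain ⟨V, S, hV, hpiece, hsub⟩ := exists_compatible_breaks γ
  let pieces : Set (ι × ℝ × ℝ) := {p | IsGap (V p.1) p.2.1 p.2.2 ∧
    IsEdgePiece E S (γ p.1).1.extend p.2.1 p.2.2}
  have : Finite pieces := ((finite_setOf_isGap hV).subset fun p hp => hp.1).to_subtype
  have hsub' (p q : pieces) := hsub _ _ _ _ _ _ p.2.1 p.2.2 q.2.1 q.2.2
  obtain ⟨m, e, he, hinj, hinter, hpieces⟩ := exists_edges_of_isEdgePiece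
    (fun p : pieces => p.2.2)
    fun p q hne => (hsub' p q hne).antisymm (hsub' q p (by rwa [inter_comm]))
  refine ⟨m, e, he, hinj, hinter, fun i => ⟨V i, hV i, fun a b h => ?_⟩⟩
  exact (hpiece i a b h).imp id fun hp => ⟨hp.isArc.injOn,
    hpieces ⟨(i, a, b), h, hp⟩ (γ i).1.continuous_extend.continuousOn⟩

end Graph

/-! ### Segments of paths and traversals of edges -/

section Segments

theorem mem_Icc_of_mem_Icc_clamp {z w s : ℝ} (hlt : max 0 (min 1 z) < max 0 (min 1 w))
    (hs : s ∈ Icc (max 0 (min 1 z)) (max 0 (min 1 w))) : s ∈ Icc z w := by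
  obtain ⟨hzs, hsw⟩ := hs
  constructor <;> grind

theorem exists_reparam_of_image_eq {N : Type*} [TopologicalSpace N] [T2Space N] {f g : ℝ → N}
    (hf : ContinuousOn f (Icc 0 1)) (hfi : InjOn f (Icc 0 1)) (hg : ContinuousOn g (Icc 0 1))
    (hgi : InjOn g (Icc 0 1)) (hfg : g '' Icc 0 1 = f '' Icc 0 1) :
    ∃ θ : ℝ → ℝ, ContinuousOn θ (Icc 0 1) ∧ (∀ s ∈ Icc 0 1, f (θ s) = g s) ∧
      (MonotoneOn θ (Icc 0 1) ∧ θ 0 = 0 ∧ θ 1 = 1 ∨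
        AntitoneOn θ (Icc 0 1) ∧ θ 0 = 1 ∧ θ 1 = 0) := by
  have hlift : ∀ s ∈ Icc (0 : ℝ) 1, ∃ t ∈ Icc (0 : ℝ) 1, f t = g s := fun s hs =>
    hfg.subset (mem_image_of_mem g hs)
  choose! θ hθI hθ using hlift
  have hcont : ContinuousOn θ (Icc 0 1) :=
    continuousOn_of_comp_injOn isCompact_Icc hf hfi hg hθI hθ
  have hinj : InjOn θ (Icc 0 1) := fun s hs t ht hst =>
    hgi hs ht (by rw [← hθ s hs, ← hθ t ht, hst])
  have hsurj : SurjOn θ (Icc 0 1) (Icc 0 1) := fun t ht => by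
    obtain ⟨s, hs, hst⟩ := hfg.superset (mem_image_of_mem f ht)
    exact ⟨s, hs, hfi (hθI s hs) ht ((hθ s hs).trans hst)⟩
  have h0 : (0 : ℝ) ∈ Icc (0 : ℝ) 1 := by simp
  have h1 : (1 : ℝ) ∈ Icc (0 : ℝ) 1 := by simp
  obtain ⟨s₀, hs₀, hθs₀⟩ := hsurj h0
  obtain ⟨s₁, hs₁, hθs₁⟩ := hsurj h1
  refine ⟨θ, hcont, hθ, ?_⟩
  rcases hcont.strictMonoOn_of_injOn_Icc' zero_le_one hinj with hmono | hanti
  · have hmono' := hmono.monotoneOn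
    exact Or.inl ⟨hmono', ((hmono' h0 hs₀ hs₀.1).trans_eq hθs₀).antisymm (hθI 0 h0).1,
      (hθI 1 h1).2.antisymm (hθs₁.symm.trans_le (hmono' hs₁ h1 hs₁.2))⟩
  · have hanti' := hanti.antitoneOn
    exact Or.inr ⟨hanti', (hθI 0 h0).2.antisymm (hθs₁.symm.trans_le (hanti' h0 hs₁ hs₁.1)),
      ((hanti' hs₀ h1 hs₀.2).trans_eq hθs₀).antisymm (hθI 1 h1).1⟩

variable {E : Type*} [NormedAddCommGroup E] [NormedSpace ℝ E]
  {M : Type*} [TopologicalSpace M] [ChartedSpace E M]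

theorem IsPiecewiseAnalytic.of_extend_eq_affine {x y x' y' : M} {γ : Path x y} {δ : Path x' y'}
    (hγ : IsPiecewiseAnalytic E γ) {a b : ℝ} (ha : 0 ≤ a) (hab : a < b) (hb : b ≤ 1)
    (h : ∀ s ∈ Icc (0 : ℝ) 1, δ.extend s = γ.extend ((b - a) * s + a)) :
    IsPiecewiseAnalytic E δ := by
  obtain ⟨n, t, ht, h0, h1, hγt⟩ := hγ
  have hba : 0 < b - a := sub_pos.2 hab
  let z : ℕ → ℝ := fun k => (t k - a) / (b - a)
  let u : ℕ → ℝ := fun k => max 0 (min 1 (z k))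
  have hz : Monotone z := fun k l hkl => by
    have := ht hkl
    simp only [z]
    gcongr
  have hu : Monotone u := fun k l hkl => max_le_max le_rfl (min_le_min le_rfl (hz hkl))
  refine ⟨n, u, hu, max_eq_left (min_le_of_right_le ?_), ?_, fun k hk => ?_⟩
  · exact div_nonpos_of_nonpos_of_nonneg (by linarith) hba.le
  · have hzn : 1 ≤ z n := (le_div_iff₀ hba).2 (by linarith)
    simp [u, hzn]
  rcases (hu k.le_succ).eq_or_lt with heq | hlt
  · refine ⟨fun _ => δ.extend (u k), fun _ _ => contMDiffAt_const, fun s hs => ?_⟩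
    rw [← Nat.succ_eq_add_one, ← heq, Icc_self] at hs
    rw [hs]
  · refine (hγt k hk).comp_affine (b - a) a (fun s hs => ?_) fun s hs => h s ?_
    · obtain ⟨hks, hsk⟩ := mem_Icc_of_mem_Icc_clamp hlt hs
      rw [div_le_iff₀ hba] at hks
      rw [le_div_iff₀ hba] at hsk
      constructor <;> linarith
    · exact Icc_subset_Icc (le_max_left _ _) (max_le zero_le_one (min_le_left _ _)) hs

namespace PAPath

theorem extend_zero {x y : M} (p : PAPath E x y) : p.1.extend 0 = x := Path.extend_zero _

theorem extend_one {x y : M} (p : PAPath E x y) : p.1.extend 1 = y := Path.extend_one _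

theorem continuousOn_extend {x y : M} (p : PAPath E x y) (S : Set ℝ) :
    ContinuousOn p.1.extend S := p.1.continuous_extend.continuousOn

theorem rel_of_extend {x y : M} {p q : PAPath E x y} {φ : ℝ → ℝ} (hφ : ContinuousOn φ (Icc 0 1))
    (hmono : MonotoneOn φ (Icc 0 1)) (h0 : φ 0 = 0) (h1 : φ 1 = 1)
    (h : ∀ t ∈ Icc (0 : ℝ) 1, q.1.extend t = p.1.extend (φ t)) : elementarySetoid E x y p q := by
  have hI : ∀ t ∈ Icc (0 : ℝ) 1, φ t ∈ Icc (0 : ℝ) 1 := fun t ht =>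
    ⟨h0 ▸ hmono (by simp) ht ht.1, h1 ▸ hmono ht (by simp) ht.2⟩
  refine rel_reparam p q (fun t => ⟨φ t, hI t t.2⟩) ?_ ?_ (Subtype.ext h0) (Subtype.ext h1) ?_
  · exact (continuousOn_iff_continuous_domRestrict.1 hφ).subtype_mk _
  · exact fun s t hst => hmono s.2 t.2 hst
  · intro t
    have ht := h t t.2
    rwa [Path.extend_apply _ t.2, Path.extend_apply _ (hI t t.2)] at ht

/-- The restriction of a path to `[a, b]`, reparametrized affinely by `[0, 1]`. -/
noncomputable def segment {x y : M} (γ : PAPath E x y) {a b : ℝ} (ha : 0 ≤ a) (hab : a < b)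
    (hb : b ≤ 1) : PAPath E (γ.1.extend a) (γ.1.extend b) :=
  ⟨{ toFun := fun s => γ.1.extend ((b - a) * s + a)
     continuous_toFun := γ.1.continuous_extend.comp (by fun_prop)
     source' := by simp
     target' := by simp },
    γ.2.of_extend_eq_affine ha hab hb fun _ hs => Path.extend_apply _ hs⟩

theorem segment_extend {x y : M} (γ : PAPath E x y) {a b : ℝ} (ha : 0 ≤ a) (hab : a < b)
    (hb : b ≤ 1) {s : ℝ} (hs : s ∈ Icc (0 : ℝ) 1) :
    (γ.segment ha hab hb).1.extend s = γ.1.extend ((b - a) * s + a) :=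
  Path.extend_apply _ hs

theorem segment_rel_trans {x y : M} (γ : PAPath E x y) {a v b : ℝ} (ha : 0 ≤ a) (hav : a < v)
    (hvb : v < b) (hb : b ≤ 1) :
    elementarySetoid E _ _ (γ.segment ha (hav.trans hvb) hb)
      ((γ.segment ha hav (hvb.le.trans hb)).trans (γ.segment (ha.trans hav.le) hvb hb)) := by
  have hba : 0 < b - a := by linarith
  let φ : ℝ → ℝ := fun s => ((v - a) * min (2 * s) 1 + (b - v) * max (2 * s - 1) 0) / (b - a)
  have hφ : ∀ s, (b - a) * φ s + a =
      (v - a) * min (2 * s) 1 + (b - v) * max (2 * s - 1) 0 + a := fun s => by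
    rw [mul_div_cancel₀ _ hba.ne']
  have hmono : Monotone φ := fun s t hst => by
    have _ : 0 ≤ v - a := by linarith
    have _ : 0 ≤ b - v := by linarith
    simp only [φ]
    gcongr
  have h0 : φ 0 = 0 := by simp [φ]
  have h1 : φ 1 = 1 := by
    rw [div_eq_one_iff_eq hba.ne']
    norm_num
  have hcont : Continuous φ := by fun_prop
  refine rel_of_extend hcont.continuousOn (hmono.monotoneOn _) h0 h1 fun t ht => ?_
  rw [segment_extend _ _ _ _ ⟨h0 ▸ hmono ht.1, h1 ▸ hmono ht.2⟩, hφ]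
  rcases le_total t (1 / 2) with hle | hge
  · refine (Path.extend_trans_of_le_half _ _ hle).trans ?_
    refine (segment_extend _ _ _ _ ⟨by linarith [ht.1], by linarith⟩).trans ?_
    rw [min_eq_left (by linarith), max_eq_right (by linarith)]
    ring_nf
  · refine (Path.extend_trans_of_half_le _ _ hge).trans ?_
    refine (segment_extend _ _ _ _ ⟨by linarith, by linarith [ht.2]⟩).trans ?_
    rw [min_eq_right (by linarith), max_eq_left (by linarith)]
    ring_nf

theorem loopClass_eq {x : M} {p q : PAPath E x x} (h : elementarySetoid E x x p q) :
    loopClass p = loopClass q := Quotient.sound h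

theorem loopClass_mul {x : M} (p q : PAPath E x x) :
    loopClass p * loopClass q = loopClass (p.trans q) := rfl

theorem loopClass_refl (x : M) : loopClass (refl x : PAPath E x x) = 1 := rfl

/-- The loop leading to the start of `q` along `a`, following `q`, and returning along `b`. -/
noncomputable def closeUp {x u v : M} (a : PAPath E x u) (q : PAPath E u v) (b : PAPath E x v) :
    PAPath E x x := a.trans (q.trans b.symm)

theorem closeUp_rel {x u v : M} {a a' : PAPath E x u} {q q' : PAPath E u v} {b b' : PAPath E x v}
    (ha : elementarySetoid E x u a a') (hq : elementarySetoid E u v q q')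
    (hb : elementarySetoid E x v b b') :
    elementarySetoid E x x (closeUp a q b) (closeUp a' q' b') :=
  rel_trans ha (rel_trans hq (rel_inv hb))

theorem closeUp_refl_rel {x : M} (q : PAPath E x x) :
    elementarySetoid E x x (closeUp (refl x) q (refl x)) q := by
  have hsymm : (refl x : PAPath E x x).symm = refl x := Subtype.ext Path.refl_symm
  rw [closeUp, hsymm]
  exact rel_tr (rel_symm (rel_refl_trans _)) (rel_symm (rel_trans_refl q))

theorem loopClass_closeUp_mul {x u v w : M} (a : PAPath E x u) (q : PAPath E u v)
    (b : PAPath E x v) (q' : PAPath E v w) (c : PAPath E x w) :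
    loopClass (closeUp a q b) * loopClass (closeUp b q' c) =
      loopClass (closeUp a (q.trans q') c) := by
  rw [loopClass_mul]
  refine loopClass_eq ?_
  have cancel : elementarySetoid E v x (b.symm.trans (b.trans (q'.trans c.symm)))
      (q'.trans c.symm) :=
    rel_tr (rel_assoc _ _ _) (rel_tr (rel_trans_left _ (rel_symm (rel_symm_trans b)))
      (rel_symm (rel_refl_trans _)))
  refine rel_tr (rel_symm (rel_assoc _ _ _)) (rel_trans_right a ?_)
  refine rel_tr (rel_symm (rel_assoc _ _ _)) ?_
  exact rel_tr (rel_trans_right q cancel) (rel_assoc _ _ _)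

theorem loopClass_closeUp_inv {x u v : M} (a : PAPath E x u) (q : PAPath E u v)
    (b : PAPath E x v) :
    (loopClass (closeUp a q b))⁻¹ = loopClass (closeUp b q.symm a) := by
  rw [inv_eq_iff_mul_eq_one, loopClass_closeUp_mul, ← loopClass_refl]
  refine loopClass_eq (rel_symm (rel_tr (rel_trans_symm a) (rel_trans_right a ?_)))
  exact rel_tr (rel_refl_trans _) (rel_trans_left _ (rel_trans_symm q))

theorem loopClass_closeUp_eq_one {x u v : M} {a : PAPath E x u} {q : PAPath E u v}
    {b : PAPath E x v} (h : elementarySetoid E x v (a.trans q) b) :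
    loopClass (closeUp a q b) = 1 := by
  rw [← loopClass_refl]
  exact loopClass_eq (rel_tr (rel_assoc _ _ _) (rel_tr (rel_trans_left _ h)
    (rel_symm (rel_trans_symm b))))

end PAPath

/-- An edge, as a path between its vertices. -/
def IsEdge.path {e : ℝ → M} (he : IsEdge E e) : PAPath E (e 0) (e 1) :=
  ⟨{ toFun := fun t => e t
     continuous_toFun := continuousOn_iff_continuous_domRestrict.1
      fun t ht => (he.analytic t ht).continuousAt.continuousWithinAt
     source' := rfl
     target' := rfl }, 1, fun n => n, Nat.mono_cast, by simp, by simp, fun i hi => by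
    obtain rfl : i = 0 := by omega
    exact ⟨e, fun s hs => he.analytic s (by simpa using hs),
      fun s hs => Path.extend_apply _ (by simpa using hs)⟩⟩

theorem IsEdge.path_extend {e : ℝ → M} (he : IsEdge E e) :
    EqOn he.path.1.extend e (Icc 0 1) := fun _ hs => Path.extend_apply _ hs

theorem IsEdge.range_path {e : ℝ → M} (he : IsEdge E e) : range he.path.1 = e '' Icc 0 1 := by
  rw [image_eq_range]
  rfl

/-- The path runs along the edge `e`, in one of the two directions. -/
inductive IsTraversal {e : ℝ → M} (he : IsEdge E e) : ∀ {u v : M}, PAPath E u v → Prop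
  | forward : IsTraversal he he.path
  | backward : IsTraversal he he.path.symm

theorem IsTraversal.range_eq {e : ℝ → M} {he : IsEdge E e} {u v : M} {ε : PAPath E u v}
    (h : IsTraversal he ε) : range ε.1 = e '' Icc 0 1 := by
  cases h with
  | forward => exact he.range_path
  | backward => exact (Path.symm_range _).trans he.range_path

theorem IsEdge.exists_isTraversal_of_image_eq [T2Space M] {e : ℝ → M} (he : IsEdge E e)
    (hinj : InjOn e (Icc 0 1)) {u v : M} {q : PAPath E u v} (hq : InjOn q.1.extend (Icc 0 1))
    (himage : q.1.extend '' Icc 0 1 = e '' Icc 0 1) :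
    ∃ ε : PAPath E u v, IsTraversal he ε ∧ elementarySetoid E u v ε q := by
  have hpath := he.path_extend
  obtain ⟨θ, hcont, hθ, ⟨hmono, h0, h1⟩ | ⟨hanti, h0, h1⟩⟩ := exists_reparam_of_image_eq
    (he.path.continuousOn_extend _) (hinj.congr hpath.symm) (q.continuousOn_extend _) hq
    (himage.trans hpath.image_eq.symm)
  all_goals
    have hu := hθ 0 (by simp)
    have hv := hθ 1 (by simp)
    rw [q.extend_zero, h0] at hu
    rw [q.extend_one, h1] at hv
  · rw [he.path.extend_zero] at hu
    rw [he.path.extend_one] at hv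
    subst hu hv
    exact ⟨_, .forward, PAPath.rel_of_extend hcont hmono h0 h1 fun t ht => (hθ t ht).symm⟩
  · rw [he.path.extend_one] at hu
    rw [he.path.extend_zero] at hv
    subst hu hv
    refine ⟨_, .backward, PAPath.rel_of_extend (φ := fun t => 1 - θ t) (by fun_prop)
      (fun s hs t ht hst => sub_le_sub_left (hanti hs ht hst) 1) (by simp [h0]) (by simp [h1])
      fun t ht => ?_⟩
    refine .trans ?_ (Path.extend_symm_apply _ _).symm
    rw [sub_sub_cancel, hθ t ht]

end Segments

/-! ### Spanning trees and independent generators -/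

section SpanningTree

theorem existsUnique_trans_of_notMem_right {X : Type*} [TopologicalSpace X] {a b c z : X}
    {p : Path a b} {q : Path b c} (hp : ∃! t : I, p t = z) (hq : z ∉ range q) :
    ∃! t : I, p.trans q t = z := by
  obtain ⟨s, hs, huniq⟩ := hp
  refine ⟨⟨s / 2, by linarith [s.2.1], by linarith [s.2.2]⟩, ?_, fun t ht => Subtype.ext ?_⟩
  · have hle : (s : ℝ) / 2 ≤ 1 / 2 := by linarith [s.2.2]
    simpa only [Path.trans_apply, hle, dite_true, mul_div_cancel₀ _ (two_ne_zero' ℝ)] using hs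
  · simp only [Path.trans_apply] at ht
    split_ifs at ht with hle
    · have := congrArg Subtype.val (huniq _ ht)
      dsimp only at this ⊢
      linarith
    · exact (hq ⟨_, ht⟩).elim

theorem existsUnique_trans_of_notMem_left {X : Type*} [TopologicalSpace X] {a b c z : X}
    {p : Path a b} {q : Path b c} (hp : z ∉ range p) (hq : ∃! t : I, q t = z) :
    ∃! t : I, p.trans q t = z := by
  have hsymm : ∀ {a b : X} {r : Path a b}, (∃! t : I, r t = z) → ∃! t : I, r.symm t = z :=
    fun h => (unitInterval.symm_bijective.existsUnique_iff).1 (by simpa using h)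
  have h := existsUnique_trans_of_notMem_right (hsymm hq) (q := p.symm) (by rwa [Path.symm_range])
  simpa [← Path.trans_symm] using hsymm h

theorem exists_extend_insert {X : Type*} {P : X → Type*} {A : Set X} (p : ∀ v ∈ A, P v) {w : X}
    (hw : w ∉ A) (q : P w) :
    ∃ p' : ∀ v ∈ insert w A, P v,
      (∀ v hv hvA, p' v hv = p v hvA) ∧ p' w (mem_insert w A) = q := by
  classical
  exact ⟨fun v hv => if hvw : v = w then hvw ▸ q else p v (hv.resolve_left hvw),
    fun v hv hvA => dif_neg fun hvw : v = w => hw (hvw ▸ hvA), dif_pos rfl⟩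

variable {E : Type*} [NormedAddCommGroup E] [NormedSpace ℝ E]
  {M : Type*} [TopologicalSpace M] [ChartedSpace E M]

theorem IsGraph.independentLoops {m : ℕ} {e : Fin m → ℝ → M} {Γ : Set M} (hg : IsGraph E e Γ)
    {x : M} {n : ℕ} {β : Fin n → PAPath E x x} {R : Fin n → Set (Fin m)} {κ : Fin n → Fin m}
    (hrange : ∀ i, range (β i).1 = ⋃ l ∈ R i, e l '' Icc 0 1) (hmem : ∀ i, κ i ∈ R i)
    (hnotMem : ∀ i j, j ≠ i → κ i ∉ R j)
    (honce : ∀ i, ∀ s ∈ Ioo (0 : ℝ) 1, ∃! t : I, (β i).1 t = e (κ i) s) :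
    IndependentLoops β := by
  let ν := Finite.equivFin ↥(⋃ i, R i)
  refine ⟨_, fun j => e (ν.symm j), ⟨fun j => hg.isEdge _, fun j l hjl => hg.inter _ _ fun h =>
    hjl (ν.symm.injective (Subtype.ext h)), ?_⟩,
    fun i => ⟨ν ⟨κ i, mem_iUnion_of_mem i (hmem i)⟩, ?_⟩⟩
  · simp only [hrange, ← biUnion_iUnion]
    rw [biUnion_eq_iUnion]
    exact ν.symm.surjective.iUnion_comp fun l : ↥(⋃ i, R i) => e l '' Icc 0 1
  · simp only [Equiv.symm_apply_apply]
    refine ⟨honce i, ?_⟩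
    rintro j hj y ⟨hy, hyj⟩
    rw [hrange] at hyj
    obtain ⟨l, hl, hyl⟩ := mem_iUnion₂.1 hyj
    exact (hg.inter (κ i) l (fun h => hnotMem i j hj (h ▸ hl)) ⟨hy, hyl⟩).1

/-- `T` is the edge set of a tree with vertex set `A` and root `x`, and `p v` is a path in the tree
from `x` to the vertex `v`. That there are no cycles is expressed by the paths: up to equivalence,
running through an edge of the tree after the path to its start gives the path to its end. -/
structure IsRootedTree {m : ℕ} {e : Fin m → ℝ → M} (he : ∀ k, IsEdge E (e k)) (x : M) (A : Set M)
    (T : Set (Fin m)) (p : ∀ v ∈ A, PAPath E x v) : Prop where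
  root_mem : x ∈ A
  root : elementarySetoid E x x (p x root_mem) (PAPath.refl x)
  edge : ∀ k ∈ T, ∃ (h0 : e k 0 ∈ A) (h1 : e k 1 ∈ A),
    elementarySetoid E x (e k 1) ((p _ h0).trans (he k).path) (p _ h1)
  range_eq : ∀ v hv, ∃ S ⊆ T, range (p v hv).1 = {v} ∪ ⋃ k ∈ S, e k '' Icc 0 1

theorem IsTraversal.rel_forward {e : ℝ → M} {he : IsEdge E e} {x u w : M} {ε : PAPath E u w}
    (hε : IsTraversal he ε) {A : Set M} {p : ∀ v ∈ A, PAPath E x v} (hu : u ∈ A) (hw : w ∈ A)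
    (h : elementarySetoid E x w ((p u hu).trans ε) (p w hw)) :
    ∃ (h0 : e 0 ∈ A) (h1 : e 1 ∈ A),
      elementarySetoid E x (e 1) ((p _ h0).trans he.path) (p _ h1) := by
  cases hε with
  | forward => exact ⟨hu, hw, h⟩
  | backward =>
    refine ⟨hw, hu, PAPath.rel_tr (PAPath.rel_trans_left _ (PAPath.rel_symm h)) ?_⟩
    refine PAPath.rel_tr (PAPath.rel_symm (PAPath.rel_assoc _ _ _)) ?_
    exact PAPath.rel_tr (PAPath.rel_trans_right _ (PAPath.rel_symm (PAPath.rel_symm_trans _)))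
      (PAPath.rel_symm (PAPath.rel_trans_refl _))

theorem isRootedTree_singleton {m : ℕ} {e : Fin m → ℝ → M} (he : ∀ k, IsEdge E (e k)) (x : M) :
    IsRootedTree he x {x} ∅ fun _ hv => (mem_singleton_iff.1 hv).symm ▸ PAPath.refl x where
  root_mem := rfl
  root := (elementarySetoid E x x).refl _
  edge := by simp
  range_eq := by
    rintro v rfl
    refine ⟨∅, Subset.rfl, ?_⟩
    change range (Path.refl v) = _
    simp

namespace IsRootedTree

variable {m : ℕ} {e : Fin m → ℝ → M} {x : M} {A : Set M} {T : Set (Fin m)}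
  {p : ∀ v ∈ A, PAPath E x v}

theorem exists_insert {he : ∀ k, IsEdge E (e k)} (h : IsRootedTree he x A T p) {k : Fin m}
    {u w : M} {ε : PAPath E u w} (hε : IsTraversal (he k) ε) (hu : u ∈ A) (hw : w ∉ A) :
    ∃ p', IsRootedTree he x (insert w A) (insert k T) p' := by
  obtain ⟨p', hold, hnew⟩ := exists_extend_insert p hw ((p u hu).trans ε)
  refine ⟨p', mem_insert_of_mem _ h.root_mem, ?_, ?_, ?_⟩
  · rw [hold x (mem_insert_of_mem _ h.root_mem) h.root_mem]
    exact h.root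
  · rintro l (rfl | hl)
    · refine hε.rel_forward (mem_insert_of_mem _ hu) (mem_insert _ _) ?_
      rw [hold u (mem_insert_of_mem _ hu) hu, hnew]
    · obtain ⟨h0, h1, hrel⟩ := h.edge l hl
      refine ⟨mem_insert_of_mem _ h0, mem_insert_of_mem _ h1, ?_⟩
      rwa [hold _ (mem_insert_of_mem _ h0) h0, hold _ (mem_insert_of_mem _ h1) h1]
  · rintro v (rfl | hv)
    · obtain ⟨S, hST, hS⟩ := h.range_eq u hu
      refine ⟨insert k S, insert_subset_insert hST, ?_⟩
      have huk : u ∈ e k '' Icc 0 1 := hε.range_eq ▸ ⟨0, ε.1.source⟩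
      have hvk : v ∈ e k '' Icc 0 1 := hε.range_eq ▸ ⟨1, ε.1.target⟩
      rw [hnew]
      refine (Path.trans_range _ _).trans ?_
      rw [hS, hε.range_eq, biUnion_insert]
      grind
    · obtain ⟨S, hST, hS⟩ := h.range_eq v hv
      rw [hold v (mem_insert_of_mem _ hv) hv]
      exact ⟨S, hST.trans (subset_insert _ _), hS⟩

theorem exists_maximal (he : ∀ k, IsEdge E (e k)) (x : M) :
    ∃ (A : Set M) (T : Set (Fin m)) (p : ∀ v ∈ A, PAPath E x v), IsRootedTree he x A T p ∧
      ∀ k, e k 0 ∈ A ↔ e k 1 ∈ A := by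
  obtain ⟨T, ⟨A, p, htree⟩, hmax⟩ :=
    (toFinite {T : Set (Fin m) | ∃ A p, IsRootedTree he x A T p}).exists_maximal
      ⟨∅, _, _, isRootedTree_singleton he x⟩
  have hclosed : ∀ {k : Fin m} {u w : M} {ε : PAPath E u w}, IsTraversal (he k) ε →
      u ∈ A → w ∈ A := fun {k u w ε} hε hu => by
    by_contra hw
    obtain ⟨p', htree'⟩ := htree.exists_insert hε hu hw
    obtain ⟨h0, h1, -⟩ := htree.edge k (hmax ⟨_, p', htree'⟩ (subset_insert k T) (mem_insert k T))
    cases hε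
    exacts [hw h1, hw h0]
  exact ⟨A, T, p, htree, fun k => ⟨hclosed .forward, hclosed .backward⟩⟩

theorem exists_range_closeUp {he : ∀ k, IsEdge E (e k)} (h : IsRootedTree he x A T p) {k : Fin m}
    (h0 : e k 0 ∈ A) (h1 : e k 1 ∈ A) :
    ∃ S, k ∈ S ∧ S ⊆ insert k T ∧
      range ((p _ h0).closeUp (he k).path (p _ h1)).1 = ⋃ l ∈ S, e l '' Icc 0 1 := by
  obtain ⟨S₀, hT₀, hS₀⟩ := h.range_eq _ h0
  obtain ⟨S₁, hT₁, hS₁⟩ := h.range_eq _ h1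
  refine ⟨insert k (S₀ ∪ S₁), mem_insert _ _, insert_subset_insert (union_subset hT₀ hT₁), ?_⟩
  have hk0 : e k 0 ∈ e k '' Icc 0 1 := ⟨0, by simp, rfl⟩
  have hk1 : e k 1 ∈ e k '' Icc 0 1 := ⟨1, by simp, rfl⟩
  change range ((p _ h0).1.trans ((he k).path.1.trans (p _ h1).1.symm)) = _
  rw [Path.trans_range, Path.trans_range, Path.symm_range, (he k).range_path, hS₀, hS₁,
    biUnion_insert, biUnion_union]
  grind

variable {he : ∀ k, IsEdge E (e k)} {Γ : Set M}

theorem notMem_range (h : IsRootedTree he x A T p) (hg : IsGraph E e Γ) {k : Fin m}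
    (hk : k ∉ T) {v : M} (hv : v ∈ A) (hvk : v ∈ edgeVertices (e k)) {s : ℝ}
    (hs : s ∈ Ioo (0 : ℝ) 1) :
    e k s ∉ range (p v hv).1 := by
  obtain ⟨S, hST, hS⟩ := h.range_eq v hv
  rw [hS]
  rintro (rfl | hmem)
  · exact (he k).notMem_vertices hs hvk
  · obtain ⟨l, hl, hsl⟩ := mem_iUnion₂.1 hmem
    exact (he k).notMem_vertices hs
      (hg.inter k l (fun hkl => hk (hkl ▸ hST hl)) ⟨⟨s, Ioo_subset_Icc_self hs, rfl⟩, hsl⟩).1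

theorem existsUnique_closeUp (h : IsRootedTree he x A T p) (hg : IsGraph E e Γ) {k : Fin m}
    (hk : k ∉ T) (hinj : InjOn (e k) (Icc 0 1)) (h0 : e k 0 ∈ A) (h1 : e k 1 ∈ A) {s : ℝ}
    (hs : s ∈ Ioo (0 : ℝ) 1) :
    ∃! t : I, ((p _ h0).closeUp (he k).path (p _ h1)).1 t = e k s := by
  have hsI := Ioo_subset_Icc_self hs
  have hedge : ∃! t : I, (he k).path.1 t = e k s :=
    ⟨⟨s, hsI⟩, rfl, fun t ht => Subtype.ext (hinj t.2 hsI ht)⟩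
  have hback : e k s ∉ range (p _ h1).1.symm := by
    rw [Path.symm_range]
    exact h.notMem_range hg hk h1 (.inr rfl) hs
  exact existsUnique_trans_of_notMem_left (h.notMem_range hg hk h0 (.inl rfl) hs)
    (existsUnique_trans_of_notMem_right hedge hback)

end IsRootedTree

/-- Closing `q` up by the paths `p`, which is possible as soon as it starts in `A`, gives a loop
whose class lies in `H`. -/
def ClosesUpIn {x : M} {A : Set M} (p : ∀ v ∈ A, PAPath E x v) (H : Subgroup (LoopGroup E x))
    {u v : M} (q : PAPath E u v) : Prop :=
  ∀ hu : u ∈ A, ∃ hv : v ∈ A, loopClass ((p u hu).closeUp q (p v hv)) ∈ H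

namespace ClosesUpIn

variable {x : M} {A : Set M} {p : ∀ v ∈ A, PAPath E x v} {H : Subgroup (LoopGroup E x)}

protected theorem refl (u : M) : ClosesUpIn p H (PAPath.refl u) := fun hu => ⟨hu, by
  rw [PAPath.loopClass_closeUp_eq_one (PAPath.rel_symm (PAPath.rel_trans_refl _))]
  exact one_mem H⟩

protected theorem trans {u v w : M} {q : PAPath E u v} {q' : PAPath E v w}
    (h : ClosesUpIn p H q) (h' : ClosesUpIn p H q') : ClosesUpIn p H (q.trans q') := fun hu => by
  obtain ⟨hv, h⟩ := h hu
  obtain ⟨hw, h'⟩ := h' hv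
  refine ⟨hw, ?_⟩
  rw [← PAPath.loopClass_closeUp_mul _ _ (p v hv)]
  exact mul_mem h h'

theorem congr {u v : M} {q q' : PAPath E u v} (h : ClosesUpIn p H q)
    (hrel : elementarySetoid E u v q q') : ClosesUpIn p H q' := fun hu => by
  obtain ⟨hv, h⟩ := h hu
  refine ⟨hv, ?_⟩
  rwa [← PAPath.loopClass_eq (PAPath.closeUp_rel ((elementarySetoid E _ _).refl _) hrel
    ((elementarySetoid E _ _).refl _))]

theorem congr_extend {u v u' v' : M} {q : PAPath E u v} {q' : PAPath E u' v'}
    (h : ClosesUpIn p H q) (hqq' : EqOn q'.1.extend q.1.extend (Icc 0 1)) :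
    ClosesUpIn p H q' := by
  have hu := hqq' (x := 0) (by simp)
  have hv := hqq' (x := 1) (by simp)
  rw [q.extend_zero, q'.extend_zero] at hu
  rw [q.extend_one, q'.extend_one] at hv
  subst hu hv
  exact h.congr (PAPath.rel_of_extend continuousOn_id monotoneOn_id rfl rfl hqq')

theorem of_isTraversal {e : ℝ → M} {he : IsEdge E e} (hA : e 0 ∈ A ↔ e 1 ∈ A)
    (hH : ∀ h0 h1, loopClass ((p (e 0) h0).closeUp he.path (p (e 1) h1)) ∈ H) {u v : M}
    {ε : PAPath E u v} (hε : IsTraversal he ε) : ClosesUpIn p H ε := by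
  cases hε with
  | forward => exact fun h0 => ⟨hA.1 h0, hH h0 _⟩
  | backward =>
    refine fun h1 => ⟨hA.2 h1, ?_⟩
    rw [← PAPath.loopClass_closeUp_inv]
    exact inv_mem (hH _ h1)

theorem segment_of_edges [T2Space M] {ι : Type*} {e : ι → ℝ → M} {he : ∀ k, IsEdge E (e k)}
    (hinj : ∀ k, InjOn (e k) (Icc 0 1))
    (hp : ∀ k {u v : M} {ε : PAPath E u v}, IsTraversal (he k) ε → ClosesUpIn p H ε)
    {y z : M} {γ : PAPath E y z} {a b : ℝ} (ha : 0 ≤ a) (hab : a < b) (hb : b ≤ 1)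
    (hγ : (∀ s ∈ Icc a b, γ.1.extend s = γ.1.extend a) ∨
      (InjOn γ.1.extend (Icc a b) ∧ ∃ k, γ.1.extend '' Icc a b = e k '' Icc 0 1)) :
    ClosesUpIn p H (γ.segment ha hab hb) := by
  have hext : ∀ s ∈ Icc (0 : ℝ) 1, (γ.segment ha hab hb).1.extend s =
      γ.1.extend ((b - a) * s + a) := fun s hs => γ.segment_extend ha hab hb hs
  have hba : 0 < b - a := sub_pos.2 hab
  have hmem : ∀ s ∈ Icc (0 : ℝ) 1, (b - a) * s + a ∈ Icc a b := fun s hs => by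
    constructor <;> nlinarith [hs.1, hs.2]
  obtain hconst | ⟨hγinj, k, hk⟩ := hγ
  · refine (ClosesUpIn.refl (γ.1.extend a)).congr_extend fun s hs => ?_
    rw [hext s hs, hconst _ (hmem s hs)]
    exact (Path.extend_apply (Path.refl _) hs).symm
  · have hseg : InjOn (γ.segment ha hab hb).1.extend (Icc 0 1) := fun s hs t ht hst => by
      rw [hext s hs, hext t ht] at hst
      exact mul_left_cancel₀ hba.ne' (add_right_cancel (hγinj (hmem s hs) (hmem t ht) hst))
    obtain ⟨ε, hε, hrel⟩ := (he k).exists_isTraversal_of_image_eq (hinj k) hseg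
      ((image_of_eqOn_comp_affine hab hext).1.trans hk)
    exact (hp k hε).congr hrel

theorem of_isSubdivision {y z : M} {γ : PAPath E y z} {V : Set ℝ} (hV : IsSubdivision V)
    (hγ : ∀ a b (ha : 0 ≤ a) (hab : a < b) (hb : b ≤ 1), IsGap V a b →
      ClosesUpIn p H (γ.segment ha hab hb)) : ClosesUpIn p H γ := by
  have h01 := hV.induction
    (Q := fun a b => ∀ (ha : 0 ≤ a) (hab : a < b) (hb : b ≤ 1),
      ClosesUpIn p H (γ.segment ha hab hb))
    (fun a b hgap ha hab hb => hγ a b ha hab hb hgap)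
    fun a _ v _ b _ hav hvb h₁ h₂ ha _ hb =>
      ((h₁ ha hav (hvb.le.trans hb)).trans (h₂ (ha.trans hav.le) hvb hb)).congr
        (PAPath.rel_symm (γ.segment_rel_trans ha hav hvb hb))
  refine (h01 le_rfl one_pos le_rfl).congr_extend fun s hs => ?_
  rw [γ.segment_extend _ _ _ hs, sub_zero, one_mul, add_zero]

theorem loopClass_mem {γ : PAPath E x x} (h : ClosesUpIn p H γ) (hx : x ∈ A)
    (hroot : elementarySetoid E x x (p x hx) (PAPath.refl x)) : loopClass γ ∈ H := by
  obtain ⟨_, hmem⟩ := h hx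
  rwa [PAPath.loopClass_eq (PAPath.rel_tr (PAPath.closeUp_rel hroot
    ((elementarySetoid E _ _).refl _) hroot) (PAPath.closeUp_refl_rel _))] at hmem

end ClosesUpIn

/-- The independent loops close up the edges off a maximal tree by paths in the tree. -/
theorem exists_independentLoops [T2Space M] [CompleteSpace E] [IsManifold 𝓘(ℝ, E) ω M]
    {ι : Type*} [Finite ι] {x : M} (γ : ι → PAPath E x x) :
    ∃ (n : ℕ) (β : Fin n → PAPath E x x), IndependentLoops β ∧
      ∀ i, loopClass (γ i) ∈ generatedSubgroup β := by
  obtain ⟨m, e, he, hinj, hinter, hγ⟩ := exists_graph γ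
  have hg : IsGraph E e (⋃ k, e k '' Icc 0 1) := ⟨he, hinter, rfl⟩
  obtain ⟨A, T, p, htree, hmax⟩ := IsRootedTree.exists_maximal he x
  let ν := Finite.equivFin {k | k ∉ T ∧ e k 0 ∈ A}
  let κ : Fin _ → Fin m := fun i => ν.symm i
  have hκT : ∀ i, κ i ∉ T := fun i => (ν.symm i).2.1
  have h0 : ∀ i, e (κ i) 0 ∈ A := fun i => (ν.symm i).2.2
  have h1 : ∀ i, e (κ i) 1 ∈ A := fun i => (hmax _).1 (h0 i)
  have hκ : ∀ k ∉ T, e k 0 ∈ A → ∃ i, κ i = k := fun k hk hk0 =>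
    ⟨ν ⟨k, hk, hk0⟩, congrArg Subtype.val (ν.symm_apply_apply _)⟩
  let β := fun i => (p _ (h0 i)).closeUp (he (κ i)).path (p _ (h1 i))
  choose R hκR hRT hR using fun i => htree.exists_range_closeUp (h0 i) (h1 i)
  refine ⟨_, β, hg.independentLoops hR hκR (fun i j hji hij => ?_)
    (fun i s hs => htree.existsUnique_closeUp hg (hκT i) (hinj _) (h0 i) (h1 i) hs), fun i => ?_⟩
  · rcases hRT j hij with hij | hiT
    exacts [hji (ν.symm.injective (Subtype.ext hij.symm)), hκT i hiT]
  have hgen : ∀ k hk0 hk1,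
      loopClass ((p (e k 0) hk0).closeUp (he k).path (p (e k 1) hk1)) ∈ generatedSubgroup β := by
    intro k hk0 hk1
    by_cases hk : k ∈ T
    · obtain ⟨_, _, hrel⟩ := htree.edge k hk
      rw [PAPath.loopClass_closeUp_eq_one hrel]
      exact one_mem _
    · obtain ⟨j, rfl⟩ := hκ k hk hk0
      exact Subgroup.subset_closure ⟨j, rfl⟩
  obtain ⟨V, hV, hpiece⟩ := hγ i
  exact ClosesUpIn.loopClass_mem (.of_isSubdivision hV fun a b ha hab hb hgap =>
    .segment_of_edges hinj (fun k _ _ _ => .of_isTraversal (hmax k) (hgen k)) ha hab hb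
      (hpiece a b hgap)) htree.root_mem htree.root

end SpanningTree

/-! ### Fourier expansion on compact groups -/

section Characters

variable {G : Type*} [Group G] [TopologicalSpace G]

/-- Characters as continuous complex-valued functions, multiplicatively: the trigonometric
polynomials are the linear combinations of its values. -/
noncomputable def charMap : PontryaginDual G →* C(G, ℂ) where
  toFun χ := ⟨fun g => (χ g : ℂ), by fun_prop⟩
  map_one' := rfl
  map_mul' χ ψ := ContinuousMap.ext fun g => Circle.coe_mul (χ g) (ψ g)

/-- By the Stone–Weierstrass theorem: the span is a star algebra, as products and conjugates of
characters are characters. -/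
theorem span_charMap_closure_eq_top [CompactSpace G] {S : Subgroup (PontryaginDual G)}
    (hS : ∀ g h : G, g ≠ h → ∃ χ ∈ S, χ g ≠ χ h) :
    (Submodule.span ℂ (charMap '' (S : Set (PontryaginDual G)))).topologicalClosure = ⊤ := by
  let A : StarSubalgebra ℂ C(G, ℂ) :=
    { toSubalgebra := Algebra.adjoin ℂ (charMap '' (S : Set (PontryaginDual G)))
      star_mem' := by
        change Algebra.adjoin ℂ _ ≤ star (Algebra.adjoin ℂ _)
        refine Algebra.adjoin_le ?_
        rintro _ ⟨χ, hχ, rfl⟩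
        refine Algebra.subset_adjoin ⟨χ⁻¹, S.inv_mem hχ, ?_⟩
        exact ContinuousMap.ext fun g => Circle.coe_inv_eq_conj (χ g) }
  have hA : Subalgebra.toSubmodule A.toSubalgebra =
      Submodule.span ℂ (charMap '' (S : Set (PontryaginDual G))) := by
    change Subalgebra.toSubmodule (Algebra.adjoin ℂ _) = _
    rw [Algebra.adjoin_eq_span, show charMap '' (S : Set (PontryaginDual G)) =
      (S.toSubmonoid.map charMap : Submonoid C(G, ℂ)) from rfl, Submonoid.closure_eq]
  have hsep : A.SeparatesPoints := fun g h hgh => by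
    obtain ⟨χ, hχ, hne⟩ := hS g h hgh
    exact ⟨_, ⟨charMap χ, Algebra.subset_adjoin ⟨χ, hχ, rfl⟩, rfl⟩, mt Circle.ext hne⟩
  rw [← hA]
  exact congrArg (fun B : StarSubalgebra ℂ C(G, ℂ) => Subalgebra.toSubmodule B.toSubalgebra)
    (ContinuousMap.starSubalgebra_topologicalClosure_eq_top_of_separatesPoints A hsep)

end Characters

section Haar

variable {G G' G'' : Type*}
  [Group G] [TopologicalSpace G] [IsTopologicalGroup G] [CompactSpace G]
  [MeasurableSpace G] [BorelSpace G]
  [Group G'] [TopologicalSpace G'] [IsTopologicalGroup G'] [CompactSpace G']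
  [MeasurableSpace G'] [BorelSpace G']
  [Group G''] [TopologicalSpace G''] [IsTopologicalGroup G''] [CompactSpace G'']
  [MeasurableSpace G''] [BorelSpace G'']

instance : (normHaar G).IsHaarMeasure :=
  inferInstanceAs (Measure.haarMeasure _).IsHaarMeasure

instance : (normHaar G).Regular :=
  inferInstanceAs (Measure.haarMeasure _).Regular

instance : IsProbabilityMeasure (normHaar G) :=
  ⟨Measure.haarMeasure_self (K₀ := (⊤ : TopologicalSpace.PositiveCompacts G))⟩

theorem measurePreserving_normHaar {π : G' →* G} (hπ : Continuous π)
    (hsurj : Function.Surjective π) : MeasurePreserving π (normHaar G') (normHaar G) := by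
  refine ⟨hπ.measurable, ?_⟩
  have : ((normHaar G').map π).IsHaarMeasure :=
    Measure.isHaarMeasure_map_of_isFiniteMeasure (normHaar G') π hπ hsurj
  have : IsProbabilityMeasure ((normHaar G').map π) :=
    Measure.isProbabilityMeasure_map hπ.aemeasurable
  exact Measure.isHaarMeasure_eq_of_isProbabilityMeasure _ _

theorem IsPullback.unique {π : G' → G} {i j : HaarL2 G → HaarL2 G'} (hi : IsPullback π i)
    (hj : IsPullback π j) (ψ : HaarL2 G) : i ψ = j ψ :=
  Lp.ext ((hi ψ).trans (hj ψ).symm)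

theorem isPullback_id : IsPullback (id : G → G) (id : HaarL2 G → HaarL2 G) :=
  fun _ => Filter.EventuallyEq.rfl

theorem IsPullback.comp {π : G' → G} {π' : G'' → G'} {i : HaarL2 G → HaarL2 G'}
    {i' : HaarL2 G' → HaarL2 G''} (hi : IsPullback π i) (hi' : IsPullback π' i')
    (hπ' : MeasurePreserving π' (normHaar G'') (normHaar G')) :
    IsPullback (π ∘ π') (i' ∘ i) := by
  intro ψ
  have hi_comp : (i ψ : G' → ℂ) ∘ π' =ᵐ[normHaar G''] (fun H => ψ (π H)) ∘ π' :=
    hπ'.quasiMeasurePreserving.ae_eq_comp (hi ψ)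
  exact (hi' (i ψ)).trans hi_comp

theorem exists_isometry_isPullback {π : G' → G}
    (hπ : MeasurePreserving π (normHaar G') (normHaar G)) :
    ∃ i : HaarL2 G →ₗᵢ[ℂ] HaarL2 G', IsPullback π i :=
  ⟨Lp.compMeasurePreservingₗᵢ ℂ π hπ, fun ψ => Lp.coeFn_compMeasurePreserving ψ hπ⟩

theorem exists_unitary_isPullback (e : G' ≃ₜ* G) :
    ∃ U : HaarL2 G ≃ₗᵢ[ℂ] HaarL2 G', IsPullback e U := by
  have he : MeasurePreserving e (normHaar G') (normHaar G) :=
    measurePreserving_normHaar (π := (e : G' →* G)) e.continuous e.surjective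
  have he' : MeasurePreserving e.symm (normHaar G) (normHaar G') :=
    measurePreserving_normHaar (π := (e.symm : G →* G')) e.symm.continuous e.symm.surjective
  obtain ⟨i, hi⟩ := exists_isometry_isPullback he
  obtain ⟨j, hj⟩ := exists_isometry_isPullback he'
  have hij : IsPullback id (i ∘ j) := by
    simpa only [show e.symm ∘ e = id from funext e.symm_apply_apply] using hj.comp hi he
  exact ⟨LinearIsometryEquiv.ofSurjective i fun ψ => ⟨j ψ, hij.unique isPullback_id ψ⟩, hi⟩

/-- A character as an element of `L²(G)`. -/
noncomputable def charLp (χ : PontryaginDual G) : HaarL2 G :=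
  ContinuousMap.toLp 2 (normHaar G) ℂ (charMap χ)

theorem coeFn_charLp (χ : PontryaginDual G) :
    (charLp χ : G → ℂ) =ᵐ[normHaar G] fun g => (χ g : ℂ) :=
  ContinuousMap.coeFn_toLp (normHaar G) (charMap χ)

theorem IsPullback.map_charLp {π : G' → G} {i : HaarL2 G → HaarL2 G'} (hi : IsPullback π i)
    (hπ : MeasurePreserving π (normHaar G') (normHaar G)) {χ : PontryaginDual G}
    {χ' : PontryaginDual G'} (h : ∀ g, χ' g = χ (π g)) : i (charLp χ) = charLp χ' := by
  refine Lp.ext ?_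
  filter_upwards [hi (charLp χ), hπ.quasiMeasurePreserving.ae_eq_comp (coeFn_charLp χ),
    coeFn_charLp χ'] with g hg hg' hg''
  rw [hg, hg'', h]
  exact hg'

theorem inner_charLp (χ : PontryaginDual G) (ψ : HaarL2 G) :
    inner ℂ (charLp χ) ψ = ∫ g, conj (χ g : ℂ) * ψ g ∂normHaar G := by
  rw [L2.inner_def]
  refine integral_congr_ae ?_
  filter_upwards [coeFn_charLp χ] with g hg
  rw [hg, RCLike.inner_apply, mul_comm]

theorem inner_charLp_charLp (χ ψ : PontryaginDual G) :
    inner ℂ (charLp χ) (charLp ψ) = ∫ g, ((χ⁻¹ * ψ) g : ℂ) ∂normHaar G := by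
  rw [inner_charLp]
  refine integral_congr_ae ?_
  filter_upwards [coeFn_charLp ψ] with g hg
  rw [hg, ← Circle.coe_inv_eq_conj, ← Circle.coe_mul]
  rfl

/-- Translating by `a` multiplies the integral by `χ a`, which is not `1` for a suitable `a`. -/
theorem integral_char_eq_zero {χ : PontryaginDual G} (hχ : χ ≠ 1) :
    ∫ g, (χ g : ℂ) ∂normHaar G = 0 := by
  obtain ⟨a, ha⟩ : ∃ a, χ a ≠ 1 := by
    by_contra! h
    exact hχ (PontryaginDual.ext h)
  have htranslate : (χ a : ℂ) * ∫ g, (χ g : ℂ) ∂normHaar G = ∫ g, (χ g : ℂ) ∂normHaar G := by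
    rw [← integral_const_mul, ← integral_mul_left_eq_self (fun g => (χ g : ℂ)) a]
    simp only [map_mul, Circle.coe_mul]
  have hfactor : ((χ a : ℂ) - 1) * ∫ g, (χ g : ℂ) ∂normHaar G = 0 := by
    rw [sub_mul, one_mul, htranslate, sub_self]
  exact (mul_eq_zero.1 hfactor).resolve_left (sub_ne_zero.2 (mt Circle.coe_eq_one.1 ha))

theorem orthonormal_charLp : Orthonormal ℂ (charLp (G := G)) := by
  classical
  refine orthonormal_iff_ite.2 fun χ ψ => ?_
  rw [inner_charLp_charLp]
  split_ifs with h
  · simp [h]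
  · exact integral_char_eq_zero (mt inv_mul_eq_one.1 h)

theorem span_charLp_closure_eq_top {S : Subgroup (PontryaginDual G)}
    (hS : ∀ g h : G, g ≠ h → ∃ χ ∈ S, χ g ≠ χ h) :
    (Submodule.span ℂ (charLp '' (S : Set (PontryaginDual G)))).topologicalClosure = ⊤ := by
  have h := (ContinuousMap.toLp_denseRange ℂ (normHaar G) ℂ
    (p := 2) (by simp)).topologicalClosure_map_submodule (span_charMap_closure_eq_top hS)
  rw [← h, Submodule.map_span, ← image_comp]
  rfl

theorem exists_unitary_fourier_coefficients {κ : Type*} {χ : κ → PontryaginDual G}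
    (hinj : Function.Injective χ) {S : Subgroup (PontryaginDual G)}
    (hS : ∀ g h : G, g ≠ h → ∃ χ ∈ S, χ g ≠ χ h)
    (hχ : (S : Set (PontryaginDual G)) ⊆ range χ) :
    ∃ F : HaarL2 G ≃ₗᵢ[ℂ] DiscreteL2 κ, ∀ ψ k,
      F ψ k = ∫ g, conj (χ k g : ℂ) * ψ g ∂normHaar G := by
  have horth : Orthonormal ℂ (charLp ∘ χ) := orthonormal_charLp.comp χ hinj
  have hspan : ⊤ ≤ (Submodule.span ℂ (range (charLp ∘ χ))).topologicalClosure := by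
    rw [← span_charLp_closure_eq_top hS, range_comp]
    exact Submodule.topologicalClosure_mono (Submodule.span_mono (image_mono hχ))
  refine ⟨(HilbertBasis.mk horth hspan).repr, fun ψ k => ?_⟩
  rw [HilbertBasis.repr_apply_apply, HilbertBasis.coe_mk, Function.comp_apply, inner_charLp]

end Haar

/-! ### Inductive limits -/

section Limits

variable {J : Type*} [PartialOrder J]
  {𝓗 : J → Type*} [∀ a, NormedAddCommGroup (𝓗 a)] [∀ a, InnerProductSpace ℂ (𝓗 a)]
  {𝓗' : J → Type*} [∀ a, NormedAddCommGroup (𝓗' a)] [∀ a, InnerProductSpace ℂ (𝓗' a)]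
  {𝓚 : Type*} [NormedAddCommGroup 𝓚] [InnerProductSpace ℂ 𝓚]
  {𝓚' : Type*} [NormedAddCommGroup 𝓚'] [InnerProductSpace ℂ 𝓚']
  {i : ∀ a b, a ≤ b → 𝓗 a →ₗᵢ[ℂ] 𝓗 b} {ι : ∀ a, 𝓗 a →ₗᵢ[ℂ] 𝓚}
  {i' : ∀ a b, a ≤ b → 𝓗' a →ₗᵢ[ℂ] 𝓗' b} {ι' : ∀ a, 𝓗' a →ₗᵢ[ℂ] 𝓚'}
  {φ : ∀ a, 𝓗 a ≃ₗᵢ[ℂ] 𝓗' a} {Φ : 𝓚 ≃ₗᵢ[ℂ] 𝓚'}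

theorem IsInductiveFamily.isInductiveLimit_of_span [CompleteSpace 𝓚] (h : IsInductiveFamily i)
    (hι : ∀ a b (hab : a ≤ b) x, ι b (i a b hab x) = ι a x) {S : Set 𝓚}
    (hS : S ⊆ ⋃ a, range (ι a)) (hdense : (Submodule.span ℂ S).topologicalClosure = ⊤) :
    IsInductiveLimit i ι := by
  have := h.nonempty
  have hle : ∀ a b, a ≤ b →
      LinearMap.range (ι a).toLinearMap ≤ LinearMap.range (ι b).toLinearMap := by
    rintro a b hab _ ⟨x, rfl⟩
    exact ⟨i a b hab x, hι a b hab x⟩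
  have hdir : Directed (· ≤ ·) fun a => LinearMap.range (ι a).toLinearMap := fun a b =>
    let ⟨c, hac, hbc⟩ := h.directed a b
    ⟨c, hle a c hac, hle b c hbc⟩
  have hunion : ((⨆ a, LinearMap.range (ι a).toLinearMap : Submodule ℂ 𝓚) : Set 𝓚) =
      ⋃ a, range (ι a) := Submodule.coe_iSup_of_directed _ hdir
  refine ⟨h, inferInstance, hι, _, hunion, ?_⟩
  rw [Submodule.dense_iff_topologicalClosure_eq_top, eq_top_iff, ← hdense]
  refine Submodule.topologicalClosure_mono (Submodule.span_le.2 ?_)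
  rwa [hunion]

theorem IsInductiveFamily.transport (h : IsInductiveFamily i)
    (hi : ∀ a b (hab : a ≤ b) x, i' a b hab (φ a x) = φ b (i a b hab x)) :
    IsInductiveFamily i' where
  nonempty := h.nonempty
  directed := h.directed
  id a x := by
    obtain ⟨y, rfl⟩ := (φ a).surjective x
    rw [hi, h.id]
  comp a b c hab hbc x := by
    obtain ⟨y, rfl⟩ := (φ a).surjective x
    rw [hi, hi, hi, h.comp]

theorem IsInductiveLimit.transport (h : IsInductiveLimit i ι)
    (hi : ∀ a b (hab : a ≤ b) x, i' a b hab (φ a x) = φ b (i a b hab x))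
    (hι : ∀ a x, ι' a (φ a x) = Φ (ι a x)) : IsInductiveLimit i' ι' where
  family := h.family.transport hi
  complete := (completeSpace_congr (e := Φ.toEquiv) Φ.isometry.isUniformEmbedding).1 h.complete
  compat a b hab x := by
    obtain ⟨y, rfl⟩ := (φ a).surjective x
    rw [hi, hι, hι, h.compat]
  dense := by
    obtain ⟨V, hV, hVdense⟩ := h.dense
    refine ⟨V.map Φ.toLinearEquiv.toLinearMap, ?_,
      Φ.surjective.denseRange.dense_image Φ.continuous hVdense⟩
    calc Φ '' (V : Set 𝓚) = ⋃ a, range (Φ ∘ ι a) := by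
          simp only [hV, image_iUnion, range_comp]
      _ = ⋃ a, range (ι' a ∘ φ a) :=
          iUnion_congr fun a => congrArg range (funext fun x => (hι a x).symm)
      _ = ⋃ a, range (ι' a) := iUnion_congr fun a => (φ a).surjective.range_comp (ι' a)

theorem IsInductiveLimit.isInductiveLimitOfUnitaries (h : IsInductiveLimit i ι)
    (hi : ∀ a b (hab : a ≤ b) x, i' a b hab (φ a x) = φ b (i a b hab x))
    (hι : ∀ a x, ι' a (φ a x) = Φ (ι a x)) : IsInductiveLimitOfUnitaries i i' ι ι' φ Φ := by
  refine ⟨hi, fun a x => (hι a x).symm, fun Ψ hΨ => ?_⟩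
  obtain ⟨V, hV, hVdense⟩ := h.dense
  refine DFunLike.coe_injective (Ψ.continuous.ext_on hVdense Φ.continuous fun y hy => ?_)
  rw [hV] at hy
  obtain ⟨a, x, rfl⟩ := mem_iUnion.1 hy
  rw [hΨ, hι]

end Limits

section Conjugation

variable {𝓗₁ 𝓗₂ 𝓗₁' 𝓗₂' : Type*}
  [NormedAddCommGroup 𝓗₁] [InnerProductSpace ℂ 𝓗₁]
  [NormedAddCommGroup 𝓗₂] [InnerProductSpace ℂ 𝓗₂]
  [NormedAddCommGroup 𝓗₁'] [InnerProductSpace ℂ 𝓗₁']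
  [NormedAddCommGroup 𝓗₂'] [InnerProductSpace ℂ 𝓗₂']

/-- The isometry `φ₂ ∘ i ∘ φ₁⁻¹`, which carries an inclusion over to the Fourier side. -/
noncomputable def conjIsometry (φ₁ : 𝓗₁ ≃ₗᵢ[ℂ] 𝓗₁') (φ₂ : 𝓗₂ ≃ₗᵢ[ℂ] 𝓗₂') (i : 𝓗₁ →ₗᵢ[ℂ] 𝓗₂) :
    𝓗₁' →ₗᵢ[ℂ] 𝓗₂' :=
  φ₂.toLinearIsometry.comp (i.comp φ₁.symm.toLinearIsometry)

theorem conjIsometry_apply_apply (φ₁ : 𝓗₁ ≃ₗᵢ[ℂ] 𝓗₁') (φ₂ : 𝓗₂ ≃ₗᵢ[ℂ] 𝓗₂') (i : 𝓗₁ →ₗᵢ[ℂ] 𝓗₂)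
    (x : 𝓗₁) : conjIsometry φ₁ φ₂ i (φ₁ x) = φ₂ (i x) :=
  congrArg (φ₂ <| i ·) (φ₁.symm_apply_apply x)

end Conjugation

/-! ### Restriction and evaluation of generalized connections -/

namespace HomU1

variable {Λ : Type*} [Group Λ]

theorem continuous_of_eval {X : Type*} [TopologicalSpace X] {f : X → HomU1 Λ}
    (h : ∀ g, Continuous fun x => f x g) : Continuous f :=
  continuous_induced_rng.2 (continuous_pi h)

theorem measurePreserving_restrict {L : Subgroup Λ} (hL : Function.Surjective (restrict L)) :
    MeasurePreserving (restrict L) (normHaar (HomU1 Λ)) (normHaar (HomU1 L)) :=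
  measurePreserving_normHaar (π := MonoidHom.mk' (restrict L) fun _ _ => rfl)
    (continuous_of_eval fun g => continuous_eval (g : Λ)) hL

theorem measurePreserving_restrictLE {L L' : Subgroup Λ} (h : L ≤ L')
    (hL : Function.Surjective (restrictLE h)) :
    MeasurePreserving (restrictLE h) (normHaar (HomU1 L')) (normHaar (HomU1 L)) :=
  measurePreserving_normHaar (π := MonoidHom.mk' (restrictLE h) fun _ _ => rfl)
    (continuous_of_eval fun g => continuous_eval (Subgroup.inclusion h g)) hL

theorem restrictLE_surjective {L L' : Subgroup Λ} (h : L ≤ L')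
    (hL : Function.Surjective (restrict L)) : Function.Surjective (restrictLE h) := fun H =>
  let ⟨H', hH'⟩ := hL H
  ⟨restrict L' H', hH'⟩

theorem exists_wilson_ne {H H' : HomU1 Λ} (h : H ≠ H') :
    ∃ χ ∈ (wilson (G := Λ)).range, χ H ≠ χ H' := by
  obtain ⟨α, hα⟩ := DFunLike.ne_iff.1 h
  exact ⟨wilson α, ⟨α, rfl⟩, hα⟩

theorem exists_isFourierTransform (Λ : Type*) [Group Λ] :
    ∃ F : HaarL2 (HomU1 Λ) ≃ₗᵢ[ℂ] DiscreteL2 (PontryaginDual (HomU1 Λ)), IsFourierTransform F :=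
  exists_unitary_fourier_coefficients Function.injective_id (fun _ _ => exists_wilson_ne)
    (subset_univ _ |>.trans_eq range_id.symm)

theorem isInductiveLimit_of_isPullback {J : Type*} [PartialOrder J] [Nonempty J]
    {L : J → Subgroup Λ} (hmono : Monotone L) (hdir : ∀ a b : J, ∃ c, a ≤ c ∧ b ≤ c)
    (hcover : ∀ α, ∃ a, α ∈ L a) (hsurj : ∀ a, Function.Surjective (restrict (L a)))
    {i : ∀ a b, a ≤ b → HaarL2 (HomU1 (L a)) →ₗᵢ[ℂ] HaarL2 (HomU1 (L b))}
    {ι : ∀ a, HaarL2 (HomU1 (L a)) →ₗᵢ[ℂ] HaarL2 (HomU1 Λ)}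
    (hi : ∀ a b (h : a ≤ b), IsPullback (restrictLE (hmono h)) (i a b h))
    (hι : ∀ a, IsPullback (restrict (L a)) (ι a)) : IsInductiveLimit i ι := by
  have hπ a := measurePreserving_restrict (hsurj a)
  have hπLE {a b} (h : a ≤ b) :=
    measurePreserving_restrictLE (hmono h) (restrictLE_surjective _ (hsurj a))
  have hfamily : IsInductiveFamily i :=
    { nonempty := inferInstance
      directed := hdir
      id := fun a ψ => (hi a a le_rfl).unique isPullback_id ψ
      comp := fun a b c hab hbc ψ =>
        ((hi a b hab).comp (hi b c hbc) (hπLE hbc)).unique (hi a c (hab.trans hbc)) ψ }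
  refine hfamily.isInductiveLimit_of_span
    (fun a b h ψ => ((hi a b h).comp (hι b) (hπ b)).unique (hι a) ψ) ?_
    (span_charLp_closure_eq_top fun _ _ => exists_wilson_ne)
  rintro _ ⟨_, ⟨α, rfl⟩, rfl⟩
  obtain ⟨a, ha⟩ := hcover α
  exact mem_iUnion.2 ⟨a, charLp (wilson ⟨α, ha⟩), (hι a).map_charLp (hπ a) fun _ => rfl⟩

end HomU1

instance (n : ℕ) : T2Space (Torus n) := inferInstanceAs (T2Space (Fin n → Circle))

section Loops

variable {E : Type*} [NormedAddCommGroup E] [NormedSpace ℝ E]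
  {M : Type*} [TopologicalSpace M] [ChartedSpace E M] {x : M}

theorem exists_isLoopTransform (x : M) :
    ∃ T : HaarL2 (GenConn E x) ≃ₗᵢ[ℂ] DiscreteL2 (HoopGroup E x), IsLoopTransform T := by
  obtain ⟨T, hT⟩ := exists_unitary_fourier_coefficients
    (χ := fun T : HoopGroup E x => (T : PontryaginDual (GenConn E x))) Subtype.val_injective
    (fun _ _ => HomU1.exists_wilson_ne) Subtype.range_val.ge
  exact ⟨T, fun ψ α => hT ψ (hoop α)⟩

theorem HomU1.eq_of_eq_on_generators {n : ℕ} {β : Fin n → PAPath E x x}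
    {H H' : HomU1 (generatedSubgroup β)}
    (h : ∀ k, H ⟨loopClass (β k), Subgroup.subset_closure (mem_range_self k)⟩ =
      H' ⟨loopClass (β k), Subgroup.subset_closure (mem_range_self k)⟩) : H = H' := by
  refine MonoidHom.eq_of_eqOn_dense (Subgroup.closure_closure_coe_preimage
    (k := range fun k => loopClass (β k))) ?_
  rintro ⟨_, _⟩ ⟨k, rfl⟩
  exact h k

theorem IndependentLoops.exists_evalEquiv [T2Space M] {n : ℕ} {β : Fin n → PAPath E x x}
    (hβ : IndependentLoops β) :
    ∃ e : HomU1 (generatedSubgroup β) ≃ₜ* Torus n,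
      ∀ H k, e H k = H ⟨loopClass (β k), Subgroup.subset_closure (mem_range_self k)⟩ := by
  let ev : HomU1 (generatedSubgroup β) →* Torus n := MonoidHom.mk'
    (fun H k => H ⟨loopClass (β k), Subgroup.subset_closure (mem_range_self k)⟩) fun _ _ => rfl
  have hbij : Function.Bijective ev := by
    refine ⟨fun H H' h => HomU1.eq_of_eq_on_generators (congrFun h), fun z => ?_⟩
    obtain ⟨H, hH⟩ := hβ.exists_hom_circle z
    exact ⟨HomU1.restrict _ H, funext hH⟩
  have hcont : Continuous ev := continuous_pi fun k => HomU1.continuous_eval _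
  have hcont' : Continuous (Equiv.ofBijective ev hbij) := hcont
  exact ⟨{ MulEquiv.ofBijective ev hbij with
    continuous_toFun := hcont
    continuous_invFun := hcont'.continuous_symm_of_equiv_compact_to_t2 }, fun _ _ => rfl⟩

namespace LoopIndex

theorem restrict_surjective [T2Space M] (L : LoopIndex E x) :
    Function.Surjective (HomU1.restrict L.1) := by
  obtain ⟨_, n, β, hβ, rfl⟩ := L
  intro H
  obtain ⟨H', hH'⟩ := hβ.exists_hom_circle fun k =>
    H ⟨loopClass (β k), Subgroup.subset_closure (mem_range_self k)⟩
  exact ⟨H', HomU1.eq_of_eq_on_generators hH'⟩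

variable [T2Space M] [CompleteSpace E] [IsManifold 𝓘(ℝ, E) ω M]

theorem exists_le_le (L L' : LoopIndex E x) : ∃ L'' : LoopIndex E x, L ≤ L'' ∧ L' ≤ L'' := by
  obtain ⟨_, n, β, -, rfl⟩ := L
  obtain ⟨_, n', β', -, rfl⟩ := L'
  obtain ⟨m, δ, hδ, hmem⟩ := exists_independentLoops (Sum.elim β β')
  refine ⟨⟨generatedSubgroup δ, m, δ, hδ, rfl⟩, (Subgroup.closure_le _).2 ?_,
    (Subgroup.closure_le _).2 ?_⟩
  · exact range_subset_iff.2 fun k => hmem (Sum.inl k)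
  · exact range_subset_iff.2 fun k => hmem (Sum.inr k)

theorem exists_mem (α : LoopGroup E x) : ∃ L : LoopIndex E x, α ∈ L.1 := by
  obtain ⟨γ, rfl⟩ := Quotient.exists_rep α
  obtain ⟨m, δ, hδ, hmem⟩ := exists_independentLoops fun _ : Unit => γ
  exact ⟨⟨generatedSubgroup δ, m, δ, hδ, rfl⟩, hmem ()⟩

instance : Nonempty (LoopIndex E x) :=
  ⟨(exists_mem 1).choose⟩

end LoopIndex

end Loops

theorem mainTheorem1_general {E : Type*} [NormedAddCommGroup E] [NormedSpace ℝ E] [CompleteSpace E]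
    {M : Type*} [TopologicalSpace M] [T2Space M] [ChartedSpace E M] [IsManifold 𝓘(ℝ, E) ω M]
    (x : M) :
    (∀ (n : ℕ) (β : Fin n → PAPath E x x), IndependentLoops β →
      ∃ e : HomU1 (generatedSubgroup β) ≃ₜ* Torus n,
        (∀ H k, e H k = H ⟨loopClass (β k), Subgroup.subset_closure (mem_range_self k)⟩) ∧
        ∃ U : HaarL2 (Torus n) ≃ₗᵢ[ℂ] HaarL2 (HomU1 (generatedSubgroup β)), IsPullback e U) ∧
    ∃ (i : ∀ L L' : LoopIndex E x, L ≤ L' → HaarL2 (GenConnAt E L) →ₗᵢ[ℂ] HaarL2 (GenConnAt E L'))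
      (iLim : ∀ L : LoopIndex E x, HaarL2 (GenConnAt E L) →ₗᵢ[ℂ] HaarL2 (GenConn E x))
      (F : ∀ L : LoopIndex E x,
        HaarL2 (GenConnAt E L) ≃ₗᵢ[ℂ] DiscreteL2 (PontryaginDual (GenConnAt E L)))
      (T : HaarL2 (GenConn E x) ≃ₗᵢ[ℂ] DiscreteL2 (HoopGroup E x))
      (j : ∀ L L' : LoopIndex E x, L ≤ L' → DiscreteL2 (PontryaginDual (GenConnAt E L)) →ₗᵢ[ℂ]
        DiscreteL2 (PontryaginDual (GenConnAt E L')))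
      (jLim : ∀ L : LoopIndex E x,
        DiscreteL2 (PontryaginDual (GenConnAt E L)) →ₗᵢ[ℂ] DiscreteL2 (HoopGroup E x)),
      (∀ (L L' : LoopIndex E x) (h : L ≤ L'),
        IsPullback (HomU1.restrictLE (Subtype.coe_le_coe.2 h)) (i L L' h)) ∧
      (∀ L, IsPullback (HomU1.restrict L.1) (iLim L)) ∧
      (∀ L, IsFourierTransform (F L)) ∧
      IsLoopTransform T ∧
      (∀ L L' (h : L ≤ L') ψ, j L L' h (F L ψ) = F L' (i L L' h ψ)) ∧
      (∀ L ψ, jLim L (F L ψ) = T (iLim L ψ)) ∧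
      IsInductiveLimit i iLim ∧
      IsInductiveLimit j jLim ∧
      IsInductiveLimitOfUnitaries i j iLim jLim F T := by
  refine ⟨fun n β hβ => ?_, ?_⟩
  · obtain ⟨e, he⟩ := hβ.exists_evalEquiv
    exact ⟨e, he, exists_unitary_isPullback e⟩
  choose i hi using fun (L L' : LoopIndex E x) (h : L ≤ L') =>
    exists_isometry_isPullback <| HomU1.measurePreserving_restrictLE (Subtype.coe_le_coe.2 h) <|
      HomU1.restrictLE_surjective _ L.restrict_surjective
  choose iLim hiLim using fun L : LoopIndex E x =>
    exists_isometry_isPullback (HomU1.measurePreserving_restrict L.restrict_surjective)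
  choose F hF using fun L : LoopIndex E x => HomU1.exists_isFourierTransform L.1
  obtain ⟨T, hT⟩ := exists_isLoopTransform (E := E) x
  have hlim : IsInductiveLimit i iLim := HomU1.isInductiveLimit_of_isPullback
    (Subtype.mono_coe _) LoopIndex.exists_le_le LoopIndex.exists_mem
    LoopIndex.restrict_surjective hi hiLim
  have hj L L' h ψ := conjIsometry_apply_apply (F L) (F L') (i L L' h) ψ
  have hjLim L ψ := conjIsometry_apply_apply (F L) T (iLim L) ψ
  exact ⟨i, iLim, F, T, _, _, hi, hiLim, hF, hT, hj, hjLim, hlim, hlim.transport hj hjLim,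
    hlim.isInductiveLimitOfUnitaries hj hjLim⟩

theorem mainTheorem1 {E : Type*} [NormedAddCommGroup E] [NormedSpace ℝ E] [FiniteDimensional ℝ E]
    {M : Type*} [TopologicalSpace M] [T2Space M] [SecondCountableTopology M] [ChartedSpace E M]
    [IsManifold 𝓘(ℝ, E) ω M] (x : M) :
    -- evaluation on an independent family identifies `Hom(L, U(1))` with a torus,
    -- and the `L²` spaces accordingly
    (∀ (n : ℕ) (β : Fin n → PAPath E x x), IndependentLoops β →
      ∃ e : HomU1 (generatedSubgroup β) ≃ₜ* Torus n,
        (∀ H k, e H k = H ⟨loopClass (β k), Subgroup.subset_closure (mem_range_self k)⟩) ∧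
        ∃ U : HaarL2 (Torus n) ≃ₗᵢ[ℂ] HaarL2 (HomU1 (generatedSubgroup β)), IsPullback e U) ∧
    ∃ (i : ∀ L L' : LoopIndex E x, L ≤ L' → HaarL2 (GenConnAt E L) →ₗᵢ[ℂ] HaarL2 (GenConnAt E L'))
      (iLim : ∀ L : LoopIndex E x, HaarL2 (GenConnAt E L) →ₗᵢ[ℂ] HaarL2 (GenConn E x))
      (F : ∀ L : LoopIndex E x,
        HaarL2 (GenConnAt E L) ≃ₗᵢ[ℂ] DiscreteL2 (PontryaginDual (GenConnAt E L)))
      (T : HaarL2 (GenConn E x) ≃ₗᵢ[ℂ] DiscreteL2 (HoopGroup E x))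
      (j : ∀ L L' : LoopIndex E x, L ≤ L' → DiscreteL2 (PontryaginDual (GenConnAt E L)) →ₗᵢ[ℂ]
        DiscreteL2 (PontryaginDual (GenConnAt E L')))
      (jLim : ∀ L : LoopIndex E x,
        DiscreteL2 (PontryaginDual (GenConnAt E L)) →ₗᵢ[ℂ] DiscreteL2 (HoopGroup E x)),
      -- the inclusions are the pull-backs by the restriction maps
      (∀ (L L' : LoopIndex E x) (h : L ≤ L'),
        IsPullback (HomU1.restrictLE (Subtype.coe_le_coe.2 h)) (i L L' h)) ∧
      (∀ L, IsPullback (HomU1.restrict L.1) (iLim L)) ∧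
      -- the unitary maps are the Fourier transforms and the loop transform
      (∀ L, IsFourierTransform (F L)) ∧
      IsLoopTransform T ∧
      -- the inclusions on the dual side are the transported ones
      (∀ L L' (h : L ≤ L') ψ, j L L' h (F L ψ) = F L' (i L L' h ψ)) ∧
      (∀ L ψ, jLim L (F L ψ) = T (iLim L ψ)) ∧
      -- the three inductive limits
      IsInductiveLimit i iLim ∧
      IsInductiveLimit j jLim ∧
      IsInductiveLimitOfUnitaries i j iLim jLim F T := by
  have : CompleteSpace E := FiniteDimensional.complete ℝ E
  exact mainTheorem1_general x
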